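/- **Setting.** Let $d>0$ be an integer with $d\equiv 0,3 \pmod 4$, let $\mathbb K=\mathbb Q(\sqrt{-d})\subset\mathbb C$, and let $\mathcal O=\mathbb Z\big[\tfrac{d+\sqrt{-d}}2\big]$ be the order of discriminant $-d$ in $\mathbb K$ (every order in an imaginary quadratic field is of this form). Write $\mathbf e(x)=e^{2\pi i x}$, let $\mathcal H$ be the upper half-plane, and let $\operatorname{U}(1,1)(\mathbb Z)$ be the group of $A\in \operatorname{GL}_2(\mathcal O)$ with $A\binom{0\ -1}{1\ \ \ 0}A^*=\binom{0\ -1}{1\ \ \ 0}$; it equals $\mathcal O^\times\cdot\operatorname{SL}_2(\mathbb Z)$. For $A=\binom{a\ b}{c\ d}$ in it put $A\tau=\frac{a\tau+b}{c\tau+d}$, $j(A,\tau)=c\tau+d$, $j_A'=c$, $j^c(A,\tau)=\bar c\tau+\bar d$. A *discriminant form* is a finite abelian group $D$ with a $\mathbb Q/\mathbb Z$-valued quadratic form $\gamma\mapsto\frac{\gamma^2}2$ whose bilinear form $(\cdot,\cdot)$ is non-degenerate. In order that $\operatorname{U}(1,1)(\mathbb Z)$ act on $\mathbb C[D]$, it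 is equipped with an isometric action of $\mathcal O^\times$ in which $-1$ acts as $-1$, and with an integer $s_D$ such that $\sum_{\gamma\in D}\mathbf e(\frac{\gamma^2}2)=i^{s_D}\sqrt{|D|}$. (If $\mathcal O^\times=\{\pm1\}$, this means only that the signature of $D$ is even.) The *Weil representation* $\rho_D$ of $\operatorname{U}(1,1)(\mathbb Z)$ on $\mathbb C[D]$ is given by $$\rho_D\tbinom{1\ 1}{0\ 1}\mathfrak e_\gamma=\mathbf e(\tfrac{\gamma^2}2)\mathfrak e_\gamma,\quad \rho_D\tbinom{0\ -1}{1\ \ \ 0}\mathfrak e_\gamma=\tfrac{i^{-s_D}}{\sqrt{|D|}}\sum_{\delta\in D}\mathbf e(-(\gamma,\delta))\mathfrak e_\delta,\quad \rho_D(\xi I)\mathfrak e_\gamma=\xi^{-s_D}\mathfrak e_{\bar\xi\gamma}\ \ (\xi\in\mathcal O^\times).$$ For $\alpha,\beta\in D$ let $t_\alpha\mathfrak e_\gamma=\mathfrak e_{\gamma-\alpha}$ and $\chi_\beta\mathfrak e_\gamma=\mathbf e((\beta,\gamma))\mathfrak e_\gamma$. For an isotropic subgroup $H$ of a discriminant form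 $A$ let $\downarrow_H:\mathbb C[A]\to\mathbb C[H^\perp/H]$ send $\mathfrak e_\delta$ to $\mathfrak e_{\delta+H}$ if $\delta\in H^\perp$ and to $0$ otherwise. Let $\Gamma\subseteq\operatorname{U}(1,1)(\mathbb Z)$ have finite index. A *modular form* of weight $k\in\mathbb Z$ and representation $\rho_D$ with respect to $\Gamma$ is a smooth $F:\mathcal H\to\mathbb C[D]$ with $F(A\tau)=j(A,\tau)^k\rho_D(A)F(\tau)$ for $A\in\Gamma$ that grows at most linearly exponentially towards the cusps; it is *weakly holomorphic* if it is holomorphic on $\mathcal H$, and *holomorphic* if it is moreover bounded at all cusps (i.e. $(c\tau+d)^{-k}F(A\tau)$ is bounded as $\operatorname{Im}\tau\to\infty$, for every $A\in\operatorname{SL}_2(\mathbb Z)$). **The index.** Let $S$ be a positive semidefinite Hermitian $c_+\times c_+$ matrix over $\mathbb K$, let $b_+$ be its rank, let $\Delta$ be a discriminant form, and let $\psi:\mathcal O^{c_+}\to\Delta$ be a homomorphism with $\psi(a)=0$ whenever $Sa=0$ and $\frac{(\psi a)^2}2=a^*Sa+\mathbb Z$ for all $a$. Put $\Omega=\ker\psi+\ker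 S\subseteq\mathbb K^{c_+}$ (with $\ker S\subseteq\mathbb K^{c_+}$), $\Omega^*=\{a\in\mathbb K^{c_+}:\operatorname{Tr}^{\mathbb K}_{\mathbb Q}(a^*Sb)\in\mathbb Z\ \forall b\in\Omega\}\supseteq\mathcal O^{c_+}$, and $D_\Omega=\Omega^*/\Omega$ with the quadratic form $a+\Omega\mapsto a^*Sa+\mathbb Z$; let $$\Theta_{\Omega,S}(\tau,z,w)=\sum_{\gamma\in D_\Omega}\Big[\sum_{a\in(\gamma+\Omega)/\ker S}\mathbf e(\tau a^*Sa+a^*Sz+w^tSa)\Big]\mathfrak e_\gamma .$$ A *Hermitian Jacobi form* of weight $k$, representation $\rho_\Delta$ and index $(S,\psi)$ with respect to $\Gamma$ is a smooth $\Phi:\mathcal H\times\mathbb C^{c_+}\times\mathbb C^{c_+}\to\mathbb C[\Delta]$, holomorphic in $(z,w)$, such that for all $u,v\in\mathcal O^{c_+}$ and $A\in\Gamma$ $$\Phi(\tau,z+\tau u+v,w+\tau\bar u+\bar v)=\mathbf e(-\tau u^*Su-u^*Sz-w^tSu)\,\chi_{\psi v}t_{\psi u}\Phi(\tau,z,w),$$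 $$\Phi\big(A\tau,\tfrac z{j(A,\tau)},\tfrac w{j^c(A,\tau)}\big)=j(A,\tau)^k\,\mathbf e\big(\tfrac{j_A'\,w^tSz}{j(A,\tau)}\big)\rho_\Delta(A)\Phi(\tau,z,w),$$ and such that the coefficients $f_{\beta,a}$ of the resulting expansion $\Phi=\sum_{\beta\in\Delta}\sum_{a\in\Omega^*/\ker S}f_{\beta,a}(\tau)\,\mathbf e(\tau a^*Sa+a^*Sz+w^tSa)\,\mathfrak e_\beta$ grow at most linearly exponentially towards the cusps. It is *weakly holomorphic* if it is holomorphic in $(\tau,z,w)$, and *holomorphic* if moreover, for every $A=\binom{a\ b}{c\ d}\in\operatorname{SL}_2(\mathbb Z)$, the function $(c\tau+d)^{-k}\mathbf e\big(-\tfrac{c\,w^tSz}{c\tau+d}\big)\Phi\big(A\tau,\tfrac z{c\tau+d},\tfrac w{c\tau+d}\big)$ has a Fourier expansion $\sum_{\beta}\sum_{m,r}C_{\beta,m,r}\,\mathbf e(m\tau+r^*Sz+w^tSr)\,\mathfrak e_\beta$, with $m\in\frac1N\mathbb Z$ for some $N\geq1$ and $r\in\Omega^*/\ker S$, in which $C_{\beta,m,r}\ne0$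 only if $m\ge r^*Sr$. **Assumptions.** The quotient of $\ker\psi$ modulo its intersection with $\ker S$ is an $\mathcal O$-module (equivalently, $\ker\psi$ is stable under $\mathcal O$) and is projective over $\mathcal O$. With $D_{\Omega,S}=(\mathcal O^{c_+}+\Omega)/\Omega$ and $H_\Omega=D_{\Omega,S}^\perp\subseteq D_\Omega$, there are a discriminant form $D$ and an injective homomorphism $\iota:H_\Omega\to D$ with $\frac{\iota(\gamma)^2}2=-\frac{\gamma^2}2$ such that, for the isotropic subgroup $H=\{\gamma+\iota(\gamma):\gamma\in H_\Omega\}$ of $D_\Omega\oplus D$, there is an isomorphism of discriminant forms $\Delta_H:=H^\perp/H\cong\Delta$ that sends the class of $u+\Omega\in D_{\Omega,S}=H_\Omega^\perp$ to $\psi(u)$ for every $u\in\mathcal O^{c_+}$. Here $\iota$ and the isomorphism respect the actions of $\mathcal O^\times$, and $\xi^{s_\Delta}=\xi^{b_++s_D}$ for $\xi\in\mathcal O^\times$ (if $\mathcal O^\times=\{\pm1\}$, both hold automatically). **Theorem.** For every Hermitian Jacobi form $\Phi$ of weight $k$, representation $\rho_\Delta$ and index $(S,\psi)$ with respect to $\Gamma$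 there is a unique modular form $F$ of weight $k-b_+$ and representation $\rho_D$ with respect to $\Gamma$ such that $$\Phi(\tau,z,w)=\ \downarrow_H\big(\Theta_{\Omega,S}(\tau,z,w)\otimes F(\tau)\big)\qquad(\tau\in\mathcal H,\ z,w\in\mathbb C^{c_+}),$$ where $\mathbb C[\Delta_H]$ is identified with $\mathbb C[\Delta]$. Moreover $F$ is weakly holomorphic if and only if $\Phi$ is, and $F$ is holomorphic if and only if $\Phi$ is. -/

import Mathlib

open scoped ContDiff MatrixGroups ComplexOrder Matrix

namespace HermJac

noncomputable section

/-! ### The field, the order, and exponentials -/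

/-- `𝐞(z) = exp(2πiz)`. -/
def cexpo (z : ℂ) : ℂ := Complex.exp (2 * Real.pi * Complex.I * z)

/-- `𝐞(x)` for a class `x` in `ℝ/ℤ`. -/
def qexpo (x : UnitAddCircle) : ℂ := (AddCircle.toCircle x : ℂ)

/-- `√-d = √d · i`. -/
def sqrtNeg (d : ℕ) : ℂ := (Real.sqrt (d : ℝ) : ℂ) * Complex.I

/-- The imaginary quadratic field `𝕂 = ℚ(√-d)` inside `ℂ` (for `d > 0`). -/
def imQuad (d : ℕ) : IntermediateField ℚ ℂ := IntermediateField.adjoin ℚ {sqrtNeg d}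

/-- The order `𝒪 = ℤ[(d + √-d)/2]`. When `d > 0` and `d ≡ 0, 3 (mod 4)` this is the unique
quadratic order of discriminant `-d`, with `ℤ`-basis `1, (d + √-d)/2`; every order in every
imaginary quadratic field is obtained in this way. -/
def qOrder (d : ℕ) : Subring ℂ := Subring.closure {((d : ℂ) + sqrtNeg d) / 2}

theorem qOrder_le_imQuad (d : ℕ) {x : ℂ} (hx : x ∈ qOrder d) : x ∈ imQuad d := by
  have h : qOrder d ≤ (imQuad d).toSubfield.toSubring := by
    refine Subring.closure_le.2 ?_
    rintro y rfl
    have h1 : sqrtNeg d ∈ imQuad d :=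
      IntermediateField.subset_adjoin ℚ {sqrtNeg d} (Set.mem_singleton _)
    have h2 : (d : ℂ) ∈ imQuad d := natCast_mem _ d
    have h3 : (2 : ℂ) ∈ imQuad d := ofNat_mem _ 2
    have h4 : ((d : ℂ) + sqrtNeg d) / 2 ∈ imQuad d := div_mem (add_mem h2 h1) h3
    exact h4
  exact h hx

theorem star_mem_qOrder (d : ℕ) {x : ℂ} (hx : x ∈ qOrder d) : star x ∈ qOrder d := by
  have h : qOrder d ≤ (qOrder d).comap (starRingEnd ℂ) := by
    refine Subring.closure_le.2 ?_
    rintro y rfl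
    change (starRingEnd ℂ) (((d : ℂ) + sqrtNeg d) / 2) ∈ qOrder d
    have h1 : ((d : ℂ) + sqrtNeg d) / 2 ∈ qOrder d := Subring.subset_closure (Set.mem_singleton _)
    have h2 : (d : ℂ) ∈ qOrder d := natCast_mem _ d
    have h3 : (starRingEnd ℂ) (((d : ℂ) + sqrtNeg d) / 2)
        = (d : ℂ) - ((d : ℂ) + sqrtNeg d) / 2 := by
      simp only [sqrtNeg, map_div₀, map_add, map_mul, Complex.conj_ofReal, Complex.conj_I,
        map_natCast, map_ofNat]
      ring
    rw [h3]
    exact sub_mem h2 h1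
  exact h hx

/-- A vector with entries in `𝒪`, as a complex vector. -/
def toC {d c : ℕ} (u : Fin c → qOrder d) : Fin c → ℂ := fun i => (u i : ℂ)

/-! ### The group `U(1,1)(ℤ)` and its action on the upper half-plane -/

/-- The matrix `(0 -1; 1 0)`. -/
def Jmat : Matrix (Fin 2) (Fin 2) ℂ := !![0, -1; 1, 0]

/-- The complex matrix underlying an element of `GL₂(𝒪)`. -/
def toMat {d : ℕ} (A : GL (Fin 2) (qOrder d)) : Matrix (Fin 2) (Fin 2) ℂ :=
  (qOrder d).subtype.mapMatrix (A : Matrix (Fin 2) (Fin 2) (qOrder d))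

theorem toMat_mul {d : ℕ} (A B : GL (Fin 2) (qOrder d)) :
    toMat (A * B) = toMat A * toMat B := by
  unfold toMat
  rw [Units.val_mul, map_mul]

theorem toMat_one {d : ℕ} : toMat (1 : GL (Fin 2) (qOrder d)) = 1 := by
  simp [toMat]

/-- `U(1,1)(ℤ)`: the matrices `A ∈ GL₂(𝒪)` with `A J A^* = J`. -/
def U11 (d : ℕ) : Subgroup (GL (Fin 2) (qOrder d)) where
  carrier := {A | toMat A * Jmat * (toMat A).conjTranspose = Jmat}
  mul_mem' := by
    intro A B hA hB
    simp only [Set.mem_ofPred_eq] at hA hB ⊢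
    calc toMat (A * B) * Jmat * (toMat (A * B)).conjTranspose
        = toMat A * (toMat B * Jmat * (toMat B).conjTranspose) * (toMat A).conjTranspose := by
          rw [toMat_mul, Matrix.conjTranspose_mul]; simp only [Matrix.mul_assoc]
      _ = Jmat := by rw [hB, hA]
  one_mem' := by simp [toMat_one]
  inv_mem' := by
    intro A hA
    simp only [Set.mem_ofPred_eq] at hA ⊢
    have h1 : toMat A⁻¹ * toMat A = 1 := by rw [← toMat_mul, inv_mul_cancel, toMat_one]
    have h2 : (toMat A).conjTranspose * (toMat A⁻¹).conjTranspose = 1 := by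
      rw [← Matrix.conjTranspose_mul, h1, Matrix.conjTranspose_one]
    calc toMat A⁻¹ * Jmat * (toMat A⁻¹).conjTranspose
        = toMat A⁻¹ * (toMat A * Jmat * (toMat A).conjTranspose)
            * (toMat A⁻¹).conjTranspose := by rw [hA]
      _ = (toMat A⁻¹ * toMat A) * Jmat
            * ((toMat A).conjTranspose * (toMat A⁻¹).conjTranspose) := by
          simp only [Matrix.mul_assoc]
      _ = Jmat := by rw [h1, h2, Matrix.one_mul, Matrix.mul_one]

/-- The complex matrix underlying an element of `U(1,1)(ℤ)`. -/
def mat {d : ℕ} (A : U11 d) : Matrix (Fin 2) (Fin 2) ℂ := toMat (A : GL (Fin 2) (qOrder d))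

/-- `j(A,τ) = cτ + d`. -/
def jfac {d : ℕ} (A : U11 d) (τ : ℂ) : ℂ := mat A 1 0 * τ + mat A 1 1

/-- `j^c(A,τ) = c̄τ + d̄`. -/
def jcfac {d : ℕ} (A : U11 d) (τ : ℂ) : ℂ := star (mat A 1 0) * τ + star (mat A 1 1)

theorem im_act_pos {d : ℕ} (A : U11 d) (τ : UpperHalfPlane) :
    0 < ((mat A 0 0 * (τ : ℂ) + mat A 0 1) / jfac A τ).im := by
  have hA : mat A * Jmat * (mat A).conjTranspose = Jmat := A.2
  have hJJ : Jmat * (-Jmat) = 1 := by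
    ext i j; fin_cases i <;> fin_cases j <;> simp [Jmat, Matrix.mul_apply, Fin.sum_univ_two]
  have hJJ' : (-Jmat) * Jmat = 1 := by
    ext i j; fin_cases i <;> fin_cases j <;> simp [Jmat, Matrix.mul_apply, Fin.sum_univ_two]
  have h1 : mat A * (Jmat * (mat A).conjTranspose * (-Jmat)) = 1 := by
    rw [← Matrix.mul_assoc, ← Matrix.mul_assoc, hA, hJJ]
  have h2 : (Jmat * (mat A).conjTranspose * (-Jmat)) * mat A = 1 := mul_eq_one_comm.1 h1
  have h3 : (mat A).conjTranspose * Jmat * mat A = Jmat := by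
    calc (mat A).conjTranspose * Jmat * mat A
        = ((-Jmat) * Jmat) * ((mat A).conjTranspose * Jmat * mat A) := by rw [hJJ', Matrix.one_mul]
      _ = Jmat * ((Jmat * (mat A).conjTranspose * (-Jmat)) * mat A) := by
          simp only [Matrix.mul_assoc, Matrix.neg_mul, Matrix.mul_neg]
      _ = Jmat := by rw [h2, Matrix.mul_one]
  have e00 := congrFun (congrFun h3 0) 0
  have e01 := congrFun (congrFun h3 0) 1
  have e10 := congrFun (congrFun h3 1) 0
  have e11 := congrFun (congrFun h3 1) 1
  simp only [Jmat, Matrix.mul_apply, Fin.sum_univ_two, Matrix.conjTranspose_apply,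
    Matrix.of_apply, Matrix.cons_val', Matrix.cons_val_zero, Matrix.cons_val_one,
    Matrix.cons_val_fin_one, mul_zero, mul_one, zero_add, add_zero, mul_neg] at e00 e01 e10 e11
  have hτ : 0 < (τ : ℂ).im := τ.im_pos
  have key : ((mat A 0 0 * (τ : ℂ) + mat A 0 1) * star (jfac A τ)).im = (τ : ℂ).im := by
    have f00 := congrArg Complex.im e00
    have f11 := congrArg Complex.im e11
    have g01 := congrArg Complex.re e01
    have f01 := congrArg Complex.im e01
    simp only [jfac, Complex.star_def, map_add, map_mul, Complex.add_im, Complex.mul_im,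
      Complex.add_re, Complex.mul_re, Complex.conj_re, Complex.conj_im, Complex.neg_re,
      Complex.neg_im, Complex.one_re, Complex.one_im, Complex.zero_im]
      at f00 f11 g01 f01 ⊢
    linear_combination (-(τ : ℂ).im) * g01 + (τ : ℂ).re * f01 + f11 / 2
      + ((τ : ℂ).re ^ 2 + (τ : ℂ).im ^ 2) / 2 * f00
  have hj : jfac A τ ≠ 0 := by
    intro h0
    rw [h0] at key
    simp at key
    exact absurd key.symm hτ.ne'
  have hpos : 0 < Complex.normSq (jfac A τ) := Complex.normSq_pos.2 hj
  have : (mat A 0 0 * (τ : ℂ) + mat A 0 1) / jfac A τ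
      = ((mat A 0 0 * (τ : ℂ) + mat A 0 1) * star (jfac A τ))
        * (((Complex.normSq (jfac A τ))⁻¹ : ℝ) : ℂ) := by
    rw [div_eq_mul_inv, Complex.inv_def]; simp [mul_assoc]
  rw [this, Complex.im_mul_ofReal, key]
  positivity

/-- `Aτ = (aτ + b)/(cτ + d)` for `A ∈ U(1,1)(ℤ)` and `τ` in the upper half-plane. -/
def act {d : ℕ} (A : U11 d) (τ : UpperHalfPlane) : UpperHalfPlane :=
  ⟨(mat A 0 0 * (τ : ℂ) + mat A 0 1) / jfac A τ, im_act_pos A τ⟩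

/-! ### Discriminant forms and their Weil representations -/

/-- A `ℤ`-quadratic map from a finite abelian group to `ℝ/ℤ` takes values in `ℚ/ℤ`. So the
`ℚ/ℤ`-valued quadratic forms on finite groups are exactly the `ℝ/ℤ`-valued ones. -/
theorem exists_rat_of_finite {D : Type*} [AddCommGroup D] [Finite D]
    (q : QuadraticMap ℤ D UnitAddCircle) (γ : D) :
    ∃ r : ℚ, q γ = ((r : ℝ) : UnitAddCircle) := by
  obtain ⟨x, hx⟩ := QuotientAddGroup.mk_surjective (q γ)
  set n : ℕ := Nat.card D with hn
  have hn0 : (n : ℝ) ≠ 0 := by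
    have : n ≠ 0 := Nat.card_pos.ne'
    exact_mod_cast this
  have h1 : (n : ℤ) • γ = 0 := by
    rw [natCast_zsmul]; exact card_nsmul_eq_zero'
  have h2 : ((n : ℤ) * (n : ℤ)) • q γ = 0 := by
    rw [← QuadraticMap.map_smul, h1, QuadraticMap.map_zero]
  have hx' : q γ = ((x : ℝ) : UnitAddCircle) := hx.symm
  have h3 : ((((n : ℤ) * (n : ℤ)) • x : ℝ) : UnitAddCircle) = 0 := by
    rw [hx'] at h2; exact h2
  obtain ⟨m, hm⟩ := (AddCircle.coe_eq_zero_iff (1 : ℝ)).1 h3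
  refine ⟨(m : ℚ) / ((n : ℚ) * n), ?_⟩
  rw [hx']
  congr 1
  push_cast
  simp only [zsmul_eq_mul, mul_one] at hm
  push_cast at hm
  field_simp
  linarith

/-- A discriminant form, with the data through which `U(1,1)(ℤ)` acts on `ℂ[D]`: a finite
abelian group `D`, a non-degenerate `ℚ/ℤ`-valued quadratic form `γ ↦ q γ = γ²/2`, with bilinear
pairing `(γ,δ) = polar q γ δ`, an isometric action of the unit group `μ(𝒪) = 𝒪ˣ` in which `-1`
acts as `-1`, and an integer `sig` (half the signature `b₊ - b₋` of a Hermitian lattice realising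
the form), whose class modulo `4` is determined by `q` through the Gauss sum.
If `μ(𝒪) = {±1}`, the action is no additional datum, and only `sig` modulo `4` matters. -/
structure DiscForm (d : ℕ) (D : Type*) [AddCommGroup D] [Fintype D] where
  q : QuadraticMap ℤ D UnitAddCircle
  nondeg : ∀ γ, (∀ δ, QuadraticMap.polar q γ δ = 0) → γ = 0
  unit : (qOrder d)ˣ →* AddMonoid.End D
  unit_neg_one : ∀ γ, unit (-1) γ = -γ
  unit_quad : ∀ ξ γ, q (unit ξ γ) = q γ
  sig : ℤ
  gauss : ∑ γ, qexpo (q γ) = Complex.I ^ sig * (Real.sqrt (Fintype.card D) : ℂ)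

section Weil

variable {d : ℕ} {D : Type*} [AddCommGroup D] [Fintype D] (X : DiscForm d D)

/-- `ρ_D(T) 𝔢_γ = 𝐞(γ²/2) 𝔢_γ`, where `ℂ[D]` is the space of functions `D → ℂ`. -/
def DiscForm.weilT : Module.End ℂ (D → ℂ) where
  toFun v γ := qexpo (X.q γ) * v γ
  map_add' v w := by ext γ; simp [mul_add]
  map_smul' r v := by ext γ; simp [mul_left_comm]

/-- `ρ_D(S) 𝔢_γ = i^{-sig} / √|D| · ∑_δ 𝐞(-(γ,δ)) 𝔢_δ`. -/
def DiscForm.weilS : Module.End ℂ (D → ℂ) where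
  toFun v δ := Complex.I ^ (-X.sig) / (Real.sqrt (Fintype.card D) : ℂ)
    * ∑ γ, qexpo (-QuadraticMap.polar X.q γ δ) * v γ
  map_add' v w := by ext γ; simp [mul_add, Finset.sum_add_distrib]
  map_smul' r v := by
    ext γ
    simp only [Pi.smul_apply, smul_eq_mul, RingHom.id_apply, Finset.mul_sum]
    exact Finset.sum_congr rfl fun _ _ => by ring

/-- `ρ_D(ξ) 𝔢_γ = ξ^{-sig} 𝔢_{ξ⁻¹γ}` for a unit `ξ` of `𝒪`; here `ξ⁻¹ = ξ̄`. -/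
def DiscForm.weilU (ξ : (qOrder d)ˣ) : Module.End ℂ (D → ℂ) where
  toFun v γ := ((ξ : qOrder d) : ℂ) ^ (-X.sig) * v (X.unit ξ γ)
  map_add' v w := by ext γ; simp [mul_add]
  map_smul' r v := by ext γ; simp [mul_left_comm]

/-- The graph `{(A, ρ_D(A)) | A ∈ U(1,1)(ℤ)}` of the Weil representation: the submonoid of
`U(1,1)(ℤ) × End(ℂ[D])` that is generated by `(T, ρ_D(T))`, `(S, ρ_D(S))` and `(ξ, ρ_D(ξ))` for
units `ξ` of `𝒪`. Since `(ST)⁶ = S⁴ = 1`, the matrices `S` and `T` generate `SL₂(ℤ)` also as a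
monoid, and `U(1,1)(ℤ) = 𝒪ˣ · SL₂(ℤ)`. -/
def DiscForm.weilGraph : Submonoid (U11 d × Module.End ℂ (D → ℂ)) :=
  Submonoid.closure
    ({p | mat p.1 = !![1, 1; 0, 1] ∧ p.2 = X.weilT} ∪
     {p | mat p.1 = !![0, -1; 1, 0] ∧ p.2 = X.weilS} ∪
     {p | ∃ ξ : (qOrder d)ˣ,
        mat p.1 = !![((ξ : qOrder d) : ℂ), 0; 0, ((ξ : qOrder d) : ℂ)] ∧ p.2 = X.weilU ξ})

/-- The translation operator `t_α : 𝔢_γ ↦ 𝔢_{γ-α}`. -/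
def transOp (α : D) (v : D → ℂ) : D → ℂ := fun γ => v (γ + α)

/-- The character operator `χ_β : 𝔢_γ ↦ 𝐞((β,γ)) 𝔢_γ`. -/
def DiscForm.charOp (β : D) (v : D → ℂ) : D → ℂ :=
  fun γ => qexpo (QuadraticMap.polar X.q β γ) * v γ

end Weil

/-- The orthogonal complement `H^⊥` of a subgroup with respect to a quadratic form. -/
def perp {A : Type*} [AddCommGroup A] (q : QuadraticMap ℤ A UnitAddCircle) (H : AddSubgroup A) :
    AddSubgroup A where
  carrier := {x | ∀ h ∈ H, QuadraticMap.polar q x h = 0}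
  add_mem' := by
    intro a b ha hb h hh
    rw [QuadraticMap.polar_add_left, ha h hh, hb h hh, add_zero]
  zero_mem' := by intro h _; exact QuadraticMap.polar_zero_left q h
  neg_mem' := by
    intro a ha h hh
    rw [QuadraticMap.polar_neg_left, ha h hh, neg_zero]

/-- The quotient `Δ_H = H^⊥/H` (for an isotropic subgroup `H`). -/
abbrev DeltaH {A : Type*} [AddCommGroup A] (q : QuadraticMap ℤ A UnitAddCircle)
    (H : AddSubgroup A) : Type _ := perp q H ⧸ H.addSubgroupOf (perp q H)

/-- The arrow operator `↓_H : ℂ[A] → ℂ[H^⊥/H]`, with `𝔢_δ ↦ 𝔢_{δ+H}` for `δ ∈ H^⊥` and `𝔢_δ ↦ 0`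
otherwise: the coefficient of `↓_H v` at a class `β` is the sum of the coefficients of `v` at the
elements `δ ∈ H^⊥` of `β`. (The group `A` is finite.) -/
def downArrow {A : Type*} [AddCommGroup A] (q : QuadraticMap ℤ A UnitAddCircle)
    (H : AddSubgroup A) (v : A → ℂ) : DeltaH q H → ℂ :=
  fun β => ∑ᶠ δ : {δ : perp q H // (QuotientAddGroup.mk δ : DeltaH q H) = β}, v (δ : perp q H)

/-! ### The matrix index `(S, ψ)` and its lattices -/

/-- `a^* S b`. -/
def herm {c : ℕ} (S : Matrix (Fin c) (Fin c) ℂ) (a b : Fin c → ℂ) : ℂ := star a ⬝ᵥ (S *ᵥ b)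

/-- `a^* S a`, as a real number (for Hermitian `S`). -/
def hnorm {c : ℕ} (S : Matrix (Fin c) (Fin c) ℂ) (a : Fin c → ℂ) : ℝ := (herm S a a).re

/-- `Tr(a^* S b)`; the trace of `𝕂` over `ℚ` takes `x` to `x + x̄ = 2 Re x`. -/
def htr {c : ℕ} (S : Matrix (Fin c) (Fin c) ℂ) (a b : Fin c → ℂ) : ℝ := 2 * (herm S a b).re

/-- A (possibly non-integral) matrix index `(S, ψ)`: a positive semidefinite Hermitian
`c × c` matrix `S` over `𝕂`, and a homomorphism `ψ : 𝒪^c → Δ` to a discriminant form, with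
`ψ(a) = 0` if `Sa = 0`, and `|ψ a|² = a^* S a + ℤ`. -/
structure MatrixIndex (d c : ℕ) {Δ : Type*} [AddCommGroup Δ] [Fintype Δ] (X : DiscForm d Δ) where
  S : Matrix (Fin c) (Fin c) ℂ
  S_mem : ∀ i j, S i j ∈ imQuad d
  S_psd : S.PosSemidef
  ψ : (Fin c → qOrder d) →+ Δ
  ψ_ker : ∀ a, S *ᵥ toC a = 0 → ψ a = 0
  ψ_quad : ∀ a, X.q (ψ a) = (hnorm S (toC a) : UnitAddCircle)

section Pairing

variable {c : ℕ} (S : Matrix (Fin c) (Fin c) ℂ)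

theorem herm_add_left (a b x : Fin c → ℂ) : herm S (a + b) x = herm S a x + herm S b x := by
  simp [herm, star_add, add_dotProduct]

theorem herm_add_right (a x y : Fin c → ℂ) : herm S a (x + y) = herm S a x + herm S a y := by
  simp [herm, Matrix.mulVec_add, dotProduct_add]

theorem herm_smul_left (r : ℂ) (a b : Fin c → ℂ) : herm S (r • a) b = star r * herm S a b := by
  simp [herm, star_smul]

theorem herm_smul_right (r : ℂ) (a b : Fin c → ℂ) : herm S a (r • b) = r * herm S a b := by
  simp [herm, Matrix.mulVec_smul]

theorem herm_conj {S : Matrix (Fin c) (Fin c) ℂ} (hS : S.IsHermitian) (a b : Fin c → ℂ) :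
    star (herm S a b) = herm S b a := by
  unfold herm
  rw [← Matrix.star_dotProduct_star, star_star, Matrix.star_mulVec, hS.eq,
    dotProduct_comm, Matrix.dotProduct_mulVec, dotProduct_comm]

theorem htr_symm {S : Matrix (Fin c) (Fin c) ℂ} (hS : S.IsHermitian) (a b : Fin c → ℂ) :
    htr S a b = htr S b a := by
  unfold htr
  rw [← herm_conj hS a b]
  simp

theorem htr_add_left (a b x : Fin c → ℂ) : htr S (a + b) x = htr S a x + htr S b x := by
  simp [htr, herm_add_left, mul_add]

theorem htr_add_right (a x y : Fin c → ℂ) : htr S a (x + y) = htr S a x + htr S a y := by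
  simp [htr, herm_add_right, mul_add]

theorem hnorm_add {S : Matrix (Fin c) (Fin c) ℂ} (hS : S.IsHermitian) (a b : Fin c → ℂ) :
    hnorm S (a + b) = hnorm S a + hnorm S b + htr S a b := by
  have h : (herm S b a).re = (herm S a b).re := by
    rw [← herm_conj hS a b]; simp
  simp only [hnorm, htr, herm_add_left, herm_add_right, Complex.add_re, h]
  ring

end Pairing

namespace MatrixIndex

variable {d c : ℕ} {Δ : Type*} [AddCommGroup Δ] [Fintype Δ] {X : DiscForm d Δ}
  (I : MatrixIndex d c X)

/-- The kernel of `S` on `𝕂^c`. -/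
def kerS : AddSubgroup (Fin c → ℂ) where
  carrier := {a | (∀ i, a i ∈ imQuad d) ∧ I.S *ᵥ a = 0}
  add_mem' := by
    rintro a b ⟨ha, ha'⟩ ⟨hb, hb'⟩
    exact ⟨fun i => add_mem (ha i) (hb i), by rw [Matrix.mulVec_add, ha', hb', add_zero]⟩
  zero_mem' := ⟨fun i => zero_mem _, Matrix.mulVec_zero _⟩
  neg_mem' := by
    rintro a ⟨ha, ha'⟩
    exact ⟨fun i => neg_mem (ha i), by rw [Matrix.mulVec_neg, ha', neg_zero]⟩

/-- `Ω = ker ψ + ker S`, a subgroup of `𝕂^c`. -/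
def Om : AddSubgroup (Fin c → ℂ) where
  carrier := {x | ∃ a : Fin c → qOrder d, I.ψ a = 0 ∧ ∃ s ∈ I.kerS, x = toC a + s}
  add_mem' := by
    rintro x y ⟨a, ha, s, hs, rfl⟩ ⟨b, hb, t, ht, rfl⟩
    refine ⟨a + b, by rw [map_add, ha, hb, add_zero], s + t, add_mem hs ht, ?_⟩
    ext i; simp [toC]; ring
  zero_mem' := ⟨0, map_zero _, 0, zero_mem _, by ext i; simp [toC]⟩
  neg_mem' := by
    rintro x ⟨a, ha, s, hs, rfl⟩
    refine ⟨-a, by rw [map_neg, ha, neg_zero], -s, neg_mem hs, ?_⟩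
    ext i; simp [toC]; ring

/-- `Ω^*`, the vectors `a ∈ 𝕂^c` with `Tr(a^* S b) ∈ ℤ` for all `b ∈ Ω`; this is the inverse
image in `𝕂^c` of the dual of the lattice `Ω/ker S` in `𝕂^c/ker S`. -/
def OmStar : AddSubgroup (Fin c → ℂ) where
  carrier := {a | (∀ i, a i ∈ imQuad d) ∧ ∀ b ∈ I.Om, ∃ n : ℤ, htr I.S a b = n}
  add_mem' := by
    rintro a b ⟨ha, ha'⟩ ⟨hb, hb'⟩
    refine ⟨fun i => add_mem (ha i) (hb i), fun x hx => ?_⟩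
    obtain ⟨m, hm⟩ := ha' x hx
    obtain ⟨n, hn⟩ := hb' x hx
    exact ⟨m + n, by rw [htr_add_left, hm, hn]; push_cast; ring⟩
  zero_mem' := ⟨fun i => zero_mem _, fun x _ => ⟨0, by simp [htr, herm]⟩⟩
  neg_mem' := by
    rintro a ⟨ha, ha'⟩
    refine ⟨fun i => neg_mem (ha i), fun x hx => ?_⟩
    obtain ⟨m, hm⟩ := ha' x hx
    refine ⟨-m, ?_⟩
    have : htr I.S (-a) x = -htr I.S a x := by simp [htr, herm]
    rw [this, hm]; push_cast; ring

theorem kerS_le_Om {a : Fin c → ℂ} (ha : a ∈ I.kerS) : a ∈ I.Om :=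
  ⟨0, map_zero _, a, ha, by ext i; simp [toC]⟩

theorem herm_kerS {a s : Fin c → ℂ} (hs : s ∈ I.kerS) : herm I.S a s = 0 := by
  simp [herm, hs.2]

theorem hnorm_add_kerS {a s : Fin c → ℂ} (hs : s ∈ I.kerS) : hnorm I.S (a + s) = hnorm I.S a := by
  rw [hnorm_add I.S_psd.isHermitian, hnorm, hnorm, htr, I.herm_kerS hs, I.herm_kerS hs]
  simp

theorem exists_int_of_ψ_eq_zero {a : Fin c → qOrder d} (ha : I.ψ a = 0) :
    ∃ n : ℤ, hnorm I.S (toC a) = n := by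
  have h := I.ψ_quad a
  rw [ha, QuadraticMap.map_zero] at h
  obtain ⟨n, hn⟩ := (AddCircle.coe_eq_zero_iff (1 : ℝ)).1 h.symm
  exact ⟨n, by rw [← hn]; simp⟩

theorem hnorm_Om {b : Fin c → ℂ} (hb : b ∈ I.Om) : ∃ n : ℤ, hnorm I.S b = n := by
  obtain ⟨a, ha, s, hs, rfl⟩ := hb
  rw [I.hnorm_add_kerS hs]
  exact I.exists_int_of_ψ_eq_zero ha

/-- `𝒪^c ⊆ Ω^*`. -/
theorem toC_mem_OmStar (u : Fin c → qOrder d) : toC u ∈ I.OmStar := by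
  refine ⟨fun i => qOrder_le_imQuad d (u i).2, ?_⟩
  rintro b ⟨a, ha, s, hs, rfl⟩
  have h0 : htr I.S (toC u) s = 0 := by simp [htr, I.herm_kerS hs]
  rw [htr_add_right, h0, add_zero]
  obtain ⟨n, hn⟩ := I.exists_int_of_ψ_eq_zero ha
  have h1 : (hnorm I.S (toC (u + a)) : UnitAddCircle) = (hnorm I.S (toC u) : UnitAddCircle) := by
    rw [← I.ψ_quad, ← I.ψ_quad, map_add, ha, add_zero]
  have h2 : toC (u + a) = toC u + toC a := by ext i; simp [toC]
  rw [h2, hnorm_add I.S_psd.isHermitian, hn] at h1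
  have h3 : ((hnorm I.S (toC u) + n + htr I.S (toC u) (toC a) - hnorm I.S (toC u) : ℝ)
      : UnitAddCircle) = 0 := by
    rw [AddCircle.coe_sub, h1, sub_self]
  obtain ⟨m, hm⟩ := (AddCircle.coe_eq_zero_iff (1 : ℝ)).1 h3
  refine ⟨m - n, ?_⟩
  simp only [zsmul_eq_mul, mul_one] at hm
  push_cast
  linarith

/-- `D_Ω = Ω^*/Ω`. -/
abbrev DOm : Type := I.OmStar ⧸ I.Om.addSubgroupOf I.OmStar

/-- `Ω^*/ker S`, the dual lattice `M^*` of `M = Ω/ker S`. -/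
abbrev Lam : Type := I.OmStar ⧸ I.kerS.addSubgroupOf I.OmStar

/-- The class in `D_Ω` of an element of `𝒪^c`. -/
def cls (u : Fin c → qOrder d) : I.DOm :=
  QuotientAddGroup.mk (⟨toC u, I.toC_mem_OmStar u⟩ : I.OmStar)

/-- The projection `Ω^*/ker S → D_Ω`. -/
def toD : I.Lam →+ I.DOm :=
  QuotientAddGroup.map _ _ (AddMonoidHom.id I.OmStar) (by
    intro x hx
    exact I.kerS_le_Om hx)

/-- `γ ↦ γ^* S γ + ℤ` as a function on `D_Ω`. -/
def qFun : I.DOm → UnitAddCircle :=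
  Quotient.lift (fun a : I.OmStar => (hnorm I.S (a : Fin c → ℂ) : UnitAddCircle)) (by
    intro a b hab
    have hab' : -a + b ∈ I.Om.addSubgroupOf I.OmStar := QuotientAddGroup.leftRel_apply.1 hab
    have hmem : (-(a : Fin c → ℂ) + (b : Fin c → ℂ)) ∈ I.Om := hab'
    obtain ⟨n, hn⟩ := I.hnorm_Om hmem
    obtain ⟨m, hm⟩ := a.2.2 _ hmem
    have hb : (b : Fin c → ℂ) = (a : Fin c → ℂ) + (-(a : Fin c → ℂ) + (b : Fin c → ℂ)) := by
      rw [add_neg_cancel_left]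
    have h1 : hnorm I.S (b : Fin c → ℂ) = hnorm I.S (a : Fin c → ℂ) + n + m := by
      rw [hb, hnorm_add I.S_psd.isHermitian, hn, hm]
    change (hnorm I.S (a : Fin c → ℂ) : UnitAddCircle) = (hnorm I.S (b : Fin c → ℂ) : UnitAddCircle)
    have hz : ∀ k : ℤ, ((k : ℝ) : UnitAddCircle) = 0 := fun k =>
      (AddCircle.coe_eq_zero_iff (1 : ℝ)).2 ⟨k, by simp⟩
    rw [h1, AddCircle.coe_add, AddCircle.coe_add, hz, hz, add_zero, add_zero])

theorem polar_qFun (a b : I.OmStar) :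
    QuadraticMap.polar I.qFun (QuotientAddGroup.mk a) (QuotientAddGroup.mk b)
      = (htr I.S (a : Fin c → ℂ) (b : Fin c → ℂ) : UnitAddCircle) := by
  change (hnorm I.S ((a : Fin c → ℂ) + (b : Fin c → ℂ)) : UnitAddCircle)
    - (hnorm I.S (a : Fin c → ℂ) : UnitAddCircle) - (hnorm I.S (b : Fin c → ℂ) : UnitAddCircle) = _
  rw [← AddCircle.coe_sub, ← AddCircle.coe_sub, hnorm_add I.S_psd.isHermitian]
  congr 1
  ring

/-- The quadratic form of `D_Ω`, taking the class of `a ∈ Ω^*` to `a^* S a + ℤ`. -/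
def qOm : QuadraticMap ℤ I.DOm UnitAddCircle :=
  QuadraticMap.ofPolar I.qFun
    (by
      intro n x
      induction x using QuotientAddGroup.induction_on with
      | H a =>
        change (hnorm I.S (n • (a : Fin c → ℂ)) : UnitAddCircle)
          = (n * n) • (hnorm I.S (a : Fin c → ℂ) : UnitAddCircle)
        have h : (n • (a : Fin c → ℂ)) = (n : ℂ) • (a : Fin c → ℂ) := by
          ext i; simp
        have h2 : hnorm I.S (n • (a : Fin c → ℂ)) = (n * n) • hnorm I.S (a : Fin c → ℂ) := by
          rw [h, hnorm, herm_smul_left, herm_smul_right, hnorm]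
          simp [mul_assoc]
        rw [h2]
        rfl)
    (by
      intro x x' y
      induction x using QuotientAddGroup.induction_on with
      | H a =>
      induction x' using QuotientAddGroup.induction_on with
      | H a' =>
      induction y using QuotientAddGroup.induction_on with
      | H b =>
        rw [← QuotientAddGroup.mk_add, polar_qFun, polar_qFun, polar_qFun, ← AddCircle.coe_add,
          ← htr_add_left]
        rfl)
    (by
      intro n x y
      induction x using QuotientAddGroup.induction_on with
      | H a =>
      induction y using QuotientAddGroup.induction_on with
      | H b =>
        rw [← QuotientAddGroup.mk_zsmul, polar_qFun, polar_qFun]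
        have h : ((n • a : I.OmStar) : Fin c → ℂ) = (n : ℂ) • (a : Fin c → ℂ) := by
          ext i; simp
        have h2 : htr I.S ((n • a : I.OmStar) : Fin c → ℂ) (b : Fin c → ℂ)
            = n • htr I.S (a : Fin c → ℂ) (b : Fin c → ℂ) := by
          rw [h, htr, herm_smul_left, htr]
          simp [mul_left_comm]
        rw [h2]
        rfl)

/-- `D_{Ω,S} = (𝒪^c + Ω)/Ω ⊆ D_Ω`. -/
def DOmS : AddSubgroup I.DOm := AddSubgroup.closure (Set.range I.cls)

/-- `H_Ω = D_{Ω,S}^⊥ ⊆ D_Ω`. -/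
def HOm : AddSubgroup I.DOm := perp I.qOm I.DOmS

/-- The Hermitian norm `a^* S a` of a class in `Ω^*/ker S`. -/
def lamNorm : I.Lam → ℝ :=
  Quotient.lift (fun a : I.OmStar => hnorm I.S (a : Fin c → ℂ)) (by
    intro a b hab
    have hab' : -a + b ∈ I.kerS.addSubgroupOf I.OmStar := QuotientAddGroup.leftRel_apply.1 hab
    have hmem : (-(a : Fin c → ℂ) + (b : Fin c → ℂ)) ∈ I.kerS := hab'
    change hnorm I.S (a : Fin c → ℂ) = hnorm I.S (b : Fin c → ℂ)
    rw [← I.hnorm_add_kerS hmem, add_neg_cancel_left])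

/-- `a^* S z + w^t S a` for a class `a` in `Ω^*/ker S`. -/
def lamLin (z w : Fin c → ℂ) : I.Lam → ℂ :=
  Quotient.lift (fun a : I.OmStar => herm I.S (a : Fin c → ℂ) z + w ⬝ᵥ (I.S *ᵥ (a : Fin c → ℂ))) (by
    intro a b hab
    have hab' : -a + b ∈ I.kerS.addSubgroupOf I.OmStar := QuotientAddGroup.leftRel_apply.1 hab
    have hmem : (-(a : Fin c → ℂ) + (b : Fin c → ℂ)) ∈ I.kerS := hab'
    have hb : (b : Fin c → ℂ) = (a : Fin c → ℂ) + (-(a : Fin c → ℂ) + (b : Fin c → ℂ)) := by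
      rw [add_neg_cancel_left]
    change herm I.S (a : Fin c → ℂ) z + w ⬝ᵥ (I.S *ᵥ (a : Fin c → ℂ))
      = herm I.S (b : Fin c → ℂ) z + w ⬝ᵥ (I.S *ᵥ (b : Fin c → ℂ))
    have h0 : herm I.S (-(a : Fin c → ℂ) + (b : Fin c → ℂ)) z = 0 := by
      rw [← herm_conj I.S_psd.isHermitian z, I.herm_kerS hmem, star_zero]
    rw [hb, herm_add_left, Matrix.mulVec_add, hmem.2, h0, add_zero, add_zero])

/-- The theta function `Θ_{Ω,S}(τ,z,w)`, with values in `ℂ[D_Ω]`. Its coefficient at `γ` is the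
sum of `𝐞(τ a^*Sa + a^*Sz + w^tSa)` over `a ∈ γ + Ω`, where `a` is taken modulo `ker S` (the
summand depends only on `a + ker S`). -/
def theta (τ : UpperHalfPlane) (z w : Fin c → ℂ) : I.DOm → ℂ :=
  fun γ => ∑' a : {a : I.Lam // I.toD a = γ},
    cexpo ((τ : ℂ) * (I.lamNorm a : ℂ) + I.lamLin z w a)

/-- `ker ψ` is stable under multiplication by `𝒪`; equivalently, the image `Ω/ker S` of `ker ψ`
in `𝕂^c/ker S` is an `𝒪`-module. -/
def KerStable : Prop := ∀ (x : qOrder d) (a : Fin c → qOrder d), I.ψ a = 0 → I.ψ (x • a) = 0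

/-- `ker ψ` as an `𝒪`-submodule of `𝒪^c`. -/
def kerPsi (hst : I.KerStable) : Submodule (qOrder d) (Fin c → qOrder d) where
  carrier := {a | I.ψ a = 0}
  add_mem' := by
    intro a b ha hb
    change I.ψ (a + b) = 0
    rw [map_add, show I.ψ a = 0 from ha, show I.ψ b = 0 from hb, add_zero]
  zero_mem' := map_zero _
  smul_mem' := fun x a ha => hst x a ha

/-- The kernel of `S` on `𝒪^c`. -/
def kerSO : Submodule (qOrder d) (Fin c → qOrder d) where
  carrier := {a | I.S *ᵥ toC a = 0}
  add_mem' := by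
    intro a b ha hb
    have h : toC (a + b) = toC a + toC b := by ext i; simp [toC]
    change I.S *ᵥ toC (a + b) = 0
    rw [h, Matrix.mulVec_add, show I.S *ᵥ toC a = 0 from ha, show I.S *ᵥ toC b = 0 from hb,
      add_zero]
  zero_mem' := by
    have h : toC (0 : Fin c → qOrder d) = 0 := by ext i; simp [toC]
    change I.S *ᵥ toC 0 = 0
    rw [h, Matrix.mulVec_zero]
  smul_mem' := by
    intro x a ha
    have h : toC (x • a) = (x : ℂ) • toC a := by ext i; simp [toC]
    change I.S *ᵥ toC (x • a) = 0
    rw [h, Matrix.mulVec_smul, show I.S *ᵥ toC a = 0 from ha, smul_zero]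

/-- The quotient of `ker ψ` modulo its intersection with `ker S`, as an `𝒪`-module. -/
abbrev OmBar (hst : I.KerStable) : Type := I.kerPsi hst ⧸ I.kerSO.submoduleOf (I.kerPsi hst)

theorem smul_Om (hst : I.KerStable) (x : qOrder d) {b : Fin c → ℂ} (hb : b ∈ I.Om) :
    (x : ℂ) • b ∈ I.Om := by
  obtain ⟨a, ha, s, hs, rfl⟩ := hb
  refine ⟨x • a, hst x a ha, (x : ℂ) • s, ⟨fun i => ?_, ?_⟩, ?_⟩
  · exact mul_mem (qOrder_le_imQuad d x.2) (hs.1 i)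
  · rw [Matrix.mulVec_smul, hs.2, smul_zero]
  · ext i; simp [toC, mul_add]

theorem smul_OmStar (hst : I.KerStable) (x : qOrder d) {a : Fin c → ℂ} (ha : a ∈ I.OmStar) :
    (x : ℂ) • a ∈ I.OmStar := by
  refine ⟨fun i => mul_mem (qOrder_le_imQuad d x.2) (ha.1 i), fun b hb => ?_⟩
  obtain ⟨n, hn⟩ := ha.2 _ (I.smul_Om hst ⟨star (x : ℂ), star_mem_qOrder d x.2⟩ hb)
  refine ⟨n, ?_⟩
  rw [← hn, htr, htr, herm_smul_left, herm_smul_right]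

/-- Multiplication by `x ∈ 𝒪` on `D_Ω`. -/
def mulD (hst : I.KerStable) (x : qOrder d) : I.DOm →+ I.DOm :=
  QuotientAddGroup.map _ _
    ({ toFun := fun a => ⟨(x : ℂ) • (a : Fin c → ℂ), I.smul_OmStar hst x a.2⟩
       map_zero' := by ext i; simp
       map_add' := by intro a b; ext i; simp [mul_add] } : I.OmStar →+ I.OmStar)
    (by
      intro a ha
      exact I.smul_Om hst x ha)

end MatrixIndex

/-! ### Hermitian Jacobi forms and modular forms -/

/-- Every function value `f(Aτ)`, for `A ∈ SL₂(ℤ)`, grows at most like the exponential of a linear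
function of `Im τ` when `Im τ → ∞` with `Re τ` bounded: `f` grows at most linearly exponentially
towards every cusp. -/
def ExpGrowth {E : Type*} [Norm E] (f : UpperHalfPlane → E) : Prop :=
  ∀ (A : SL(2, ℤ)) (R : ℝ), ∃ C₁ C₂ : ℝ, ∀ τ : UpperHalfPlane, |τ.re| ≤ R → 1 ≤ τ.im →
    ‖f (A • τ)‖ ≤ C₁ * Real.exp (C₂ * τ.im)

section Modular

variable {d : ℕ} {D : Type*} [AddCommGroup D] [Fintype D] (Y : DiscForm d D)

/-- Modular forms of weight `k` and representation `ρ_D` with respect to `Γ`: smooth functions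
on the upper half-plane, with `F(Aτ) = j(A,τ)^k ρ_D(A) F(τ)` for `A ∈ Γ`, which grow at most
linearly exponentially towards the cusps. -/
structure IsModularForm (Γ : Subgroup (U11 d)) (k : ℤ) (F : UpperHalfPlane → D → ℂ) : Prop where
  smooth : ContDiffOn ℝ ∞ (fun t : ℂ => F (UpperHalfPlane.ofComplex t)) {t | 0 < t.im}
  modular : ∀ A ∈ Γ, ∀ R, (A, R) ∈ Y.weilGraph → ∀ τ : UpperHalfPlane,
    F (act A τ) = (jfac A τ) ^ k • R (F τ)
  growth : ExpGrowth F

end Modular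

/-- Holomorphy on the upper half-plane (for a modular form: weak holomorphicity). -/
def HolModular {D : Type*} [Fintype D] (F : UpperHalfPlane → D → ℂ) : Prop :=
  DifferentiableOn ℂ (fun t : ℂ => F (UpperHalfPlane.ofComplex t)) {t | 0 < t.im}

/-- Boundedness at the cusps: for `A ∈ SL₂(ℤ)`, the function `(cτ+d)^{-k} F(Aτ)` is bounded as
`Im τ → ∞`. -/
def BddAtCusps {D : Type*} [Fintype D] (k : ℤ) (F : UpperHalfPlane → D → ℂ) : Prop :=
  ∀ A : SL(2, ℤ), UpperHalfPlane.IsBoundedAtImInfty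
    (fun τ : UpperHalfPlane => ((A 1 0 : ℂ) * (τ : ℂ) + (A 1 1 : ℂ)) ^ (-k) • F (A • τ))

section Jacobi

variable {d c : ℕ} {Δ : Type*} [AddCommGroup Δ] [Fintype Δ] {X : DiscForm d Δ}
  (I : MatrixIndex d c X)

/-- Hermitian Jacobi forms of weight `k`, representation `ρ_Δ` and index `(S,ψ)` with respect
to `Γ`. In the last condition, the functions `f β a` are the coefficients of the expansion
`Φ_β(τ,z,w) = ∑_a f_{β,a}(τ) 𝐞(τ a^*Sa + a^*Sz + w^tSa)` over `a ∈ Ω^*/ker S`, which exists and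
is unique by holomorphy and periodicity. -/
structure IsHermitianJacobiForm (Γ : Subgroup (U11 d)) (k : ℤ)
    (Φ : UpperHalfPlane → (Fin c → ℂ) → (Fin c → ℂ) → Δ → ℂ) : Prop where
  smooth : ContDiffOn ℝ ∞
    (fun p : ℂ × (Fin c → ℂ) × (Fin c → ℂ) => Φ (UpperHalfPlane.ofComplex p.1) p.2.1 p.2.2)
    {p | 0 < p.1.im}
  holomorphic : ∀ τ, Differentiable ℂ (fun p : (Fin c → ℂ) × (Fin c → ℂ) => Φ τ p.1 p.2)
  periodic : ∀ (u v : Fin c → qOrder d) (τ : UpperHalfPlane) (z w : Fin c → ℂ),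
    Φ τ (z + (τ : ℂ) • toC u + toC v) (w + (τ : ℂ) • star (toC u) + star (toC v))
      = cexpo (-(τ : ℂ) * herm I.S (toC u) (toC u) - herm I.S (toC u) z
          - w ⬝ᵥ (I.S *ᵥ toC u))
        • X.charOp (I.ψ v) (transOp (I.ψ u) (Φ τ z w))
  modular : ∀ A ∈ Γ, ∀ R, (A, R) ∈ X.weilGraph → ∀ (τ : UpperHalfPlane) (z w : Fin c → ℂ),
    Φ (act A τ) ((jfac A τ)⁻¹ • z) ((jcfac A τ)⁻¹ • w)
      = ((jfac A τ) ^ k * cexpo (mat A 1 0 * (w ⬝ᵥ (I.S *ᵥ z)) / jfac A τ)) • R (Φ τ z w)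
  growth : ∀ f : Δ → I.Lam → UpperHalfPlane → ℂ,
    (∀ (τ : UpperHalfPlane) (z w : Fin c → ℂ) (β : Δ), HasSum
      (fun a => f β a τ * cexpo ((τ : ℂ) * (I.lamNorm a : ℂ) + I.lamLin z w a)) (Φ τ z w β)) →
    ∀ β a, ExpGrowth (f β a)

/-- Holomorphy in all the variables (for a Jacobi form: weak holomorphicity). -/
def HolJacobi (Φ : UpperHalfPlane → (Fin c → ℂ) → (Fin c → ℂ) → Δ → ℂ) : Prop :=
  DifferentiableOn ℂ
    (fun p : ℂ × (Fin c → ℂ) × (Fin c → ℂ) => Φ (UpperHalfPlane.ofComplex p.1) p.2.1 p.2.2)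
    {p | 0 < p.1.im}

/-- `(Φ|A)(τ,z,w) = (cτ+d)^{-k} 𝐞(-c w^tSz/(cτ+d)) Φ(Aτ, z/(cτ+d), w/(cτ+d))` for
`A ∈ SL₂(ℤ)`. -/
def slashJ (k : ℤ) (A : SL(2, ℤ)) (Φ : UpperHalfPlane → (Fin c → ℂ) → (Fin c → ℂ) → Δ → ℂ)
    (τ : UpperHalfPlane) (z w : Fin c → ℂ) : Δ → ℂ :=
  (((A 1 0 : ℂ) * (τ : ℂ) + (A 1 1 : ℂ)) ^ (-k)
    * cexpo (-((A 1 0 : ℂ) * (w ⬝ᵥ (I.S *ᵥ z)) / ((A 1 0 : ℂ) * (τ : ℂ) + (A 1 1 : ℂ))))) •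
  Φ (A • τ) (((A 1 0 : ℂ) * (τ : ℂ) + (A 1 1 : ℂ))⁻¹ • z)
    (((A 1 0 : ℂ) * (τ : ℂ) + (A 1 1 : ℂ))⁻¹ • w)

/-- The cusp condition of a holomorphic Jacobi form: for every `A ∈ SL₂(ℤ)`, the Fourier
expansion `∑ C_{β,m,a} 𝐞(mτ + a^*Sz + w^tSa)` of the components of `Φ|A`, with `m ∈ (1/N)ℤ` and
`a ∈ Ω^*/ker S`, has `C_{β,m,a} ≠ 0` only for `m ≥ a^*Sa`. -/
def HolAtCusps (k : ℤ) (Φ : UpperHalfPlane → (Fin c → ℂ) → (Fin c → ℂ) → Δ → ℂ) : Prop :=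
  ∀ A : SL(2, ℤ), ∃ (N : ℕ) (C : Δ → ℤ → I.Lam → ℂ), 0 < N ∧
    (∀ β m a, C β m a ≠ 0 → I.lamNorm a ≤ (m : ℝ) / N) ∧
    ∀ (τ : UpperHalfPlane) (z w : Fin c → ℂ) (β : Δ), HasSum
      (fun p : ℤ × I.Lam => C β p.1 p.2 * cexpo ((p.1 : ℂ) / N * (τ : ℂ) + I.lamLin z w p.2))
      (slashJ I k A Φ τ z w β)

end Jacobi

/-! ### The auxiliary discriminant form `D` -/

section Glue

variable {d c : ℕ} {Δ D : Type*} [AddCommGroup Δ] [Fintype Δ] [AddCommGroup D] [Fintype D]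
  {X : DiscForm d Δ} (I : MatrixIndex d c X) (Y : DiscForm d D)

/-- The quadratic form of `D_Ω ⊕ D`. -/
def sumForm : QuadraticMap ℤ (I.DOm × D) UnitAddCircle := QuadraticMap.prod I.qOm Y.q

/-- The horizontal subgroup `H = {γ + ι(γ) | γ ∈ H_Ω}` of `D_Ω ⊕ D`. -/
def glueSub (ι : I.HOm →+ D) : AddSubgroup (I.DOm × D) := (I.HOm.subtype.prod ι).range

/-- The assumptions on the discriminant form `D`: an isomorphism `ι` of `H_Ω`, with the quadratic
form inverted, onto a subgroup of `D`, and an isomorphism of discriminant forms from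
`Δ_H = H^⊥/H` (where `H = {γ + ι(γ)}`) to `Δ`, which takes the image in `Δ_H` of the class
`u + Ω ∈ D_{Ω,S} = H_Ω^⊥` to `ψ(u)`. The maps respect the actions of the units of `𝒪` (automatic
for `-1`), and `ξ^{sig}` is the same for `Δ_H`, namely `ξ^{b₊ + sig(D)}`, and for `Δ`
(automatic if `ξ⁴ = 1`). -/
structure GlueData (hst : I.KerStable) where
  ι : I.HOm →+ D
  ι_inj : Function.Injective ι
  ι_quad : ∀ γ : I.HOm, Y.q (ι γ) = -I.qOm (γ : I.DOm)
  ι_unit : ∀ (ξ : (qOrder d)ˣ) (γ γ' : I.HOm), (γ' : I.DOm) = I.mulD hst ξ γ →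
    ι γ' = Y.unit ξ (ι γ)
  iso : DeltaH (sumForm I Y) (glueSub I ι) ≃+ Δ
  iso_quad : ∀ x : perp (sumForm I Y) (glueSub I ι),
    X.q (iso (QuotientAddGroup.mk x)) = sumForm I Y (x : I.DOm × D)
  iso_emb : ∀ (u : Fin c → qOrder d) (x : perp (sumForm I Y) (glueSub I ι)),
    (x : I.DOm × D) = (I.cls u, 0) → iso (QuotientAddGroup.mk x) = I.ψ u
  iso_unit : ∀ (ξ : (qOrder d)ˣ) (x x' : perp (sumForm I Y) (glueSub I ι)),
    (x' : I.DOm × D) = (I.mulD hst ξ (x : I.DOm × D).1, Y.unit ξ (x : I.DOm × D).2) →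
    iso (QuotientAddGroup.mk x') = X.unit ξ (iso (QuotientAddGroup.mk x))
  sig_eq : ∀ ξ : (qOrder d)ˣ,
    ((ξ : qOrder d) : ℂ) ^ X.sig = ((ξ : qOrder d) : ℂ) ^ ((I.S.rank : ℤ) + Y.sig)

/-- `↓_H(θ ⊗ v)` for `θ ∈ ℂ[D_Ω]` and `v ∈ ℂ[D]`, as an element of `ℂ[Δ]` through the isomorphism
of `Δ_H` with `Δ`. -/
def GlueData.downTensor {I : MatrixIndex d c X} {Y : DiscForm d D} {hst : I.KerStable}
    (G : GlueData I Y hst) (θ : I.DOm → ℂ) (v : D → ℂ) : Δ → ℂ :=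
  fun β => downArrow (sumForm I Y) (glueSub I G.ι) (fun x => θ x.1 * v x.2) (G.iso.symm β)

end Glue

end

end HermJac

namespace HermJac

open MeasureTheory Set Filter Topology

noncomputable section

/-! ### Elementary facts about the exponential -/

theorem cexpo_add (x y : ℂ) : cexpo (x + y) = cexpo x * cexpo y := by
  simp only [cexpo, mul_add, Complex.exp_add]

theorem cexpo_zero : cexpo 0 = 1 := by simp [cexpo]

theorem cexpo_ne_zero (x : ℂ) : cexpo x ≠ 0 := Complex.exp_ne_zero _

theorem cexpo_neg (x : ℂ) : cexpo (-x) = (cexpo x)⁻¹ := by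
  simp only [cexpo, mul_neg, Complex.exp_neg]

theorem cexpo_int (k : ℤ) : cexpo k = 1 := by
  rw [cexpo, Complex.exp_eq_one_iff]; exact ⟨k, by ring⟩

theorem cexpo_add_int (x : ℂ) (k : ℤ) : cexpo (x + k) = cexpo x := by
  rw [cexpo_add, cexpo_int, mul_one]

theorem norm_cexpo (x : ℂ) : ‖cexpo x‖ = Real.exp (-(2 * Real.pi * x.im)) := by
  rw [cexpo, Complex.norm_exp]; congr 1; simp

theorem norm_cexpo_ofReal (x : ℝ) : ‖cexpo x‖ = 1 := by simp [norm_cexpo]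

theorem differentiable_cexpo : Differentiable ℂ cexpo := by
  unfold cexpo; fun_prop

theorem continuous_cexpo : Continuous cexpo := differentiable_cexpo.continuous

theorem qexpo_coe (x : ℝ) : qexpo (x : UnitAddCircle) = cexpo x := by
  rw [qexpo, AddCircle.toCircle_apply_mk, Circle.coe_exp, cexpo]; congr 1; push_cast; ring

theorem qexpo_add (x y : UnitAddCircle) : qexpo (x + y) = qexpo x * qexpo y := by
  simp [qexpo, AddCircle.toCircle_add]

theorem qexpo_zero : qexpo 0 = 1 := by simp [qexpo]

theorem qexpo_neg (x : UnitAddCircle) : qexpo (-x) = (qexpo x)⁻¹ := by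
  simp [qexpo, AddCircle.toCircle_neg]

theorem qexpo_injective : Function.Injective qexpo := fun _ _ h =>
  AddCircle.injective_toCircle one_ne_zero (Subtype.ext h)

theorem qexpo_eq_one_iff (x : UnitAddCircle) : qexpo x = 1 ↔ x = 0 :=
  ⟨fun h => qexpo_injective (h.trans qexpo_zero.symm), fun h => h ▸ qexpo_zero⟩

/-! ### Fourier series of periodic entire functions of several variables -/

variable {n : ℕ}

/-- The half-open unit cube. -/
def unitBox (n : ℕ) : Set (Fin n → ℝ) := {x | ∀ i, x i ∈ Ioc (0 : ℝ) 1}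

/-- The linear form `m · ζ` with integral coefficients. -/
def zdot (m : Fin n → ℤ) (ζ : Fin n → ℂ) : ℂ := ∑ i, (m i : ℂ) * ζ i

/-- The embedding of `ℝⁿ` into `ℂⁿ`. -/
def vecC (x : Fin n → ℝ) : Fin n → ℂ := fun i => (x i : ℂ)

/-- The embedding of `ℤⁿ` into `ℂⁿ`. -/
def vecZ (k : Fin n → ℤ) : Fin n → ℂ := fun i => (k i : ℂ)

theorem zdot_add (m : Fin n → ℤ) (ζ ξ : Fin n → ℂ) : zdot m (ζ + ξ) = zdot m ζ + zdot m ξ := by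
  simp [zdot, mul_add, Finset.sum_add_distrib]

theorem zdot_smul (m : Fin n → ℤ) (s : ℂ) (ζ : Fin n → ℂ) : zdot m (s • ζ) = s * zdot m ζ := by
  simp [zdot, Finset.mul_sum, mul_left_comm]

theorem zdot_add_left (m l : Fin n → ℤ) (ζ : Fin n → ℂ) :
    zdot (m + l) ζ = zdot m ζ + zdot l ζ := by
  simp [zdot, add_mul, Finset.sum_add_distrib]

theorem zdot_neg_left (m : Fin n → ℤ) (ζ : Fin n → ℂ) : zdot (-m) ζ = -zdot m ζ := by
  simp [zdot]

theorem zdot_zero_left (ζ : Fin n → ℂ) : zdot 0 ζ = 0 := by simp [zdot]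

theorem zdot_zero_right (m : Fin n → ℤ) : zdot m 0 = 0 := by simp [zdot]

theorem zdot_vecZ (m k : Fin n → ℤ) : zdot m (vecZ k) = ((∑ i, m i * k i : ℤ) : ℂ) := by
  simp [zdot, vecZ]

theorem zdot_vecC (m : Fin n → ℤ) (x : Fin n → ℝ) :
    zdot m (vecC x) = ((∑ i, (m i : ℝ) * x i : ℝ) : ℂ) := by
  simp [zdot, vecC]

theorem cexpo_zdot_vecZ (m k : Fin n → ℤ) : cexpo (zdot m (vecZ k)) = 1 := by
  rw [zdot_vecZ, cexpo_int]

theorem differentiable_zdot (m : Fin n → ℤ) : Differentiable ℂ (zdot m) := by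
  unfold zdot; fun_prop

theorem continuous_zdot (m : Fin n → ℤ) : Continuous (zdot m) := (differentiable_zdot m).continuous

theorem continuous_vecC : Continuous (vecC : (Fin n → ℝ) → Fin n → ℂ) := by
  unfold vecC; fun_prop

theorem measurableSet_unitBox : MeasurableSet (unitBox n) := by
  have : unitBox n = Set.pi univ fun _ => Ioc (0 : ℝ) 1 := by ext; simp [unitBox]
  rw [this]; exact MeasurableSet.univ_pi fun _ => measurableSet_Ioc

theorem volume_unitBox : volume (unitBox n) = 1 := by
  have : unitBox n = Set.pi univ fun _ => Ioc (0 : ℝ) 1 := by ext; simp [unitBox]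
  rw [this, volume_pi_pi]; simp

theorem unitBox_subset : unitBox n ⊆ Set.pi univ fun _ => Icc (0 : ℝ) 1 :=
  fun _ hx i _ => Ioc_subset_Icc_self (hx i)

theorem isCompact_closedBox : IsCompact (Set.pi univ fun _ : Fin n => Icc (0 : ℝ) 1) :=
  isCompact_univ_pi fun _ => isCompact_Icc

instance : IsProbabilityMeasure (volume.restrict (unitBox n)) :=
  ⟨by rw [Measure.restrict_apply_univ, volume_unitBox]⟩

theorem Continuous.integrableOn_unitBox {H : (Fin n → ℝ) → ℂ} (hH : Continuous H) :
    IntegrableOn H (unitBox n) :=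
  (hH.continuousOn.integrableOn_compact isCompact_closedBox).mono_set unitBox_subset

/-- A periodic function on `ℝⁿ` is a function on the torus. -/
theorem exists_torus_lift (H : (Fin n → ℝ) → ℂ) (hH : Continuous H)
    (hper : ∀ x (k : Fin n → ℤ), H (x + fun i => (k i : ℝ)) = H x) :
    ∃ f : C(UnitAddTorus (Fin n), ℂ), ∀ x : Fin n → ℝ, f (fun i => (x i : UnitAddCircle)) = H x := by
  have hq : IsOpenQuotientMap (Pi.map fun _ : Fin n => ((↑) : ℝ → UnitAddCircle)) :=
    IsOpenQuotientMap.piMap fun _ => QuotientAddGroup.isOpenQuotientMap_mk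
  have hfac : Function.FactorsThrough H (Pi.map fun _ : Fin n => ((↑) : ℝ → UnitAddCircle)) := by
    intro x y hxy
    have h1 : ∀ i, ∃ k : ℤ, y i - x i = k := by
      intro i
      have h2 : ((y i - x i : ℝ) : UnitAddCircle) = 0 := by
        rw [AddCircle.coe_sub, sub_eq_zero]; exact (congrFun hxy i).symm
      obtain ⟨k, hk⟩ := (AddCircle.coe_eq_zero_iff (1 : ℝ)).1 h2
      exact ⟨k, by rw [← hk]; simp⟩
    choose k hk using h1
    rw [← hper x k]; congr 1; ext i; simp [← hk]
  refine ⟨⟨Function.extend (Pi.map fun _ : Fin n => ((↑) : ℝ → UnitAddCircle)) H 0, ?_⟩, fun x => hfac.extend_apply 0 x⟩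
  rw [hq.isQuotientMap.continuous_iff]
  convert! hH using 1
  exact funext fun x => hfac.extend_apply 0 x

theorem mFourier_coe (m : Fin n → ℤ) (x : Fin n → ℝ) :
    UnitAddTorus.mFourier m (fun i => (x i : UnitAddCircle)) = cexpo (zdot m (vecC x)) := by
  simp only [UnitAddTorus.mFourier, ContinuousMap.coe_mk, fourier_coe_apply, cexpo, zdot,
    Finset.mul_sum, vecC, Complex.exp_sum]
  refine Finset.prod_congr rfl fun i _ => ?_
  congr 1; push_cast; ring

/-- The integral of a periodic function over the unit cube is invariant under translations. -/
theorem integral_unitBox_add (H : (Fin n → ℝ) → ℂ) (hH : Continuous H)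
    (hper : ∀ x (k : Fin n → ℤ), H (x + fun i => (k i : ℝ)) = H x) (a : Fin n → ℝ) :
    ∫ x in unitBox n, H (x + a) = ∫ x in unitBox n, H x := by
  obtain ⟨f, hf⟩ := exists_torus_lift H hH hper
  have h0 := UnitAddTorus.mFourierCoeff_eq_integral f 0 (0 : Fin n → ℝ)
  have ha := UnitAddTorus.mFourierCoeff_eq_integral f 0 a
  simp only [neg_zero, UnitAddTorus.mFourier_zero, ContinuousMap.one_apply, one_smul, hf,
    Pi.zero_apply, zero_add] at h0 ha
  rw [show {x : Fin n → ℝ | ∀ i, x i ∈ Ioc (0 : ℝ) 1} = unitBox n from rfl] at h0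
  rw [← h0, ha]
  have hmp := measurePreserving_add_right (volume : Measure (Fin n → ℝ)) a
  rw [← hmp.setIntegral_preimage_emb (MeasurableEquiv.addRight a).measurableEmbedding H]
  congr 2
  ext x; simp [unitBox, add_comm]

theorem integral_cexpo_zdot (m : Fin n → ℤ) :
    ∫ x in unitBox n, cexpo (zdot m (vecC x)) = if m = 0 then 1 else 0 := by
  split_ifs with h
  · simp [h, zdot_zero_left, cexpo_zero]
  · obtain ⟨i, hi⟩ := Function.ne_iff.1 h
    have hmi : (m i : ℝ) ≠ 0 := by exact_mod_cast hi
    have hcont : Continuous fun x : Fin n → ℝ => cexpo (zdot m (vecC x)) :=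
      continuous_cexpo.comp ((continuous_zdot m).comp continuous_vecC)
    have hv : ∀ x y : Fin n → ℝ, vecC (x + y) = vecC x + vecC y := fun x y => by
      ext; simp [vecC]
    have key := integral_unitBox_add (fun x => cexpo (zdot m (vecC x))) hcont
      (fun x k => by
        simp only [hv, zdot_add, cexpo_add]
        rw [show vecC (fun i => (k i : ℝ)) = vecZ k by ext; simp [vecC, vecZ], cexpo_zdot_vecZ,
          mul_one]) (Pi.single i (1 / (2 * m i)))
    simp only [hv, zdot_add, cexpo_add] at key
    rw [integral_mul_const] at key
    have hh : cexpo (zdot m (vecC (Pi.single i (1 / (2 * (m i : ℝ)))))) = -1 := by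
      have : zdot m (vecC (Pi.single i (1 / (2 * (m i : ℝ))))) = ((1 / 2 : ℝ) : ℂ) := by
        rw [zdot_vecC, Finset.sum_eq_single i]
        · congr 1; simp; field_simp
        · intro j _ hj; simp [Pi.single_eq_of_ne hj]
        · simp
      rw [this, cexpo, ← Complex.exp_pi_mul_I]; congr 1; push_cast; ring
    rw [hh] at key
    have : (2 : ℂ) * ∫ x in unitBox n, cexpo (zdot m (vecC x)) = 0 := by linear_combination -key
    simpa using this

/-- Uniqueness of the coefficients of a Fourier series. -/
theorem fourier_coeff_eq {c : (Fin n → ℤ) → ℂ} {H : (Fin n → ℝ) → ℂ}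
    (h : ∀ x, HasSum (fun m => c m * cexpo (zdot m (vecC x))) (H x)) (m : Fin n → ℤ) :
    c m = ∫ x in unitBox n, cexpo (-zdot m (vecC x)) * H x := by
  have hc : Summable fun m => ‖c m‖ := by
    have := (h 0).summable.norm
    simpa only [norm_mul, zdot_vecC, norm_cexpo_ofReal, mul_one] using this
  have hcont : ∀ m : Fin n → ℤ, Continuous fun x : Fin n → ℝ => cexpo (zdot m (vecC x)) :=
    fun m => continuous_cexpo.comp ((continuous_zdot m).comp continuous_vecC)
  set g : (Fin n → ℤ) → (Fin n → ℝ) → ℂ := fun l x => c l * cexpo (zdot (l - m) (vecC x)) with hg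
  have hgc : ∀ l, Continuous (g l) := fun l => (hcont (l - m)).const_mul _
  have hgn : ∀ l x, ‖g l x‖ = ‖c l‖ := by
    intro l x; simp only [hg, norm_mul, zdot_vecC, norm_cexpo_ofReal, mul_one]
  have key := hasSum_integral_of_summable_integral_norm (μ := volume.restrict (unitBox n))
    (F := g) (fun l => Continuous.integrableOn_unitBox (hgc l)) (by simpa [hgn] using hc)
  have h1 : ∀ l, ∫ x in unitBox n, g l x = if l = m then c m else 0 := by
    intro l
    simp only [hg]
    rw [integral_const_mul, integral_cexpo_zdot]
    simp only [sub_eq_zero]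
    split_ifs with h <;> simp [h]
  simp only [h1] at key
  have h2 := key.unique (hasSum_ite_eq m (c m))
  rw [← h2]
  congr 1; ext x
  have h3 := (h x).mul_left (cexpo (-zdot m (vecC x)))
  rw [← h3.tsum_eq]
  refine tsum_congr fun l => ?_
  simp only [hg, sub_eq_add_neg, zdot_add_left, zdot_neg_left, cexpo_add]; ring

theorem summable_exp_neg_abs :
    Summable fun m : Fin n → ℤ => Real.exp (-∑ i, |(m i : ℝ)|) := by
  have h1 : Summable fun k : ℤ => Real.exp (-|(k : ℝ)|) := by
    have h0 : Summable fun k : ℕ => Real.exp (-(k : ℝ)) := by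
      simpa using Real.summable_exp_neg_nat
    refine Summable.of_nat_of_neg ?_ ?_ <;> simpa using h0
  refine summable_of_sum_le (c := (∑' k : ℤ, Real.exp (-|(k : ℝ)|)) ^ n)
    (fun _ => (Real.exp_pos _).le) fun s => ?_
  classical
  let t : Fin n → Finset ℤ := fun i => s.image fun m => m i
  calc ∑ m ∈ s, Real.exp (-∑ i, |(m i : ℝ)|)
      ≤ ∑ m ∈ Fintype.piFinset t, Real.exp (-∑ i, |(m i : ℝ)|) := by
        refine Finset.sum_le_sum_of_subset_of_nonneg (fun m hm => ?_)
          fun _ _ _ => (Real.exp_pos _).le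
        exact Fintype.mem_piFinset.2 fun i => Finset.mem_image_of_mem _ hm
    _ = ∏ i, ∑ k ∈ t i, Real.exp (-|(k : ℝ)|) := by
        rw [Finset.prod_univ_sum]
        refine Finset.sum_congr rfl fun m _ => ?_
        rw [← Finset.sum_neg_distrib, Real.exp_sum]
    _ ≤ ∏ _i : Fin n, ∑' k : ℤ, Real.exp (-|(k : ℝ)|) := by
        refine Finset.prod_le_prod (fun i _ => Finset.sum_nonneg fun _ _ => (Real.exp_pos _).le)
          fun i _ => h1.sum_le_tsum _ fun _ _ => (Real.exp_pos _).le
    _ = _ := by simp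

/-- The integral over the unit cube of a function depending holomorphically on a parameter. -/
theorem differentiable_integral_unitBox (F : ℂ → (Fin n → ℝ) → ℂ)
    (hF : Continuous (Function.uncurry F)) (hd : ∀ x, Differentiable ℂ fun s => F s x) :
    Differentiable ℂ fun s => ∫ x in unitBox n, F s x := by
  intro s₀
  have hK : IsCompact (Metric.closedBall s₀ 2 ×ˢ (Set.pi univ fun _ : Fin n => Icc (0 : ℝ) 1)) :=
    (isCompact_closedBall s₀ 2).prod isCompact_closedBox
  obtain ⟨C, hC⟩ := hK.exists_bound_of_continuousOn hF.continuousOn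
  have hFs : ∀ s, Continuous (F s) := fun s =>
    hF.comp (continuous_const.prodMk continuous_id)
  have := hasDerivAt_integral_of_dominated_loc_of_deriv_le (μ := volume.restrict (unitBox n))
    (F := F) (F' := fun s x => deriv (fun s => F s x) s) (bound := fun _ => C / 1)
    (x₀ := s₀) (Metric.ball_mem_nhds s₀ one_pos)
    (Eventually.of_forall fun s => (hFs s).aestronglyMeasurable)
    (Continuous.integrableOn_unitBox (hFs s₀)) ?_ ?_ (integrable_const _) ?_
  · exact this.2.differentiableAt
  · have hm := measurable_deriv_with_param (𝕜 := ℂ) (f := fun (x : Fin n → ℝ) (s : ℂ) => F s x)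
      (hF.comp continuous_swap)
    exact (hm.comp (measurable_id.prodMk measurable_const)).aestronglyMeasurable
  · refine (ae_restrict_iff' measurableSet_unitBox).2 (Eventually.of_forall fun x hx s hs => ?_)
    refine Complex.norm_deriv_le_of_forall_mem_sphere_norm_le one_pos
      (hd x).diffContOnCl fun z hz => hC (z, x) ⟨?_, unitBox_subset hx⟩
    have h1 : dist z s = 1 := hz
    have h2 : dist s s₀ < 1 := hs
    have := dist_triangle z s s₀
    simp only [Metric.mem_closedBall]; linarith
  · exact Eventually.of_forall fun x s _ => ((hd x) s).hasDerivAt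

theorem vecC_add (x y : Fin n → ℝ) : vecC (x + y) = vecC x + vecC y := by ext; simp [vecC]

theorem vecC_intCast (k : Fin n → ℤ) : vecC (fun i => (k i : ℝ)) = vecZ k := by
  ext; simp [vecC, vecZ]

section Entire

variable {G : (Fin n → ℂ) → ℂ} (hG : Differentiable ℂ G)
  (hper : ∀ ζ (k : Fin n → ℤ), G (ζ + vecZ k) = G ζ)

include hG hper in
theorem integral_unitBox_shift (y : Fin n → ℝ) (s : ℂ) :
    ∫ x in unitBox n, G (vecC x + s • vecC y) = ∫ x in unitBox n, G (vecC x) := by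
  set h : ℂ → ℂ := fun s => ∫ x in unitBox n, G (vecC x + s • vecC y) with hh
  have hd : Differentiable ℂ h := by
    refine differentiable_integral_unitBox (fun s x => G (vecC x + s • vecC y)) ?_ ?_
    · exact hG.continuous.comp ((continuous_vecC.comp continuous_snd).add
        (continuous_fst.smul continuous_const))
    · intro x
      exact hG.comp (by fun_prop)
  have hreal : ∀ r : ℝ, h r = h 0 := by
    intro r
    have := integral_unitBox_add (fun x => G (vecC x)) (hG.continuous.comp continuous_vecC)
      (fun x k => by rw [vecC_add, vecC_intCast, hper]) (r • y)
    have e : vecC (r • y) = (r : ℂ) • vecC y := by ext; simp [vecC]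
    simpa [hh, vecC_add, e] using this
  have heq : h = fun _ => h 0 := by
    have ha : AnalyticOnNhd ℂ h univ := hd.differentiableOn.analyticOnNhd isOpen_univ
    refine ha.eq_of_frequently_eq (z₀ := 0) analyticOnNhd_const ?_
    have hs : Tendsto (fun k : ℕ => ((1 / ((k : ℝ) + 1) : ℝ) : ℂ)) atTop (𝓝[≠] 0) := by
      refine tendsto_nhdsWithin_iff.2 ⟨?_, Eventually.of_forall fun k => ?_⟩
      · have := (Complex.continuous_ofReal.tendsto 0).comp
          (tendsto_one_div_add_atTop_nhds_zero_nat (𝕜 := ℝ))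
        simpa [Function.comp_def] using this
      · simp only [mem_compl_iff, mem_singleton_iff, Complex.ofReal_eq_zero]; positivity
    exact hs.frequently (Frequently.of_forall fun k => hreal _)
  have := congrFun heq s
  simpa [hh] using this

/-- The Fourier coefficients of a periodic entire function. -/
def fcoef (G : (Fin n → ℂ) → ℂ) (m : Fin n → ℤ) : ℂ :=
  ∫ x in unitBox n, cexpo (-zdot m (vecC x)) * G (vecC x)

include hG hper in
theorem fcoef_shift (m : Fin n → ℤ) (ζ : Fin n → ℂ) :
    fcoef (fun ξ => G (ξ + ζ)) m = cexpo (zdot m ζ) * fcoef G m := by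
  set G₁ : (Fin n → ℂ) → ℂ := fun ξ => cexpo (-zdot m ξ) * G ξ with hG₁
  have d1 : Differentiable ℂ G₁ :=
    (differentiable_cexpo.comp (differentiable_zdot m).neg).mul hG
  have p1 : ∀ ζ (k : Fin n → ℤ), G₁ (ζ + vecZ k) = G₁ ζ := by
    intro ζ k
    simp only [hG₁, hper, zdot_add, neg_add, cexpo_add]
    rw [cexpo_neg (zdot m (vecZ k)), cexpo_zdot_vecZ, inv_one, mul_one]
  set u : Fin n → ℝ := fun i => (ζ i).re
  set v : Fin n → ℝ := fun i => (ζ i).im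
  have hζ : ζ = (1 : ℂ) • vecC u + Complex.I • vecC v := by
    ext i; simp [vecC, u, v, mul_comm Complex.I, Complex.re_add_im]
  have s1 := integral_unitBox_shift d1 p1 v Complex.I
  have s2 := integral_unitBox_shift (G := fun ξ => G₁ (ξ + Complex.I • vecC v))
    (d1.comp (by fun_prop)) (fun ζ k => by
      rw [show ζ + vecZ k + Complex.I • vecC v = ζ + Complex.I • vecC v + vecZ k by abel, p1]) u 1
  rw [s1] at s2
  rw [fcoef, fcoef, ← s2, ← integral_const_mul]
  congr 1; ext x
  simp only [hG₁, add_assoc]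
  rw [← hζ, zdot_add, neg_add, cexpo_add, cexpo_neg (zdot m ζ)]
  field_simp [cexpo_ne_zero]

include hG hper in
theorem summable_fcoef : Summable (fcoef G) := by
  have hK : IsCompact (Metric.closedBall (0 : Fin n → ℂ) 2) := isCompact_closedBall _ _
  obtain ⟨C, hC⟩ := hK.exists_bound_of_continuousOn hG.continuous.continuousOn
  refine Summable.of_norm_bounded (g := fun m => C * Real.exp (-∑ i, |(m i : ℝ)|))
    (summable_exp_neg_abs.mul_left C) fun m => ?_
  set ζ : Fin n → ℂ := fun i => -((SignType.sign (m i) : ℝ) : ℂ) * Complex.I with hζ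
  have hz : (zdot m ζ).im = -∑ i, |(m i : ℝ)| := by
    simp only [zdot, hζ, Complex.im_sum, ← Finset.sum_neg_distrib]
    refine Finset.sum_congr rfl fun i _ => ?_
    rcases lt_trichotomy (m i) 0 with h | h | h
    · have h' : (m i : ℝ) < 0 := by exact_mod_cast h
      simp [h, abs_of_neg h']
    · simp [h]
    · have h' : (0 : ℝ) < m i := by exact_mod_cast h
      simp [h, abs_of_pos h']
  have hzn : ∀ i, ‖ζ i‖ ≤ 1 := by
    intro i
    rcases lt_trichotomy (m i) 0 with h | h | h <;> simp [hζ, h]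
  have h1 : ‖fcoef (fun ξ => G (ξ + ζ)) m‖ ≤ C := by
    rw [fcoef]
    have := norm_setIntegral_le_of_norm_le_const (μ := volume) (s := unitBox n) (C := C)
      (f := fun x => cexpo (-zdot m (vecC x)) * G (vecC x + ζ))
      (by rw [volume_unitBox]; simp) (fun x hx => ?_)
    · simpa [Measure.real, volume_unitBox] using this
    · have e : -zdot m (vecC x) = ((-∑ i, (m i : ℝ) * x i : ℝ) : ℂ) := by
        rw [zdot_vecC]; push_cast; rfl
      rw [norm_mul, e, norm_cexpo_ofReal, one_mul]
      refine hC _ ?_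
      rw [mem_closedBall_zero_iff, pi_norm_le_iff_of_nonneg (by norm_num)]
      intro i
      have hx1 : ‖(vecC x) i‖ ≤ 1 := by
        simp only [vecC, Complex.norm_real, Real.norm_eq_abs]
        rw [abs_of_pos (hx i).1]; exact (hx i).2
      calc ‖(vecC x + ζ) i‖ ≤ ‖vecC x i‖ + ‖ζ i‖ := norm_add_le _ _
        _ ≤ 2 := by linarith [hzn i]
  rw [fcoef_shift hG hper, norm_mul, norm_cexpo, hz] at h1
  have hS : 0 ≤ ∑ i, |(m i : ℝ)| := Finset.sum_nonneg fun _ _ => abs_nonneg _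
  set T := ∑ i, |(m i : ℝ)|
  have h2 : Real.exp T ≤ Real.exp (-(2 * Real.pi * -T)) := by
    refine Real.exp_le_exp.2 ?_
    nlinarith [Real.pi_gt_three]
  have h3 : Real.exp T * ‖fcoef G m‖ ≤ C :=
    (mul_le_mul_of_nonneg_right h2 (norm_nonneg _)).trans h1
  rw [Real.exp_neg, ← div_eq_mul_inv, le_div_iff₀ (Real.exp_pos _), mul_comm]
  exact h3

include hG hper in
/-- A periodic entire function is the sum of its Fourier series. -/
theorem hasSum_fcoef (ζ : Fin n → ℂ) :
    HasSum (fun m => fcoef G m * cexpo (zdot m ζ)) (G ζ) := by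
  set G₁ : (Fin n → ℂ) → ℂ := fun ξ => G (ξ + ζ) with hG₁
  have d1 : Differentiable ℂ G₁ := hG.comp (by fun_prop)
  have p1 : ∀ ζ (k : Fin n → ℤ), G₁ (ζ + vecZ k) = G₁ ζ := fun ξ k => by
    simp only [hG₁]; rw [add_right_comm, hper]
  obtain ⟨f, hf⟩ := exists_torus_lift (fun x => G₁ (vecC x)) (d1.continuous.comp continuous_vecC)
    (fun x k => by simp only [vecC_add, vecC_intCast, p1])
  have hco : UnitAddTorus.mFourierCoeff f = fcoef G₁ := by
    ext m
    rw [UnitAddTorus.mFourierCoeff_eq_integral f m 0, fcoef]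
    simp only [Pi.zero_apply, zero_add, mFourier_coe, hf, smul_eq_mul, zdot_neg_left]
    rfl
  have := UnitAddTorus.hasSum_mFourier_series_apply_of_summable (f := f)
    (by rw [hco]; exact summable_fcoef d1 p1) (fun i => ((0 : ℝ) : UnitAddCircle))
  rw [hf fun _ => 0, hco] at this
  have e0 : vecC (fun _ : Fin n => (0 : ℝ)) = 0 := by ext; simp [vecC]
  simp only [mFourier_coe, e0, zdot_zero_right, cexpo_zero, smul_eq_mul, mul_one, hG₁,
    zero_add] at this
  convert! this using 2 with m
  rw [fcoef_shift hG hper, mul_comm]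

end Entire

end

end HermJac

namespace HermJac

open MeasureTheory Set Filter Topology

noncomputable section

/-! ### Series of holomorphic functions of several variables -/

theorem norm_fderiv_le_of_ball {E : Type*} [NormedAddCommGroup E] [NormedSpace ℂ E]
    {f : E → ℂ} {q : E} {r C : ℝ} (hr : 0 < r) (hf : DifferentiableOn ℂ f (Metric.ball q r))
    (hC : ∀ p ∈ Metric.ball q r, ‖f p‖ ≤ C) : ‖fderiv ℂ f q‖ ≤ 2 * C / r := by
  have hC0 : 0 ≤ C := (norm_nonneg _).trans (hC q (Metric.mem_ball_self hr))
  refine ContinuousLinearMap.opNorm_le_bound _ (by positivity) fun v => ?_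
  rcases eq_or_ne v 0 with rfl | hv
  · simp
  have hv' : 0 < ‖v‖ := norm_pos_iff.2 hv
  set R := r / (2 * ‖v‖) with hR
  have hRpos : 0 < R := by positivity
  have hmem : ∀ s ∈ Metric.closedBall (0 : ℂ) R, q + s • v ∈ Metric.ball q r := by
    intro s hs
    rw [Metric.mem_ball, dist_self_add_left, norm_smul]
    have h1 : ‖s‖ ≤ R := by simpa using hs
    calc ‖s‖ * ‖v‖ ≤ R * ‖v‖ := by gcongr
      _ = r / 2 := by rw [hR]; field_simp
      _ < r := by linarith
  have hline : Differentiable ℂ fun s : ℂ => q + s • v := by fun_prop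
  have hd : DifferentiableOn ℂ (fun s : ℂ => f (q + s • v)) (Metric.closedBall 0 R) :=
    hf.comp hline.differentiableOn hmem
  have h1 := Complex.norm_deriv_le_of_forall_mem_sphere_norm_le hRpos (c := 0)
    (f := fun s : ℂ => f (q + s • v)) (C := C)
    (DifferentiableOn.diffContOnCl (hd.mono (Metric.closure_ball_subset_closedBall)))
    (fun s hs => hC _ (hmem s (Metric.sphere_subset_closedBall hs)))
  have h2 : HasDerivAt (fun s : ℂ => f (q + s • v)) (fderiv ℂ f q v) 0 := by
    have hfq : HasFDerivAt f (fderiv ℂ f q) (q + (0 : ℂ) • v) := by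
      rw [zero_smul, add_zero]
      exact (hf.differentiableAt (Metric.ball_mem_nhds q hr)).hasFDerivAt
    have hl : HasDerivAt (fun s : ℂ => q + s • v) v 0 := by
      simpa using ((hasDerivAt_id (0 : ℂ)).smul_const v).const_add q
    exact hfq.comp_hasDerivAt 0 hl
  rw [h2.deriv] at h1
  refine h1.trans_eq ?_
  rw [hR]; field_simp

theorem differentiableAt_tsum_of_ball {ι E : Type*} [NormedAddCommGroup E] [NormedSpace ℂ E]
    {f : ι → E → ℂ} {u : ι → ℝ} {p : E} {r : ℝ} (hr : 0 < r) (hu : Summable u)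
    (hf : ∀ i, DifferentiableOn ℂ (f i) (Metric.ball p r))
    (hb : ∀ i, ∀ q ∈ Metric.ball p r, ‖f i q‖ ≤ u i) :
    DifferentiableAt ℂ (fun q => ∑' i, f i q) p := by
  let _ : NormedSpace ℝ E := NormedSpace.restrictScalars ℝ ℂ E
  have hsub : ∀ q ∈ Metric.ball p (r / 2), Metric.ball q (r / 2) ⊆ Metric.ball p r := by
    intro q hq
    refine Metric.ball_subset_ball' ?_
    have : dist q p < r / 2 := hq
    linarith
  refine (hasFDerivAt_tsum_of_isPreconnected (𝕜 := ℂ) (u := fun i => 2 * u i / (r / 2))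
    (f' := fun i q => fderiv ℂ (f i) q) (s := Metric.ball p (r / 2)) (x₀ := p)
    ?_ Metric.isOpen_ball (convex_ball p (r / 2)).isPreconnected ?_ ?_
    (Metric.mem_ball_self (by positivity)) ?_ (Metric.mem_ball_self (by positivity)))
    |>.differentiableAt
  · exact (hu.mul_left 2).div_const _
  · intro i q hq
    exact ((hf i).differentiableAt (Metric.isOpen_ball.mem_nhds
      (Metric.ball_subset_ball (by linarith) hq))).hasFDerivAt
  · intro i q hq
    exact norm_fderiv_le_of_ball (by positivity) ((hf i).mono (hsub q hq))
      fun x hx => hb i x (hsub q hq hx)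
  · exact Summable.of_norm_bounded hu fun i => hb i p (Metric.mem_ball_self hr)

/-! ### Gaussian series attached to a positive definite matrix -/

variable {n : ℕ} {Q : Matrix (Fin n) (Fin n) ℝ}

/-- The bilinear form `xᵗQy` on `ℂⁿ`. -/
def bform (Q : Matrix (Fin n) (Fin n) ℝ) (x y : Fin n → ℂ) : ℂ :=
  x ⬝ᵥ (Q.map Complex.ofReal *ᵥ y)

theorem bform_add_left (x x' y : Fin n → ℂ) : bform Q (x + x') y = bform Q x y + bform Q x' y := by
  simp [bform, add_dotProduct]

theorem bform_add_right (x y y' : Fin n → ℂ) :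
    bform Q x (y + y') = bform Q x y + bform Q x y' := by
  simp [bform, Matrix.mulVec_add, dotProduct_add]

theorem bform_smul_left (s : ℂ) (x y : Fin n → ℂ) : bform Q (s • x) y = s * bform Q x y := by
  simp [bform]

theorem bform_smul_right (s : ℂ) (x y : Fin n → ℂ) : bform Q x (s • y) = s * bform Q x y := by
  simp [bform, Matrix.mulVec_smul]

theorem bform_comm (hQ : Q.IsHermitian) (x y : Fin n → ℂ) : bform Q x y = bform Q y x := by
  have : (Q.map Complex.ofReal)ᵀ = Q.map Complex.ofReal := by
    ext i j
    have := hQ.apply i j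
    simp only [star_trivial] at this
    simp [this]
  unfold bform
  rw [Matrix.dotProduct_mulVec, dotProduct_comm, ← Matrix.mulVec_transpose, this]

theorem bform_vecC (x y : Fin n → ℝ) : bform Q (vecC x) (vecC y) = ((x ⬝ᵥ (Q *ᵥ y) : ℝ) : ℂ) := by
  simp [bform, vecC, dotProduct, Matrix.mulVec]

theorem differentiable_bform_self : Differentiable ℂ fun x : Fin n → ℂ => bform Q x x := by
  unfold bform dotProduct Matrix.mulVec dotProduct; fun_prop

/-- A positive definite form dominates the square of the `ℓ¹`-norm. -/
theorem exists_pos_le_form (hQ : Q.PosDef) :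
    ∃ A > 0, ∀ x : Fin n → ℝ, A * (∑ i, |x i|) ^ 2 ≤ x ⬝ᵥ (Q *ᵥ x) := by
  rcases n.eq_zero_or_pos with rfl | hn
  · exact ⟨1, one_pos, fun x => by simp⟩
  have hne : (Metric.sphere (0 : Fin n → ℝ) 1).Nonempty := by
    have : Nonempty (Fin n) := ⟨⟨0, hn⟩⟩
    exact NormedSpace.sphere_nonempty.2 zero_le_one
  have hcont : Continuous fun x : Fin n → ℝ => x ⬝ᵥ (Q *ᵥ x) := by
    unfold dotProduct Matrix.mulVec dotProduct; fun_prop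
  obtain ⟨u, hu, hmin⟩ := (isCompact_sphere (0 : Fin n → ℝ) 1).exists_isMinOn hne
    hcont.continuousOn
  have hu0 : u ≠ 0 := by rintro rfl; simp at hu
  have hpos : 0 < u ⬝ᵥ (Q *ᵥ u) := by simpa using hQ.dotProduct_mulVec_pos hu0
  have hn' : (0 : ℝ) < n := by exact_mod_cast hn
  refine ⟨(u ⬝ᵥ (Q *ᵥ u)) / n ^ 2, by positivity, fun x => ?_⟩
  rcases eq_or_ne x 0 with rfl | hx
  · simp
  have hxn : 0 < ‖x‖ := norm_pos_iff.2 hx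
  have h1 : u ⬝ᵥ (Q *ᵥ u) ≤ (‖x‖⁻¹ • x) ⬝ᵥ (Q *ᵥ (‖x‖⁻¹ • x)) :=
    hmin (by simp [norm_smul, hxn.ne'])
  rw [Matrix.mulVec_smul, smul_dotProduct, dotProduct_smul, smul_eq_mul, smul_eq_mul] at h1
  have h2 : ∑ i, |x i| ≤ n * ‖x‖ := by
    calc ∑ i, |x i| ≤ ∑ _i : Fin n, ‖x‖ := Finset.sum_le_sum fun i _ => norm_le_pi_norm x i
      _ = n * ‖x‖ := by simp
  have h3 : (u ⬝ᵥ (Q *ᵥ u)) * ‖x‖ ^ 2 ≤ x ⬝ᵥ (Q *ᵥ x) := by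
    have := mul_le_mul_of_nonneg_right h1 (sq_nonneg ‖x‖)
    refine this.trans_eq ?_
    field_simp
  have h4 : (∑ i, |x i|) ^ 2 ≤ (n * ‖x‖) ^ 2 :=
    pow_le_pow_left₀ (Finset.sum_nonneg fun _ _ => abs_nonneg _) h2 2
  calc (u ⬝ᵥ (Q *ᵥ u)) / n ^ 2 * (∑ i, |x i|) ^ 2
      ≤ (u ⬝ᵥ (Q *ᵥ u)) / n ^ 2 * (n * ‖x‖) ^ 2 := by gcongr
    _ = (u ⬝ᵥ (Q *ᵥ u)) * ‖x‖ ^ 2 := by field_simp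
    _ ≤ _ := h3

/-- The general term of the Gaussian series. -/
def gterm (Q : Matrix (Fin n) (Fin n) ℝ) (σ : ℂ) (ζ : Fin n → ℂ) (m : Fin n → ℤ) : ℂ :=
  cexpo (σ * (bform Q (vecZ m) (vecZ m) / 2) + zdot m ζ)

theorem exists_gterm_bound (hQ : Q.PosDef) {y R : ℝ} (hy : 0 < y) :
    ∃ K : ℝ, ∀ (σ : ℂ) (ζ : Fin n → ℂ), y ≤ σ.im → (∀ i, ‖ζ i‖ ≤ R) → ∀ m : Fin n → ℤ,
      ‖gterm Q σ ζ m‖ ≤ K * Real.exp (-∑ i, |(m i : ℝ)|) := by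
  obtain ⟨A, hA, hAx⟩ := exists_pos_le_form hQ
  set a := Real.pi * y * A with ha
  have hapos : 0 < a := by positivity
  set b := 2 * Real.pi * R + 1 with hb
  refine ⟨Real.exp (b ^ 2 / (4 * a)), fun σ ζ hσ hζ m => ?_⟩
  rw [gterm, norm_cexpo, ← Real.exp_add, Real.exp_le_exp]
  set t := ∑ i, |(m i : ℝ)| with ht
  have ht0 : 0 ≤ t := Finset.sum_nonneg fun _ _ => abs_nonneg _
  set q : ℝ := (fun i => (m i : ℝ)) ⬝ᵥ (Q *ᵥ fun i => (m i : ℝ)) with hq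
  have hqt : A * t ^ 2 ≤ q := hAx _
  have hq0 : 0 ≤ q := le_trans (by positivity) hqt
  have e1 : (σ * (bform Q (vecZ m) (vecZ m) / 2)).im = σ.im * (q / 2) := by
    rw [← vecC_intCast, bform_vecC, ← hq]
    rw [show ((q : ℂ) / 2) = ((q / 2 : ℝ) : ℂ) by push_cast; rfl, Complex.im_mul_ofReal]
  have e2 : |(zdot m ζ).im| ≤ R * t := by
    refine (Complex.abs_im_le_norm _).trans ?_
    rw [zdot, ht, Finset.mul_sum]
    refine (norm_sum_le _ _).trans (Finset.sum_le_sum fun i _ => ?_)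
    rw [norm_mul, Complex.norm_intCast, mul_comm]
    exact mul_le_mul_of_nonneg_right (hζ i) (abs_nonneg _)
  rw [Complex.add_im, e1]
  have h1 : y * (A * t ^ 2 / 2) ≤ σ.im * (q / 2) := by
    apply mul_le_mul hσ (by linarith) (by positivity) (by linarith)
  have h2 : -(R * t) ≤ (zdot m ζ).im := neg_le_of_abs_le e2
  have h3 : 2 * Real.pi * (y * (A * t ^ 2 / 2) - R * t)
      ≤ 2 * Real.pi * (σ.im * (q / 2) + (zdot m ζ).im) := by
    have := Real.pi_pos
    gcongr; linarith
  have h4 : b * t - a * t ^ 2 ≤ b ^ 2 / (4 * a) := by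
    rw [le_div_iff₀ (by positivity)]; nlinarith [sq_nonneg (2 * a * t - b)]
  have h5 : 2 * Real.pi * (y * (A * t ^ 2 / 2) - R * t) = a * t ^ 2 - (b - 1) * t := by
    rw [ha, hb]; ring
  linarith

theorem summable_norm_gterm (hQ : Q.PosDef) {σ : ℂ} (hσ : 0 < σ.im) (ζ : Fin n → ℂ) :
    Summable fun m => ‖gterm Q σ ζ m‖ := by
  obtain ⟨K, hK⟩ := exists_gterm_bound hQ (R := ‖ζ‖) hσ
  exact Summable.of_nonneg_of_le (fun _ => norm_nonneg _)
    (fun m => hK σ ζ le_rfl (norm_le_pi_norm ζ) m) (summable_exp_neg_abs.mul_left K)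

theorem differentiableAt_gseries (hQ : Q.PosDef) {c : (Fin n → ℤ) → ℂ} (hc : ∀ m, ‖c m‖ ≤ 1)
    {p : ℂ × (Fin n → ℂ)} (hp : 0 < p.1.im) :
    DifferentiableAt ℂ (fun p : ℂ × (Fin n → ℂ) => ∑' m, c m * gterm Q p.1 p.2 m) p := by
  obtain ⟨K, hK⟩ := exists_gterm_bound hQ (y := p.1.im / 2) (R := ‖p‖ + p.1.im / 2)
    (by positivity)
  refine differentiableAt_tsum_of_ball (r := p.1.im / 2) (by positivity)
    (summable_exp_neg_abs.mul_left K) (fun m => ?_) fun m q hq => ?_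
  · refine Differentiable.differentiableOn ?_
    unfold gterm
    refine (differentiable_cexpo.comp ?_).const_mul _
    refine (differentiable_fst.mul_const _).add ((differentiable_zdot m).comp differentiable_snd)
  · rw [norm_mul]
    have hdist : ‖q - p‖ < p.1.im / 2 := by simpa [dist_eq_norm] using hq
    have h1 : p.1.im / 2 ≤ q.1.im := by
      have : |(q.1 - p.1).im| ≤ ‖q - p‖ :=
        (Complex.abs_im_le_norm _).trans (norm_fst_le (q - p))
      rw [Complex.sub_im] at this
      have := neg_le_of_abs_le this
      linarith
    have h2 : ∀ i, ‖q.2 i‖ ≤ ‖p‖ + p.1.im / 2 := by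
      intro i
      calc ‖q.2 i‖ ≤ ‖q.2‖ := norm_le_pi_norm _ _
        _ ≤ ‖q‖ := norm_snd_le q
        _ ≤ ‖p‖ + ‖q - p‖ := norm_le_norm_add_norm_sub' q p
        _ ≤ _ := by linarith
    calc ‖c m‖ * ‖gterm Q q.1 q.2 m‖ ≤ 1 * ‖gterm Q q.1 q.2 m‖ := by gcongr; exact hc m
      _ ≤ _ := by rw [one_mul]; exact hK q.1 q.2 h1 h2 m

end

end HermJac

namespace HermJac

open MeasureTheory Set Filter Topology

noncomputable section

variable {n : ℕ} {Q : Matrix (Fin n) (Fin n) ℝ}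

/-! ### Poisson summation for Gaussians -/

open scoped MatrixOrder in
theorem exists_integral_gaussian_form (hQ : Q.PosDef) :
    ∃ K : ℂ, K ≠ 0 ∧ ∀ b : ℂ, 0 < b.re →
      Integrable (fun x : Fin n → ℝ => Complex.exp (-b * (x ⬝ᵥ (Q *ᵥ x) : ℝ))) ∧
      ∫ x : Fin n → ℝ, Complex.exp (-b * (x ⬝ᵥ (Q *ᵥ x) : ℝ)) = K * (Real.pi / b) ^ (n / 2 : ℂ) := by
  obtain ⟨B, hB⟩ := CStarAlgebra.nonneg_iff_eq_star_mul_self.mp hQ.posSemidef.nonneg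
  have hdet : B.det ≠ 0 := by
    intro h0
    have : Q.det = 0 := by rw [hB, Matrix.det_mul, h0, mul_zero]
    exact hQ.det_pos.ne' this
  have hform : ∀ x : Fin n → ℝ, x ⬝ᵥ (Q *ᵥ x) = ∑ i, (B *ᵥ x) i ^ 2 := by
    intro x
    rw [hB, ← Matrix.mulVec_mulVec, Matrix.dotProduct_mulVec, Matrix.star_eq_conjTranspose,
      Matrix.conjTranspose_eq_transpose_of_trivial, Matrix.vecMul_transpose, dotProduct]
    simp [sq]
  have hmeas : MeasurableEmbedding fun x : Fin n → ℝ => B *ᵥ x := by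
    have hinj : Function.Injective (fun x : Fin n → ℝ => B *ᵥ x) :=
      Matrix.mulVec_injective_iff_isUnit.2 ((Matrix.isUnit_iff_isUnit_det B).2 hdet.isUnit)
    have hc : Continuous fun x : Fin n → ℝ => B *ᵥ x := by
      unfold Matrix.mulVec dotProduct; fun_prop
    exact hc.measurableEmbedding hinj
  have hmap := Real.map_matrix_volume_pi_eq_smul_volume_pi hdet
  have hfun : ⇑(Matrix.toLin' B) = fun x : Fin n → ℝ => B *ᵥ x := by
    ext x; simp
  rw [hfun] at hmap
  refine ⟨(|B.det⁻¹| : ℝ), by simpa using hdet, fun b hb => ?_⟩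
  set g : (Fin n → ℝ) → ℂ := fun v => Complex.exp (-b * ∑ i, (v i : ℂ) ^ 2) with hg
  have hgi : Integrable g := by
    simpa [hg] using GaussianFourier.integrable_cexp_neg_mul_sum_add (ι := Fin n) hb 0
  have hgv : ∫ v, g v = (Real.pi / b) ^ (n / 2 : ℂ) := by
    simpa [hg] using GaussianFourier.integral_cexp_neg_mul_sum_add (ι := Fin n) hb 0
  have hcomp : (fun x : Fin n → ℝ => Complex.exp (-b * (x ⬝ᵥ (Q *ᵥ x) : ℝ)))
      = g ∘ fun x => B *ᵥ x := by
    ext x; simp only [hg, Function.comp, hform]; push_cast; rfl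
  rw [hcomp]
  constructor
  · rw [← hmeas.integrable_map_iff, hmap]
    exact hgi.smul_measure ENNReal.ofReal_ne_top
  · have := hmeas.integral_map (μ := volume) g
    rw [hmap, integral_smul_measure, hgv, ENNReal.toReal_ofReal (abs_nonneg _)] at this
    rw [show ∫ x, (g ∘ fun x => B *ᵥ x) x = ∫ x, g (B *ᵥ x) from rfl, ← this]
    simp

/-- Unfolding of an integral over `ℝⁿ` to the unit cube. -/
theorem hasSum_integral_unitBox {E : Type*} [NormedAddCommGroup E] [NormedSpace ℝ E]
    {f : (Fin n → ℝ) → E} (hf : Integrable f) :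
    HasSum (fun k : Fin n → ℤ => ∫ x in unitBox n, f (x + fun i => (k i : ℝ))) (∫ x, f x) := by
  set B : (Fin n → ℤ) → Set (Fin n → ℝ) := fun k => {x | ∀ i, x i ∈ Ioc (k i : ℝ) (k i + 1)}
    with hB
  have hpre : ∀ k : Fin n → ℤ,
      (fun x : Fin n → ℝ => x + fun i => (k i : ℝ)) ⁻¹' B k = unitBox n := by
    intro k; ext x; simp only [hB, unitBox, mem_preimage, mem_ofPred_eq, Pi.add_apply, mem_Ioc]
    refine forall_congr' fun i => ?_
    constructor <;> rintro ⟨h1, h2⟩ <;> constructor <;> linarith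
  have hBm : ∀ k, MeasurableSet (B k) := by
    intro k
    have : B k = Set.pi univ fun i => Ioc (k i : ℝ) (k i + 1) := by ext; simp [hB]
    rw [this]; exact MeasurableSet.univ_pi fun _ => measurableSet_Ioc
  have hceil : ∀ (k : Fin n → ℤ) x, x ∈ B k ↔ k = fun i => ⌈x i⌉ - 1 := by
    intro k x
    rw [funext_iff]
    refine forall_congr' fun i => ?_
    rw [eq_sub_iff_add_eq, eq_comm, Int.ceil_eq_iff]
    push_cast
    rw [add_sub_cancel_right]; rfl
  have hdisj : Pairwise (Function.onFun Disjoint B) := by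
    intro k l hkl
    refine Set.disjoint_left.2 fun x hx hx' => hkl ?_
    rw [(hceil k x).1 hx, (hceil l x).1 hx']
  have hun : ⋃ k, B k = univ := by
    refine eq_univ_of_forall fun x => mem_iUnion.2 ⟨_, (hceil _ x).2 rfl⟩
  have := hasSum_integral_iUnion (μ := volume) (f := f) hBm hdisj (by rw [hun]; simpa using hf)
  rw [hun, setIntegral_univ] at this
  convert! this using 2 with k
  rw [← hpre k]
  exact (measurePreserving_add_right volume (fun i => (k i : ℝ))).setIntegral_preimage_emb
    (MeasurableEquiv.addRight _).measurableEmbedding f (B k)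

/-- The Gaussian sum `∑ₖ 𝐞(σ (ξ+k)ᵗQ(ξ+k)/2)`. -/
def gsum (Q : Matrix (Fin n) (Fin n) ℝ) (σ : ℂ) (ξ : Fin n → ℂ) : ℂ :=
  ∑' k : Fin n → ℤ, cexpo (σ * (bform Q (ξ + vecZ k) (ξ + vecZ k) / 2))

theorem zdot_eq_dotProduct (m : Fin n → ℤ) (ζ : Fin n → ℂ) : zdot m ζ = vecZ m ⬝ᵥ ζ := rfl

theorem gsum_term (hQ : Q.IsHermitian) (σ : ℂ) (ξ : Fin n → ℂ) (k : Fin n → ℤ) :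
    cexpo (σ * (bform Q (ξ + vecZ k) (ξ + vecZ k) / 2))
      = cexpo (σ * (bform Q ξ ξ / 2)) * gterm Q σ (σ • (Q.map Complex.ofReal *ᵥ ξ)) k := by
  rw [gterm, ← cexpo_add, zdot_smul, zdot_eq_dotProduct,
    show vecZ k ⬝ᵥ (Q.map Complex.ofReal *ᵥ ξ) = bform Q (vecZ k) ξ from rfl,
    bform_add_left, bform_add_right, bform_add_right, bform_comm hQ ξ (vecZ k)]
  congr 1; ring

theorem differentiable_gsum (hQ : Q.PosDef) {σ : ℂ} (hσ : 0 < σ.im) :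
    Differentiable ℂ (gsum Q σ) := by
  have h : gsum Q σ = fun ξ => cexpo (σ * (bform Q ξ ξ * (1 / 2))) *
      ∑' k, 1 * gterm Q σ (σ • (Q.map Complex.ofReal *ᵥ ξ)) k := by
    ext ξ
    simp_rw [gsum, gsum_term hQ.1, tsum_mul_left, one_mul, div_eq_mul_one_div (bform Q ξ ξ)]
  rw [h]
  refine Differentiable.mul (differentiable_cexpo.comp
    ((differentiable_bform_self.mul_const (1 / 2 : ℂ)).const_mul σ)) fun ξ => ?_
  have h1 := differentiableAt_gseries hQ (c := fun _ => 1) (fun _ => by simp)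
    (p := (σ, σ • (Q.map Complex.ofReal *ᵥ ξ))) hσ
  have h2 : Differentiable ℂ fun ξ : Fin n → ℂ => (σ, σ • (Q.map Complex.ofReal *ᵥ ξ)) := by
    unfold Matrix.mulVec dotProduct; fun_prop
  exact h1.comp ξ (h2 ξ)

theorem vecZ_add (k l : Fin n → ℤ) : vecZ (k + l) = vecZ k + vecZ l := by ext; simp [vecZ]

theorem gsum_add_vecZ (σ : ℂ) (ξ : Fin n → ℂ) (l : Fin n → ℤ) :
    gsum Q σ (ξ + vecZ l) = gsum Q σ ξ := by
  unfold gsum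
  rw [← (Equiv.addLeft l).tsum_eq fun k =>
    cexpo (σ * (bform Q (ξ + vecZ k) (ξ + vecZ k) / 2))]
  refine tsum_congr fun k => ?_
  simp [vecZ_add, add_assoc]

theorem map_inv_mulVec (hQ : Q.PosDef) (x : Fin n → ℂ) :
    Q.map Complex.ofReal *ᵥ (Q⁻¹.map Complex.ofReal *ᵥ x) = x := by
  have h : Q.map Complex.ofReal * Q⁻¹.map Complex.ofReal = 1 := by
    have h1 : Q * Q⁻¹ = 1 := Matrix.mul_nonsing_inv _ hQ.det_pos.ne'.isUnit
    have := congrArg (fun M => M.map Complex.ofReal) h1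
    rw [show (Q * Q⁻¹).map Complex.ofReal = Q.map Complex.ofReal * Q⁻¹.map Complex.ofReal from
      Matrix.map_mul (f := Complex.ofRealHom)] at this
    rw [this]; ext i j; simp [Matrix.one_apply]; split_ifs <;> simp
  rw [Matrix.mulVec_mulVec, h, Matrix.one_mulVec]

theorem im_neg_one_div_pos {τ : ℂ} (hτ : 0 < τ.im) : 0 < (-1 / τ).im := by
  have hτ0 : τ ≠ 0 := by rintro rfl; simp at hτ
  have := Complex.normSq_pos.2 hτ0
  have h : (-1 / τ).im = τ.im / Complex.normSq τ := by rw [Complex.div_im]; simp [neg_div]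
  rw [h]; positivity

theorem gsum_shift (hQ : Q.PosDef) {τ : ℂ} (hτ : τ ≠ 0) (ξ : Fin n → ℂ) (m : Fin n → ℤ) :
    gsum Q (-1 / τ) (ξ + τ • (Q⁻¹.map Complex.ofReal *ᵥ vecZ m))
      = cexpo (-(τ * (bform Q⁻¹ (vecZ m) (vecZ m) / 2)) - zdot m ξ) * gsum Q (-1 / τ) ξ := by
  unfold gsum
  rw [← tsum_mul_left]
  refine tsum_congr fun k => ?_
  set s := Q⁻¹.map Complex.ofReal *ᵥ vecZ m with hs
  have hb : ∀ x, bform Q x s = x ⬝ᵥ vecZ m := fun x => by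
    rw [bform, hs, map_inv_mulVec hQ]
  have hss : bform Q s s = bform Q⁻¹ (vecZ m) (vecZ m) := by
    rw [hb, dotProduct_comm]; rfl
  rw [show ξ + τ • s + vecZ k = (ξ + vecZ k) + τ • s by abel, bform_add_left (ξ + vecZ k),
    bform_add_right _ (ξ + vecZ k), bform_add_right _ (ξ + vecZ k), bform_smul_left,
    bform_smul_left, bform_smul_right, bform_smul_right, hss, bform_comm hQ.1 s, hb,
    ← cexpo_add]
  have hdot : (ξ + vecZ k) ⬝ᵥ vecZ m = zdot m ξ + ((∑ i, m i * k i : ℤ) : ℂ) := by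
    rw [← zdot_vecZ, ← zdot_add, zdot_eq_dotProduct, dotProduct_comm]
  rw [hdot, ← cexpo_add_int _ (-∑ i, m i * k i), eq_comm, ← cexpo_add_int _ (-∑ i, m i * k i),
    ← cexpo_add_int _ (-∑ i, m i * k i)]
  congr 1
  push_cast
  field_simp
  ring

theorem fcoef_gsum (hQ : Q.PosDef) {τ : ℂ} (hτ : 0 < τ.im) (m : Fin n → ℤ) :
    fcoef (gsum Q (-1 / τ)) m
      = cexpo (τ * (bform Q⁻¹ (vecZ m) (vecZ m) / 2)) * fcoef (gsum Q (-1 / τ)) 0 := by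
  have hτ0 : τ ≠ 0 := by rintro rfl; simp at hτ
  have hσ := im_neg_one_div_pos hτ
  have h := fcoef_shift (differentiable_gsum hQ hσ) (gsum_add_vecZ (-1 / τ)) 0
    (τ • (Q⁻¹.map Complex.ofReal *ᵥ vecZ m))
  rw [zdot_zero_left, cexpo_zero, one_mul] at h
  rw [← h]
  simp only [fcoef, gsum_shift hQ hτ0, zdot_zero_left, neg_zero, cexpo_zero, one_mul]
  rw [← integral_const_mul]
  congr 1; ext x
  rw [← mul_assoc, ← cexpo_add]
  congr 2; ring

theorem exists_fcoef_gsum_zero (hQ : Q.PosDef) :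
    ∃ K : ℂ, K ≠ 0 ∧ ∀ τ : ℂ, 0 < τ.im →
      fcoef (gsum Q (-1 / τ)) 0 = K * (τ / Complex.I) ^ (n / 2 : ℂ) := by
  obtain ⟨K, hK0, hK⟩ := exists_integral_gaussian_form hQ
  refine ⟨K, hK0, fun τ hτ => ?_⟩
  have hτ0 : τ ≠ 0 := by rintro rfl; simp at hτ
  set b : ℂ := Real.pi * Complex.I / τ with hb
  have hbre : 0 < b.re := by
    have h1 := Complex.normSq_pos.2 hτ0
    have h2 := Real.pi_pos
    have h : (Complex.I / τ).re = τ.im / Complex.normSq τ := by rw [Complex.div_re]; simp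
    rw [hb, mul_div_assoc, Complex.re_ofReal_mul, h]
    positivity
  obtain ⟨hi, hv⟩ := hK b hbre
  have hpb : (Real.pi : ℂ) / b = τ / Complex.I := by
    have : (Real.pi : ℂ) ≠ 0 := by exact_mod_cast Real.pi_ne_zero
    rw [hb]; field_simp
  rw [hpb] at hv
  rw [← hv]
  set f : (Fin n → ℝ) → ℂ := fun x => Complex.exp (-b * (x ⬝ᵥ (Q *ᵥ x) : ℝ)) with hf
  have hfx : ∀ x, f x = cexpo (-1 / τ * (bform Q (vecC x) (vecC x) / 2)) := by
    intro x
    rw [bform_vecC, hf, cexpo, hb]; field_simp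
  have hsum := hasSum_integral_unitBox hi
  have hsumn := (hasSum_integral_unitBox hi.norm).summable
  have hint : ∀ k : Fin n → ℤ, Integrable (fun x => f (x + fun i => (k i : ℝ)))
      (volume.restrict (unitBox n)) := fun k => (hi.comp_add_right _).restrict
  have hswap := hasSum_integral_of_summable_integral_norm hint hsumn
  rw [show integral volume f = ∫ x, f x from rfl, hsum.unique hswap, fcoef]
  simp only [zdot_zero_left, neg_zero, cexpo_zero, one_mul, gsum]
  refine integral_congr_ae (Eventually.of_forall fun x => tsum_congr fun k => ?_)
  rw [hfx, vecC_add, vecC_intCast]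

/-- The transformation formula of a Gaussian sum. -/
theorem exists_poisson_gsum (hQ : Q.PosDef) {b : ℕ} (hn : n = 2 * b) :
    ∃ K : ℂ, K ≠ 0 ∧ ∀ (τ : ℂ) (ξ : Fin n → ℂ), 0 < τ.im →
      HasSum (fun m => K * τ ^ b * gterm Q⁻¹ τ ξ m) (gsum Q (-1 / τ) ξ) := by
  obtain ⟨K, hK0, hK⟩ := exists_fcoef_gsum_zero hQ
  refine ⟨K * (Complex.I ^ b)⁻¹, by simp [hK0], fun τ ξ hτ => ?_⟩
  have hτ0 : τ ≠ 0 := by rintro rfl; simp at hτ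
  have hσ := im_neg_one_div_pos hτ
  have h := hasSum_fcoef (differentiable_gsum hQ hσ) (gsum_add_vecZ (-1 / τ)) ξ
  convert! h using 2 with m
  rw [fcoef_gsum hQ hτ, hK τ hτ, gterm, cexpo_add]
  have : ((n : ℂ) / 2) = (b : ℂ) := by rw [hn]; push_cast; ring
  rw [this, Complex.cpow_natCast, div_pow]
  field_simp

end

end HermJac

namespace HermJac

noncomputable section

/-! ### The order as a lattice in `ℂ` -/

/-- The generator `(d + √-d)/2` of the order. -/
def omegaGen (d : ℕ) : ℂ := ((d : ℂ) + sqrtNeg d) / 2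

theorem omegaGen_mem (d : ℕ) : omegaGen d ∈ qOrder d :=
  Subring.subset_closure (Set.mem_singleton _)

theorem omegaGen_im {d : ℕ} (hd : 0 < d) : 0 < (omegaGen d).im := by
  have h : (omegaGen d).im = Real.sqrt d / 2 := by
    have : omegaGen d = ((d / 2 : ℝ) : ℂ) + ((Real.sqrt d / 2 : ℝ) : ℂ) * Complex.I := by
      simp only [omegaGen, sqrtNeg]; push_cast; ring
    rw [this]; simp
  rw [h]
  have : 0 < Real.sqrt d := Real.sqrt_pos.2 (by exact_mod_cast hd)
  positivity

theorem exists_omegaGen_sq {d : ℕ} (hd4 : d % 4 = 0 ∨ d % 4 = 3) :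
    ∃ e : ℕ, omegaGen d * omegaGen d = d * omegaGen d - e := by
  have h4 : 4 ∣ d * d + d := by
    rcases hd4 with h | h <;> (have := Nat.div_add_mod d 4; rw [h] at this; rw [← this]; ring_nf; omega)
  obtain ⟨e, he⟩ := h4
  refine ⟨e, ?_⟩
  have h1 : sqrtNeg d * sqrtNeg d = -d := by
    have : ((Real.sqrt d : ℝ) : ℂ) * (Real.sqrt d : ℝ) = d := by
      rw [← Complex.ofReal_mul, Real.mul_self_sqrt (Nat.cast_nonneg d)]; simp
    rw [sqrtNeg]; linear_combination -this + ((Real.sqrt d : ℝ) : ℂ) * (Real.sqrt d : ℝ) * Complex.I_mul_I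
  have h2 : (d : ℂ) * d + d = 4 * e := by exact_mod_cast he
  rw [omegaGen]; linear_combination h1 / 4 - h2 / 4

theorem mem_qOrder_iff {d : ℕ} (hd4 : d % 4 = 0 ∨ d % 4 = 3) {x : ℂ} :
    x ∈ qOrder d ↔ ∃ a b : ℤ, x = a + b * omegaGen d := by
  constructor
  · intro hx
    obtain ⟨e, he⟩ := exists_omegaGen_sq hd4
    induction hx using Subring.closure_induction with
    | mem y hy => exact ⟨0, 1, by rw [Set.mem_singleton_iff.1 hy]; simp [omegaGen]⟩
    | zero => exact ⟨0, 0, by simp⟩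
    | one => exact ⟨1, 0, by simp⟩
    | add y z _ _ hy hz =>
      obtain ⟨a, b, rfl⟩ := hy
      obtain ⟨a', b', rfl⟩ := hz
      exact ⟨a + a', b + b', by push_cast; ring⟩
    | neg y _ hy =>
      obtain ⟨a, b, rfl⟩ := hy
      exact ⟨-a, -b, by push_cast; ring⟩
    | mul y z _ _ hy hz =>
      obtain ⟨a, b, rfl⟩ := hy
      obtain ⟨a', b', rfl⟩ := hz
      exact ⟨a * a' - b * b' * e, a * b' + b * a' + b * b' * d, by
        push_cast; linear_combination (b : ℂ) * b' * he⟩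
  · rintro ⟨a, b, rfl⟩
    exact add_mem (intCast_mem _ a) (mul_mem (intCast_mem _ b) (omegaGen_mem d))

theorem finite_qOrder {d : ℕ} (hd4 : d % 4 = 0 ∨ d % 4 = 3) : Module.Finite ℤ (qOrder d) := by
  let w : qOrder d := ⟨omegaGen d, omegaGen_mem d⟩
  refine ⟨⟨{1, w}, ?_⟩⟩
  rw [eq_top_iff]
  rintro ⟨x, hx⟩ -
  obtain ⟨a, b, rfl⟩ := (mem_qOrder_iff hd4).1 hx
  have : (⟨a + b * omegaGen d, hx⟩ : qOrder d) = a • (1 : qOrder d) + b • w := by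
    ext; simp [w]
  rw [this]
  refine add_mem (Submodule.smul_mem _ _ (Submodule.subset_span (by simp)))
    (Submodule.smul_mem _ _ (Submodule.subset_span (by simp)))

theorem star_mul_self_unit {d : ℕ} (hd : 0 < d) (hd4 : d % 4 = 0 ∨ d % 4 = 3) (ξ : (qOrder d)ˣ) :
    star ((ξ : qOrder d) : ℂ) * ((ξ : qOrder d) : ℂ) = 1 := by
  have key : ∀ x ∈ qOrder d, ∃ k : ℤ, star x * x = k ∧ 0 ≤ k := by
    intro x hx
    have h1 : star x * x = ((Complex.normSq x : ℝ) : ℂ) := by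
      rw [mul_comm]; exact Complex.mul_conj x
    obtain ⟨a, b, hab⟩ := (mem_qOrder_iff hd4).1 (mul_mem (star_mem_qOrder d hx) hx)
    have hb : b = 0 := by
      have := congrArg Complex.im hab
      rw [h1] at this
      simp at this
      rcases this with h | h
      · exact h
      · exact absurd h (omegaGen_im hd).ne'
    refine ⟨a, by rw [hab, hb]; simp, ?_⟩
    have h2 : ((Complex.normSq x : ℝ) : ℂ) = ((a : ℝ) : ℂ) := by rw [← h1, hab, hb]; simp
    have h3 : (a : ℝ) = Complex.normSq x := (Complex.ofReal_injective h2).symm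
    have : (0 : ℝ) ≤ a := h3 ▸ Complex.normSq_nonneg x
    exact_mod_cast this
  obtain ⟨k, hk, hk0⟩ := key _ (ξ : qOrder d).2
  obtain ⟨l, hl, hl0⟩ := key _ ((ξ⁻¹ : (qOrder d)ˣ) : qOrder d).2
  have hinv : ((ξ : qOrder d) : ℂ) * (((ξ⁻¹ : (qOrder d)ˣ) : qOrder d) : ℂ) = 1 := by
    rw [← Subring.coe_mul, Units.mul_inv]; simp
  have hkl : k * l = 1 := by
    have hs := congrArg star hinv
    rw [star_mul', star_one] at hs
    have : (k : ℂ) * l = 1 := by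
      rw [← hk, ← hl]
      calc _ = (star ((ξ : qOrder d) : ℂ) * star (((ξ⁻¹ : (qOrder d)ˣ) : qOrder d) : ℂ)) *
          (((ξ : qOrder d) : ℂ) * (((ξ⁻¹ : (qOrder d)ˣ) : qOrder d) : ℂ)) := by ring
        _ = 1 := by rw [hs, hinv, mul_one]
    exact_mod_cast this
  have : k = 1 := Int.eq_one_of_mul_eq_one_right hk0 hkl
  rw [hk, this]; simp

/-- `u ↦ u` from `𝒪^c` to `ℂ^c`, as a homomorphism. -/
def toCHom (d c : ℕ) : (Fin c → qOrder d) →+ (Fin c → ℂ) where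
  toFun := toC
  map_zero' := by ext i; simp [toC]
  map_add' u v := by ext i; simp [toC]

theorem toC_sum_zsmul {d c n : ℕ} (bas : Fin n → Fin c → qOrder d) (k : Fin n → ℤ) :
    toC (∑ i, k i • bas i) = ∑ i, (k i : ℂ) • toC (bas i) := by
  have := map_sum (toCHom d c) (fun i => k i • bas i) Finset.univ
  refine this.trans (Finset.sum_congr rfl fun i _ => ?_)
  rw [map_zsmul]
  ext j; simp [toCHom, toC]

theorem toC_nsmul {d c : ℕ} (k : ℕ) (u : Fin c → qOrder d) : toC (k • u) = (k : ℂ) • toC u := by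
  have := map_nsmul (toCHom d c) k u
  refine this.trans ?_
  ext j; simp [toCHom, toC]

/-! ### A basis of the lattice `Ω / ker S` -/

variable {d c : ℕ} {Δ : Type*} [AddCommGroup Δ] [Fintype Δ] {X : DiscForm d Δ}

/-- Elements `b₁, …, bₙ` of `ker ψ` whose classes form a `ℤ`-basis of the lattice `Ω / ker S`,
given as the image of `ker ψ` under `S`. -/
structure Frame (I : MatrixIndex d c X) where
  n : ℕ
  bas : Fin n → Fin c → qOrder d
  ψ_bas : ∀ i, I.ψ (bas i) = 0
  gen : ∀ u, I.ψ u = 0 → ∃ k : Fin n → ℤ, I.S *ᵥ (toC u - ∑ i, (k i : ℂ) • toC (bas i)) = 0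
  indep : ∀ k : Fin n → ℤ, I.S *ᵥ (∑ i, (k i : ℂ) • toC (bas i)) = 0 → k = 0

theorem nonempty_frame (hd4 : d % 4 = 0 ∨ d % 4 = 3) (I : MatrixIndex d c X) :
    Nonempty (Frame I) := by
  have := finite_qOrder hd4
  let L : (Fin c → qOrder d) →ₗ[ℤ] (Fin c → ℂ) :=
    (I.S.mulVecLin.toAddMonoidHom.comp (toCHom d c)).toIntLinearMap
  have hL : ∀ u, L u = I.S *ᵥ toC u := fun u => rfl
  let M : Submodule ℤ (Fin c → ℂ) := (LinearMap.ker I.ψ.toIntLinearMap).map L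
  have hfg : Module.Finite ℤ M := inferInstance
  have : Module.Free ℤ M := Module.free_of_finite_type_torsion_free'
  let b := Module.finBasis ℤ M
  have hlift : ∀ i, ∃ u : Fin c → qOrder d, I.ψ u = 0 ∧ I.S *ᵥ toC u = b i := by
    intro i
    obtain ⟨u, hu, hu'⟩ := (b i).2
    exact ⟨u, hu, hu'⟩
  choose bas hbas hbas' using hlift
  have hsum : ∀ k : Fin _ → ℤ, I.S *ᵥ (∑ i, (k i : ℂ) • toC (bas i)) = ((∑ i, k i • b i : M) : _) := by
    intro k
    rw [Matrix.mulVec_sum]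
    simp only [Matrix.mulVec_smul, hbas']
    rw [AddSubmonoidClass.coe_finsetSum]
    refine Finset.sum_congr rfl fun i _ => ?_
    ext j; simp
  refine ⟨⟨_, bas, hbas, fun u hu => ?_, fun k hk => ?_⟩⟩
  · refine ⟨b.repr ⟨L u, u, hu, rfl⟩, ?_⟩
    rw [Matrix.mulVec_sub, hsum, b.sum_repr]
    simp [hL]
  · rw [hsum] at hk
    have h0 : ∑ i, k i • b i = 0 := Subtype.ext hk
    ext i
    exact Fintype.linearIndependent_iff.1 b.linearIndependent k h0 i

end

end HermJac

namespace HermJac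

noncomputable section

variable {d c : ℕ} {Δ : Type*} [AddCommGroup Δ] [Fintype Δ] {X : DiscForm d Δ}
  {I : MatrixIndex d c X}

theorem herm_sum_left {n : ℕ} (S : Matrix (Fin c) (Fin c) ℂ) (x : Fin n → ℂ) (b : Fin n → Fin c → ℂ)
    (v : Fin c → ℂ) : herm S (∑ i, x i • b i) v = ∑ i, star (x i) * herm S (b i) v := by
  simp [herm, star_sum, sum_dotProduct]

theorem herm_sum_right {n : ℕ} (S : Matrix (Fin c) (Fin c) ℂ) (x : Fin n → ℂ)
    (b : Fin n → Fin c → ℂ) (v : Fin c → ℂ) :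
    herm S v (∑ i, x i • b i) = ∑ i, x i * herm S v (b i) := by
  simp [herm, Matrix.mulVec_sum, Matrix.mulVec_smul, dotProduct_sum]

theorem MatrixIndex.mulVec_eq_zero_of_hnorm (I : MatrixIndex d c X) {a : Fin c → ℂ}
    (h : hnorm I.S a = 0) : I.S *ᵥ a = 0 := by
  rw [← I.S_psd.dotProduct_mulVec_zero_iff]
  have h1 : star (herm I.S a a) = herm I.S a a := herm_conj I.S_psd.isHermitian a a
  have h2 : herm I.S a a = ((herm I.S a a).re : ℂ) := (Complex.conj_eq_iff_re.1 h1).symm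
  have h3 : (herm I.S a a).re = 0 := h
  rw [h3] at h2
  simpa [herm] using h2

theorem MatrixIndex.hnorm_nonneg (I : MatrixIndex d c X) (a : Fin c → ℂ) : 0 ≤ hnorm I.S a := by
  have := I.S_psd.dotProduct_mulVec_nonneg a
  exact (Complex.le_def.1 this).1

/-- The conjugate linear forms: `x ↦ ∑ xᵢ b̄ᵢ`. -/
def Frame.combStar (Fr : Frame I) (x : Fin Fr.n → ℂ) : Fin c → ℂ :=
  ∑ i, x i • star (toC (Fr.bas i))

/-- `x ↦ ∑ xᵢ bᵢ`. -/
def Frame.comb (Fr : Frame I) (x : Fin Fr.n → ℂ) : Fin c → ℂ := ∑ i, x i • toC (Fr.bas i)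

/-- The Gram matrix `Tr(bᵢ^* S bⱼ)`. -/
def Frame.gram (Fr : Frame I) : Matrix (Fin Fr.n) (Fin Fr.n) ℝ :=
  Matrix.of fun i j => htr I.S (toC (Fr.bas i)) (toC (Fr.bas j))

theorem mem_Om_of_psi (I : MatrixIndex d c X) {u : Fin c → qOrder d} (hu : I.ψ u = 0) :
    toC u ∈ I.Om := ⟨u, hu, 0, zero_mem _, by simp⟩

namespace Frame

variable (Fr : Frame I)

theorem comb_vecZ (k : Fin Fr.n → ℤ) : Fr.comb (vecZ k) = toC (∑ i, k i • Fr.bas i) :=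
  (toC_sum_zsmul _ _).symm

theorem comb_add (x y : Fin Fr.n → ℂ) : Fr.comb (x + y) = Fr.comb x + Fr.comb y := by
  simp [comb, add_smul, Finset.sum_add_distrib]

theorem comb_smul (r : ℂ) (x : Fin Fr.n → ℂ) : Fr.comb (r • x) = r • Fr.comb x := by
  simp [comb, Finset.smul_sum, mul_smul]

theorem psi_comb (k : Fin Fr.n → ℤ) : I.ψ (∑ i, k i • Fr.bas i) = 0 := by
  simp only [map_sum, map_zsmul, Fr.ψ_bas, smul_zero, Finset.sum_const_zero]

theorem gram_isHermitian : Fr.gram.IsHermitian := by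
  ext i j; simp [gram, htr_symm I.S_psd.isHermitian (toC (Fr.bas j))]

theorem htr_comb_left (x : Fin Fr.n → ℝ) (v : Fin c → ℂ) :
    htr I.S (Fr.comb (vecC x)) v = ∑ i, x i * htr I.S (toC (Fr.bas i)) v := by
  simp only [htr, comb, herm_sum_left, vecC, Complex.re_sum, Finset.mul_sum]
  refine Finset.sum_congr rfl fun i _ => ?_
  simp; ring

theorem htr_comb_right (x : Fin Fr.n → ℝ) (v : Fin c → ℂ) :
    htr I.S v (Fr.comb (vecC x)) = ∑ i, x i * htr I.S v (toC (Fr.bas i)) := by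
  rw [htr_symm I.S_psd.isHermitian, htr_comb_left]
  simp_rw [htr_symm I.S_psd.isHermitian v]

theorem htr_comb_bas (x : Fin Fr.n → ℝ) (i : Fin Fr.n) :
    htr I.S (Fr.comb (vecC x)) (toC (Fr.bas i)) = (Fr.gram *ᵥ x) i := by
  rw [htr_symm I.S_psd.isHermitian, htr_comb_right]
  simp [Matrix.mulVec, dotProduct, gram, mul_comm]

theorem htr_self (v : Fin c → ℂ) : htr I.S v v = 2 * hnorm I.S v := rfl

theorem htr_comb_comb (x y : Fin Fr.n → ℝ) :
    htr I.S (Fr.comb (vecC x)) (Fr.comb (vecC y)) = x ⬝ᵥ (Fr.gram *ᵥ y) := by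
  rw [htr_comb_left, dotProduct]
  refine Finset.sum_congr rfl fun i _ => ?_
  rw [htr_symm I.S_psd.isHermitian, htr_comb_bas]

theorem exists_int_gram : ∃ A : Matrix (Fin Fr.n) (Fin Fr.n) ℤ, Fr.gram = A.map (fun k : ℤ => (k : ℝ)) := by
  have : ∀ i j, ∃ k : ℤ, Fr.gram i j = k := fun i j =>
    (I.toC_mem_OmStar (Fr.bas i)).2 _ (mem_Om_of_psi I (Fr.ψ_bas j))
  choose A hA using this
  exact ⟨Matrix.of A, by ext i j; simp [hA]⟩

theorem gram_posSemidef : Fr.gram.PosSemidef := by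
  refine Matrix.PosSemidef.of_dotProduct_mulVec_nonneg Fr.gram_isHermitian fun x => ?_
  rw [star_trivial, ← htr_comb_comb, htr_self]
  have := I.hnorm_nonneg (Fr.comb (vecC x))
  positivity

theorem gram_posDef : Fr.gram.PosDef := by
  rw [Fr.gram_posSemidef.posDef_iff_det_ne_zero]
  obtain ⟨A, hA⟩ := Fr.exists_int_gram
  intro hdet
  have hdetA : A.det = 0 := by
    have h : Fr.gram.det = ((A.det : ℤ) : ℝ) := by
      rw [hA]; exact ((Int.castRingHom ℝ).map_det A).symm
    rw [h] at hdet; exact_mod_cast hdet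
  obtain ⟨k, hk0, hk⟩ := Matrix.exists_mulVec_eq_zero_iff.2 hdetA
  refine hk0 (Fr.indep k ?_)
  refine I.mulVec_eq_zero_of_hnorm ?_
  have h1 : Fr.gram *ᵥ (fun i => (k i : ℝ)) = 0 := by
    ext i
    have := congrFun hk i
    simp only [Matrix.mulVec, dotProduct, Pi.zero_apply] at this ⊢
    rw [hA]; simp only [Matrix.map_apply]; exact_mod_cast this
  have h2 := Fr.htr_comb_comb (fun i => (k i : ℝ)) (fun i => (k i : ℝ))
  rw [h1, dotProduct_zero, htr_self, vecC_intCast] at h2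
  have h3 : hnorm I.S (Fr.comb (vecZ k)) = 0 := by linarith
  exact h3

theorem gram_mul_inv : Fr.gram * Fr.gram⁻¹ = 1 :=
  Matrix.mul_nonsing_inv _ Fr.gram_posDef.det_pos.ne'.isUnit

theorem gram_mulVec_inv (x : Fin Fr.n → ℝ) : Fr.gram *ᵥ (Fr.gram⁻¹ *ᵥ x) = x := by
  rw [Matrix.mulVec_mulVec, gram_mul_inv, Matrix.one_mulVec]

theorem inv_mulVec_gram (x : Fin Fr.n → ℝ) : Fr.gram⁻¹ *ᵥ (Fr.gram *ᵥ x) = x := by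
  rw [Matrix.mulVec_mulVec, Matrix.nonsing_inv_mul _ Fr.gram_posDef.det_pos.ne'.isUnit,
    Matrix.one_mulVec]

/-- Elements of `ker ψ` in the kernel of `S`. -/
def kap (I : MatrixIndex d c X) : Set (Fin c → qOrder d) := {u | I.ψ u = 0 ∧ I.S *ᵥ toC u = 0}

theorem exists_comb_add_span (hd : 0 < d) (v : Fin c → ℂ) :
    ∃ x : Fin Fr.n → ℝ, ∃ p ∈ Submodule.span ℝ (toC '' kap I), v = Fr.comb (vecC x) + p := by
  let W : Submodule ℝ (Fin c → ℂ) :=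
    { carrier := {v | ∃ x : Fin Fr.n → ℝ, ∃ p ∈ Submodule.span ℝ (toC '' kap I),
        v = Fr.comb (vecC x) + p}
      add_mem' := by
        rintro _ _ ⟨x, p, hp, rfl⟩ ⟨y, q, hq, rfl⟩
        exact ⟨x + y, p + q, add_mem hp hq, by rw [vecC_add, comb_add]; abel⟩
      zero_mem' := ⟨0, 0, zero_mem _, by
        rw [show vecC (0 : Fin Fr.n → ℝ) = (0 : ℂ) • (0 : Fin Fr.n → ℂ) by ext; simp [vecC],
          comb_smul]; simp⟩
      smul_mem' := by
        rintro r _ ⟨x, p, hp, rfl⟩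
        refine ⟨r • x, r • p, Submodule.smul_mem _ _ hp, ?_⟩
        rw [show vecC (r • x) = (r : ℂ) • vecC x by ext; simp [vecC], comb_smul, smul_add]
        rfl }
  have hker : ∀ u, I.ψ u = 0 → toC u ∈ W := by
    intro u hu
    obtain ⟨k, hk⟩ := Fr.gen u hu
    refine ⟨fun i => (k i : ℝ), toC (u - ∑ i, k i • Fr.bas i), Submodule.subset_span
      ⟨_, ⟨?_, ?_⟩, rfl⟩, ?_⟩
    · rw [map_sub, hu, psi_comb, sub_zero]
    · rw [← hk, ← toC_sum_zsmul]; exact congrArg _ (map_sub (toCHom d c) _ _)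
    · rw [vecC_intCast, comb_vecZ]
      rw [show toC (u - ∑ i, k i • Fr.bas i) = toC u - toC (∑ i, k i • Fr.bas i) from
        map_sub (toCHom d c) _ _, add_sub_cancel]
  have hall : ∀ u : Fin c → qOrder d, toC u ∈ W := by
    intro u
    have h1 := hker (Fintype.card Δ • u) (by rw [map_nsmul, card_nsmul_eq_zero])
    rw [toC_nsmul] at h1
    have hN : (Fintype.card Δ : ℝ) ≠ 0 := by exact_mod_cast Fintype.card_ne_zero
    have h2 := W.smul_mem (Fintype.card Δ : ℝ)⁻¹ h1
    convert h2 using 1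
    ext i
    have hN' : (Fintype.card Δ : ℂ) ≠ 0 := by exact_mod_cast Fintype.card_ne_zero
    simp [hN']
  suffices h : v ∈ W from h
  have hw := omegaGen_im hd
  have hv : v = ∑ i, (((v i).re - (v i).im / (omegaGen d).im * (omegaGen d).re : ℝ) •
      toC (Pi.single i (1 : qOrder d)) + ((v i).im / (omegaGen d).im : ℝ) •
      toC (Pi.single i (⟨omegaGen d, omegaGen_mem d⟩ : qOrder d))) := by
    ext j
    have hs : ∀ (i : Fin c) (a : qOrder d), toC (Pi.single i a) j = if i = j then (a : ℂ) else 0 := by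
      intro i a
      rcases eq_or_ne i j with rfl | h
      · simp [toC]
      · simp [toC, h]
    rw [Finset.sum_apply]
    simp only [Pi.add_apply, Pi.smul_apply, hs]
    rw [Finset.sum_eq_single j]
    · simp only [if_true]
      apply Complex.ext <;> simp
      field_simp
    · intro i _ hij; simp [hij]
    · simp
  rw [hv]
  exact W.sum_mem fun i _ => W.add_mem (W.smul_mem _ (hall _)) (W.smul_mem _ (hall _))

theorem mulVec_span {p : Fin c → ℂ} (hp : p ∈ Submodule.span ℝ (toC '' kap I)) :
    I.S *ᵥ p = 0 := by
  induction hp using Submodule.span_induction with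
  | mem x hx => obtain ⟨u, hu, rfl⟩ := hx; exact hu.2
  | zero => simp
  | add x y _ _ hx hy => rw [Matrix.mulVec_add, hx, hy, add_zero]
  | smul r x _ hx => rw [Matrix.mulVec_smul, hx, smul_zero]

theorem mulVec_eq_zero_of_htr (hd : 0 < d) {a : Fin c → ℂ}
    (h : ∀ i, htr I.S a (toC (Fr.bas i)) = 0) : I.S *ᵥ a = 0 := by
  refine I.mulVec_eq_zero_of_hnorm ?_
  obtain ⟨x, p, hp, hx⟩ := Fr.exists_comb_add_span hd a
  have h1 : htr I.S a a = 0 := by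
    nth_rewrite 2 [hx]
    rw [htr_add_right, htr_comb_right, htr, herm, mulVec_span hp]
    simp [h]
  rw [htr_self] at h1; linarith

theorem n_eq (hd : 0 < d) : Fr.n = 2 * I.S.rank := by
  let V := LinearMap.range (I.S.mulVecLin)
  let f : (Fin Fr.n → ℝ) →ₗ[ℝ] V :=
    { toFun := fun x => ⟨I.S *ᵥ Fr.comb (vecC x), ⟨_, rfl⟩⟩
      map_add' := fun x y => by
        ext1; simp [vecC_add, comb_add, Matrix.mulVec_add]
      map_smul' := fun r x => by
        ext1
        simp only [show vecC (r • x) = (r : ℂ) • vecC x by ext; simp [vecC], comb_smul,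
          Matrix.mulVec_smul]
        ext i; simp }
  have hinj : Function.Injective f := by
    rw [injective_iff_map_eq_zero]
    intro x hx
    have h0 : I.S *ᵥ Fr.comb (vecC x) = 0 := congrArg Subtype.val hx
    have h1 : Fr.gram *ᵥ x = 0 := by
      ext i
      rw [← htr_comb_bas, htr_symm I.S_psd.isHermitian, htr, herm, h0]; simp
    rw [← Fr.inv_mulVec_gram x, h1, Matrix.mulVec_zero]
  have hsurj : Function.Surjective f := by
    rintro ⟨_, v, rfl⟩
    obtain ⟨x, p, hp, hx⟩ := Fr.exists_comb_add_span hd v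
    refine ⟨x, ?_⟩
    ext1
    change I.S *ᵥ Fr.comb (vecC x) = I.S *ᵥ v
    rw [hx, Matrix.mulVec_add, mulVec_span hp, add_zero]
  have h1 := (LinearEquiv.ofBijective f ⟨hinj, hsurj⟩).finrank_eq
  rw [Module.finrank_fin_fun] at h1
  have h2 := finrank_real_of_complex V
  rw [h1, h2]; rfl

end Frame

end

end HermJac

namespace HermJac

noncomputable section

variable {d c : ℕ} {Δ : Type*} [AddCommGroup Δ] [Fintype Δ] {X : DiscForm d Δ}
  {I : MatrixIndex d c X}

theorem herm_congr {S : Matrix (Fin c) (Fin c) ℂ} (hS : S.IsHermitian) {a a' b b' : Fin c → ℂ}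
    (ha : S *ᵥ a = S *ᵥ a') (hb : S *ᵥ b = S *ᵥ b') : herm S a b = herm S a' b' := by
  rw [show herm S a b = herm S a b' by simp only [herm, hb], ← herm_conj hS b' a,
    show herm S b' a = herm S b' a' by simp only [herm, ha], herm_conj hS]

namespace Frame

variable (Fr : Frame I)

/-! ### Coordinates on `Ω^* / ker S` -/

/-- The integers `Tr(a^* S bᵢ)`. -/
def coordOm (a : I.OmStar) (i : Fin Fr.n) : ℤ :=
  Classical.choose (a.2.2 _ (mem_Om_of_psi I (Fr.ψ_bas i)))

theorem coordOm_spec (a : I.OmStar) (i : Fin Fr.n) :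
    htr I.S a (toC (Fr.bas i)) = Fr.coordOm a i :=
  Classical.choose_spec (a.2.2 _ (mem_Om_of_psi I (Fr.ψ_bas i)))

theorem coordOm_eq {a : I.OmStar} {m : Fin Fr.n → ℤ}
    (h : ∀ i, htr I.S a (toC (Fr.bas i)) = m i) : Fr.coordOm a = m := by
  ext i
  have := (Fr.coordOm_spec a i).symm.trans (h i)
  exact_mod_cast this

/-- The coordinates `Tr(a^* S bᵢ)` of a class in `Ω^* / ker S`. -/
def coord : I.Lam →+ (Fin Fr.n → ℤ) :=
  QuotientAddGroup.lift _
    ({ toFun := Fr.coordOm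
       map_zero' := Fr.coordOm_eq fun i => by simp [htr, herm]
       map_add' := fun a b => Fr.coordOm_eq fun i => by
        simp [htr_add_left, coordOm_spec] } : I.OmStar →+ (Fin Fr.n → ℤ))
    (by
      intro a ha
      have ha' : (a : Fin c → ℂ) ∈ I.kerS := ha
      refine Fr.coordOm_eq fun i => ?_
      rw [htr_symm I.S_psd.isHermitian, htr, I.herm_kerS ha']; simp)

theorem coord_mk (a : I.OmStar) (i : Fin Fr.n) :
    ((Fr.coord (QuotientAddGroup.mk a) i : ℤ) : ℝ) = htr I.S a (toC (Fr.bas i)) :=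
  (Fr.coordOm_spec a i).symm

/-- The real coordinates of a class in `Ω^* / ker S` with respect to the `bᵢ`. -/
def yvec (a : I.Lam) : Fin Fr.n → ℝ := Fr.gram⁻¹ *ᵥ fun i => (Fr.coord a i : ℝ)

theorem gram_mulVec_yvec (a : I.Lam) : Fr.gram *ᵥ Fr.yvec a = fun i => (Fr.coord a i : ℝ) :=
  Fr.gram_mulVec_inv _

theorem yvec_add (a b : I.Lam) : Fr.yvec (a + b) = Fr.yvec a + Fr.yvec b := by
  rw [yvec, yvec, yvec, ← Matrix.mulVec_add]
  congr 1; ext i; simp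

theorem mulVec_mk (hd : 0 < d) (a : I.OmStar) :
    I.S *ᵥ (a : Fin c → ℂ) = I.S *ᵥ Fr.comb (vecC (Fr.yvec (QuotientAddGroup.mk a))) := by
  rw [← sub_eq_zero, ← Matrix.mulVec_sub]
  refine Fr.mulVec_eq_zero_of_htr hd fun i => ?_
  have h1 : ∀ x y v : Fin c → ℂ, htr I.S (x - y) v = htr I.S x v - htr I.S y v := fun x y v => by
    have := htr_add_left I.S (x - y) y v
    rw [sub_add_cancel] at this; linarith
  rw [h1, htr_comb_bas, gram_mulVec_yvec, sub_eq_zero]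
  exact (Fr.coord_mk a i).symm

theorem coord_injective (hd : 0 < d) : Function.Injective Fr.coord := by
  rw [injective_iff_map_eq_zero]
  intro a ha
  induction a using QuotientAddGroup.induction_on with
  | H a =>
    rw [QuotientAddGroup.eq_zero_iff]
    refine ⟨a.2.1, ?_⟩
    change I.S *ᵥ (a : Fin c → ℂ) = 0
    rw [Fr.mulVec_mk hd, yvec, ha]
    have : vecC (Fr.gram⁻¹ *ᵥ fun i => (((0 : Fin Fr.n → ℤ) i : ℤ) : ℝ)) = 0 := by
      ext i; simp [vecC, Matrix.mulVec, dotProduct]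
    rw [this, comb]; simp

theorem exists_rat_inv : ∃ A : Matrix (Fin Fr.n) (Fin Fr.n) ℚ,
    Fr.gram⁻¹ = A.map (fun k : ℚ => (k : ℝ)) := by
  obtain ⟨A, hA⟩ := Fr.exists_int_gram
  have hA' : Fr.gram = (A.map (Int.castRingHom ℚ)).map (Rat.castHom ℝ) := by
    rw [hA]; ext i j; simp
  refine ⟨(A.map (Int.castRingHom ℚ))⁻¹, ?_⟩
  have hdet : (A.map (Int.castRingHom ℚ)).det ≠ 0 := by
    intro h0
    refine Fr.gram_posDef.det_pos.ne' ?_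
    rw [hA']
    have := (Rat.castHom ℝ).map_det (A.map (Int.castRingHom ℚ))
    rw [h0, map_zero] at this
    exact this.symm
  refine Matrix.inv_eq_right_inv ?_
  have h1 := Matrix.mul_nonsing_inv _ hdet.isUnit
  have h2 := congrArg (fun M => M.map (Rat.castHom ℝ)) h1
  simp only [Matrix.map_mul] at h2
  rw [hA']
  refine h2.trans ?_
  ext i j; simp [Matrix.one_apply]; split_ifs <;> simp

/-- A real coordinate vector `y` with `gram y` integral gives an element of `Ω^*`. -/
theorem comb_mem_OmStar (m : Fin Fr.n → ℤ) :
    Fr.comb (vecC (Fr.gram⁻¹ *ᵥ fun i => (m i : ℝ))) ∈ I.OmStar := by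
  constructor
  · obtain ⟨A, hA⟩ := Fr.exists_rat_inv
    intro j
    have : Fr.comb (vecC (Fr.gram⁻¹ *ᵥ fun i => (m i : ℝ))) j
        = ∑ i, (((A *ᵥ fun i => (m i : ℚ)) i : ℚ) : ℂ) * (Fr.bas i j : ℂ) := by
      simp only [comb, Finset.sum_apply, Pi.smul_apply, toC, smul_eq_mul, vecC, hA]
      refine Finset.sum_congr rfl fun i _ => ?_
      congr 1
      simp [Matrix.mulVec, dotProduct]
    rw [this]
    refine sum_mem fun i _ => mul_mem ?_ (qOrder_le_imQuad d (Fr.bas i j).2)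
    exact SubfieldClass.ratCast_mem _ _
  · rintro b ⟨u, hu, s, hs, rfl⟩
    obtain ⟨k, hk⟩ := Fr.gen u hu
    have h0 : I.S *ᵥ (toC u + s) = I.S *ᵥ ∑ i, (k i : ℂ) • toC (Fr.bas i) := by
      rw [Matrix.mulVec_sub, sub_eq_zero] at hk
      rw [Matrix.mulVec_add, hs.2, add_zero, hk]
    refine ⟨∑ i, k i * m i, ?_⟩
    rw [htr, herm_congr I.S_psd.isHermitian rfl h0, ← htr]
    have h1 : ∑ i, (k i : ℂ) • toC (Fr.bas i) = Fr.comb (vecC fun i => (k i : ℝ)) := by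
      rw [vecC_intCast]; rfl
    rw [h1, htr_comb_right]
    simp only [htr_comb_bas, gram_mulVec_inv]
    push_cast; rfl

theorem coord_surjective : Function.Surjective Fr.coord := by
  intro m
  refine ⟨QuotientAddGroup.mk ⟨_, Fr.comb_mem_OmStar m⟩, ?_⟩
  ext i
  have := Fr.coord_mk ⟨_, Fr.comb_mem_OmStar m⟩ i
  rw [htr_comb_bas, gram_mulVec_inv] at this
  exact_mod_cast this

/-- `Ω^* / ker S ≅ ℤⁿ`. -/
def coordEquiv (hd : 0 < d) : I.Lam ≃+ (Fin Fr.n → ℤ) :=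
  AddEquiv.ofBijective Fr.coord ⟨Fr.coord_injective hd, Fr.coord_surjective⟩

@[simp] theorem coordEquiv_apply (hd : 0 < d) (a : I.Lam) : Fr.coordEquiv hd a = Fr.coord a := rfl

/-- The linear coordinates on `ℂ^c × ℂ^c` dual to `coord`. -/
def zeta (z w : Fin c → ℂ) : Fin Fr.n → ℂ :=
  Fr.gram⁻¹.map Complex.ofReal *ᵥ
    fun i => herm I.S (toC (Fr.bas i)) z + w ⬝ᵥ (I.S *ᵥ toC (Fr.bas i))

theorem vecC_yvec (a : I.Lam) :
    vecC (Fr.yvec a) = Fr.gram⁻¹.map Complex.ofReal *ᵥ vecZ (Fr.coord a) := by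
  ext i; simp [vecC, yvec, Matrix.mulVec, dotProduct, vecZ]

theorem gram_map_mulVec_vecC_yvec (a : I.Lam) :
    Fr.gram.map Complex.ofReal *ᵥ vecC (Fr.yvec a) = vecZ (Fr.coord a) := by
  rw [vecC_yvec, map_inv_mulVec Fr.gram_posDef]

theorem htr_mk (hd : 0 < d) (a b : I.OmStar) :
    ((htr I.S a b : ℝ) : ℂ) = bform Fr.gram⁻¹ (vecZ (Fr.coord (QuotientAddGroup.mk a)))
      (vecZ (Fr.coord (QuotientAddGroup.mk b))) := by
  rw [htr, herm_congr I.S_psd.isHermitian (Fr.mulVec_mk hd a) (Fr.mulVec_mk hd b), ← htr,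
    htr_comb_comb, ← bform_vecC, bform, gram_map_mulVec_vecC_yvec, vecC_yvec, bform,
    dotProduct_comm]
  exact bform_comm Fr.gram_posDef.inv.1 _ _

theorem lamNorm_eq (hd : 0 < d) (a : I.Lam) :
    (I.lamNorm a : ℂ) = bform Fr.gram⁻¹ (vecZ (Fr.coord a)) (vecZ (Fr.coord a)) / 2 := by
  induction a using QuotientAddGroup.induction_on with
  | H a =>
    rw [← Fr.htr_mk hd, htr_self]
    rw [show I.lamNorm (QuotientAddGroup.mk a) = hnorm I.S a from rfl]
    push_cast; ring

theorem lamLin_eq (hd : 0 < d) (z w : Fin c → ℂ) (a : I.Lam) :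
    I.lamLin z w a = zdot (Fr.coord a) (Fr.zeta z w) := by
  induction a using QuotientAddGroup.induction_on with
  | H a =>
    rw [show I.lamLin z w (QuotientAddGroup.mk a) = herm I.S a z + w ⬝ᵥ (I.S *ᵥ (a : Fin c → ℂ))
      from rfl, herm_congr I.S_psd.isHermitian (Fr.mulVec_mk hd a) rfl, Fr.mulVec_mk hd a,
      zdot_eq_dotProduct, zeta]
    rw [show ∀ v, vecZ (Fr.coord (QuotientAddGroup.mk a)) ⬝ᵥ (Fr.gram⁻¹.map Complex.ofReal *ᵥ v)
      = bform Fr.gram⁻¹ (vecZ (Fr.coord (QuotientAddGroup.mk a))) v from fun _ => rfl,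
      bform_comm Fr.gram_posDef.inv.1, bform, ← vecC_yvec, comb, herm_sum_left,
      Matrix.mulVec_sum, dotProduct_sum, dotProduct, ← Finset.sum_add_distrib]
    refine Finset.sum_congr rfl fun i _ => ?_
    rw [Matrix.mulVec_smul, dotProduct_smul, smul_eq_mul]
    simp [vecC]; ring

theorem zeta_add (z w z' w' : Fin c → ℂ) :
    Fr.zeta (z + z') (w + w') = Fr.zeta z w + Fr.zeta z' w' := by
  rw [zeta, zeta, zeta, ← Matrix.mulVec_add]
  congr 1; ext i; simp [herm_add_right]; ring

theorem zeta_smul (r : ℂ) (z w : Fin c → ℂ) : Fr.zeta (r • z) (r • w) = r • Fr.zeta z w := by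
  rw [zeta, zeta, ← Matrix.mulVec_smul]
  congr 1; ext i; simp [herm_smul_right]; ring

theorem star_dotProduct_mulVec (u v : Fin c → ℂ) :
    star u ⬝ᵥ (I.S *ᵥ v) = herm I.S u v := rfl

theorem gram_coe (i j : Fin Fr.n) : (Fr.gram i j : ℂ) =
    herm I.S (toC (Fr.bas i)) (toC (Fr.bas j)) + herm I.S (toC (Fr.bas j)) (toC (Fr.bas i)) := by
  rw [← herm_conj I.S_psd.isHermitian (toC (Fr.bas i)) (toC (Fr.bas j))]
  simp only [gram, Matrix.of_apply, htr]
  exact (Complex.add_conj _).symm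

theorem zeta_comb (x : Fin Fr.n → ℂ) : Fr.zeta (Fr.comb x) (Fr.combStar x) = x := by
  have h : (fun i => herm I.S (toC (Fr.bas i)) (Fr.comb x)
      + Fr.combStar x ⬝ᵥ (I.S *ᵥ toC (Fr.bas i))) = Fr.gram.map Complex.ofReal *ᵥ x := by
    ext i
    rw [comb, combStar, herm_sum_right, sum_dotProduct, ← Finset.sum_add_distrib, Matrix.mulVec,
      dotProduct]
    refine Finset.sum_congr rfl fun j _ => ?_
    rw [smul_dotProduct, star_dotProduct_mulVec, Matrix.map_apply, gram_coe, smul_eq_mul]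
    ring
  rw [zeta, h]
  have hinv : Fr.gram⁻¹⁻¹ = Fr.gram := Matrix.nonsing_inv_nonsing_inv _ Fr.gram_posDef.det_pos.ne'.isUnit
  have := map_inv_mulVec Fr.gram_posDef.inv x
  rwa [hinv] at this

theorem combStar_add (x y : Fin Fr.n → ℂ) :
    Fr.combStar (x + y) = Fr.combStar x + Fr.combStar y := by
  simp [combStar, add_smul, Finset.sum_add_distrib]

theorem combStar_smul (r : ℂ) (x : Fin Fr.n → ℂ) : Fr.combStar (r • x) = r • Fr.combStar x := by
  simp [combStar, Finset.smul_sum, mul_smul]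

theorem kap_pair_span {p q : Fin c → ℂ}
    (h : (p, q) ∈ Submodule.span ℂ ((fun u => (toC u, star (toC u))) '' kap I)) :
    I.S *ᵥ p = 0 ∧ ∀ v, q ⬝ᵥ (I.S *ᵥ v) = 0 := by
  let W : Submodule ℂ ((Fin c → ℂ) × (Fin c → ℂ)) :=
    { carrier := {p | I.S *ᵥ p.1 = 0 ∧ ∀ v, p.2 ⬝ᵥ (I.S *ᵥ v) = 0}
      add_mem' := by
        rintro x y ⟨h1, h2⟩ ⟨h3, h4⟩
        exact ⟨by simp [Matrix.mulVec_add, h1, h3], fun v => by simp [h2, h4]⟩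
      zero_mem' := by simp
      smul_mem' := by
        rintro r x ⟨h1, h2⟩
        exact ⟨by simp [Matrix.mulVec_smul, h1], fun v => by simp [h2]⟩ }
  have : Submodule.span ℂ ((fun u => (toC u, star (toC u))) '' kap I) ≤ W := by
    refine Submodule.span_le.2 ?_
    rintro _ ⟨u, hu, rfl⟩
    refine ⟨hu.2, fun v => ?_⟩
    change herm I.S (toC u) v = 0
    rw [← herm_conj I.S_psd.isHermitian, herm, hu.2]; simp
  exact this h

theorem exists_pair_decomp (hd : 0 < d) (z w : Fin c → ℂ) :
    ∃ p q, (p, q) ∈ Submodule.span ℂ ((fun u => (toC u, star (toC u))) '' kap I) ∧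
      z = Fr.comb (Fr.zeta z w) + p ∧ w = Fr.combStar (Fr.zeta z w) + q := by
  set N := Submodule.span ℂ ((fun u : Fin c → qOrder d => (toC u, star (toC u))) '' kap I) with hN
  have key : ∀ v : Fin c → ℂ, ∃ x : Fin Fr.n → ℂ,
      (v, star v) - (Fr.comb x, Fr.combStar x) ∈ N := by
    intro v
    obtain ⟨x, p, hp, rfl⟩ := Fr.exists_comb_add_span hd v
    refine ⟨vecC x, ?_⟩
    have h1 : (Fr.comb (vecC x) + p, star (Fr.comb (vecC x) + p)) - (Fr.comb (vecC x),
        Fr.combStar (vecC x)) = (p, star p) := by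
      ext i
      · simp
      · simp [comb, combStar, vecC]
    rw [h1]
    induction hp using Submodule.span_induction with
    | mem x hx =>
      obtain ⟨u, hu, rfl⟩ := hx
      exact Submodule.subset_span ⟨u, hu, rfl⟩
    | zero => rw [star_zero]; exact zero_mem _
    | add x y _ _ hx hy =>
      have := add_mem (hx ?_) (hy ?_)
      · simpa using this
      · ext i <;> simp [comb, combStar, vecC]
      · ext i <;> simp [comb, combStar, vecC]
    | smul r x _ hx =>
      have := N.smul_mem (r : ℂ) (hx ?_)
      · convert this using 1
        ext i <;> simp
      · ext i <;> simp [comb, combStar, vecC]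
  obtain ⟨x, hx⟩ := key ((1 / 2 : ℂ) • (z + star w))
  obtain ⟨y, hy⟩ := key ((-Complex.I / 2) • (z - star w))
  have h := add_mem hx (N.smul_mem Complex.I hy)
  have e : ((1 / 2 : ℂ) • (z + star w), star ((1 / 2 : ℂ) • (z + star w))) - (Fr.comb x, Fr.combStar x)
      + Complex.I • (((-Complex.I / 2) • (z - star w), star ((-Complex.I / 2) • (z - star w))) -
        (Fr.comb y, Fr.combStar y)) =
      (z - Fr.comb (x + Complex.I • y), w - Fr.combStar (x + Complex.I • y)) := by
    ext i
    · simp [comb_add, comb_smul]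
      linear_combination (-1 / 2 * (z i - (starRingEnd ℂ) (w i))) * Complex.I_mul_I
    · simp [combStar_add, combStar_smul]
      linear_combination (1 / 2 * ((starRingEnd ℂ) (z i) - w i)) * Complex.I_mul_I
  rw [e] at h
  set ζ := x + Complex.I • y
  have hz : Fr.zeta z w = ζ := by
    have h0 := kap_pair_span h
    have h1 := Fr.zeta_add (Fr.comb ζ) (Fr.combStar ζ) (z - Fr.comb ζ) (w - Fr.combStar ζ)
    rw [add_sub_cancel, add_sub_cancel, zeta_comb] at h1
    rw [h1]
    have h2 : Fr.zeta (z - Fr.comb ζ) (w - Fr.combStar ζ) = 0 := by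
      rw [zeta]
      simp only [herm, h0.1, h0.2, dotProduct_zero, add_zero]
      exact Matrix.mulVec_zero _
    rw [h2, add_zero]
  rw [hz]
  exact ⟨_, _, h, by simp, by simp⟩

theorem dotProduct_mulVec_eq (hd : 0 < d) (z w : Fin c → ℂ) :
    w ⬝ᵥ (I.S *ᵥ z) = bform Fr.gram (Fr.zeta z w) (Fr.zeta z w) / 2 := by
  obtain ⟨p, q, hpq, hz, hw⟩ := Fr.exists_pair_decomp hd z w
  set ζ := Fr.zeta z w
  obtain ⟨hp, hq⟩ := kap_pair_span hpq
  rw [hz, hw, Matrix.mulVec_add, hp, add_zero, add_dotProduct, hq, add_zero, comb, combStar,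
    Matrix.mulVec_sum, sum_dotProduct]
  simp only [dotProduct_sum, Matrix.mulVec_smul, smul_dotProduct, dotProduct_smul, smul_eq_mul,
    star_dotProduct_mulVec]
  simp only [mul_left_comm (ζ _) (ζ _)]
  have h1 : bform Fr.gram ζ ζ = ∑ i, ∑ j, (ζ i * (ζ j * herm I.S (toC (Fr.bas i)) (toC (Fr.bas j)))
      + ζ j * (ζ i * herm I.S (toC (Fr.bas j)) (toC (Fr.bas i)))) := by
    simp only [bform, dotProduct, Matrix.mulVec, Matrix.map_apply, gram_coe, Finset.mul_sum]
    refine Finset.sum_congr rfl fun i _ => Finset.sum_congr rfl fun j _ => ?_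
    ring
  rw [h1]
  simp only [Finset.sum_add_distrib]
  rw [Finset.sum_comm (f := fun i j => ζ j * (ζ i * herm I.S (toC (Fr.bas j)) (toC (Fr.bas i))))]
  ring

end Frame

end

end HermJac

namespace HermJac

noncomputable section

variable {d c : ℕ} {Δ : Type*} [AddCommGroup Δ] [Fintype Δ] {X : DiscForm d Δ}
  {I : MatrixIndex d c X}

/-- The term `𝐞(τ a^*Sa + a^*Sz + w^tSa)` of the theta series. -/
def MatrixIndex.lterm (I : MatrixIndex d c X) (τ : ℂ) (z w : Fin c → ℂ) (a : I.Lam) : ℂ :=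
  cexpo (τ * (I.lamNorm a : ℂ) + I.lamLin z w a)

namespace Frame

variable (Fr : Frame I)

/-! ### The discriminant group of `Ω` -/

/-- The class of `∑ kᵢ bᵢ` in `Ω^* / ker S`. -/
def om (k : Fin Fr.n → ℤ) : I.Lam :=
  QuotientAddGroup.mk (⟨toC (∑ i, k i • Fr.bas i), I.toC_mem_OmStar _⟩ : I.OmStar)

theorem coord_om_real (k : Fin Fr.n → ℤ) :
    (fun i => (Fr.coord (Fr.om k) i : ℝ)) = Fr.gram *ᵥ fun i => (k i : ℝ) := by
  ext i
  rw [om, coord_mk, ← htr_comb_bas, vecC_intCast, comb_vecZ]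

theorem yvec_om (k : Fin Fr.n → ℤ) : Fr.yvec (Fr.om k) = fun i => (k i : ℝ) := by
  rw [yvec, coord_om_real, inv_mulVec_gram]

theorem toD_om (k : Fin Fr.n → ℤ) : I.toD (Fr.om k) = 0 :=
  (QuotientAddGroup.eq_zero_iff _).2 (mem_Om_of_psi I (Fr.psi_comb k))

theorem om_injective : Function.Injective Fr.om := by
  intro k l h
  have := congrArg Fr.yvec h
  rw [yvec_om, yvec_om] at this
  ext i
  exact_mod_cast congrFun this i

theorem toD_eq_zero_iff (a : I.Lam) : I.toD a = 0 ↔ ∃ k, a = Fr.om k := by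
  refine ⟨fun h => ?_, fun ⟨k, hk⟩ => hk ▸ Fr.toD_om k⟩
  induction a using QuotientAddGroup.induction_on with
  | H a =>
    have h1 : (a : Fin c → ℂ) ∈ I.Om := (QuotientAddGroup.eq_zero_iff a).1 h
    obtain ⟨u, hu, s, hs, hus⟩ := h1
    obtain ⟨k, hk⟩ := Fr.gen u hu
    refine ⟨k, ?_⟩
    rw [om, QuotientAddGroup.eq]
    have h2 : -(a : Fin c → ℂ) + toC (∑ i, k i • Fr.bas i)
        = -s + -(toC u - ∑ i, (k i : ℂ) • toC (Fr.bas i)) := by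
      rw [hus, toC_sum_zsmul]; abel
    change -(a : Fin c → ℂ) + toC (∑ i, k i • Fr.bas i) ∈ I.kerS
    rw [h2]
    refine add_mem (neg_mem hs) (neg_mem ⟨fun i => ?_, hk⟩)
    rw [← toC_sum_zsmul]
    exact sub_mem (qOrder_le_imQuad d (u i).2) (qOrder_le_imQuad d (Subtype.property _))

theorem toD_surjective (I : MatrixIndex d c X) : Function.Surjective I.toD := by
  intro γ
  induction γ using QuotientAddGroup.induction_on with
  | H a => exact ⟨QuotientAddGroup.mk a, rfl⟩

theorem finite_DOm (Fr : Frame I) (hd : 0 < d) : Finite I.DOm := by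
  obtain ⟨A, hA⟩ := Fr.exists_int_gram
  have hfin : Module.Finite ℤ I.Lam :=
    Module.Finite.equiv (Fr.coordEquiv hd).symm.toIntLinearEquiv
  have hfin' : Module.Finite ℤ I.DOm :=
    Module.Finite.of_surjective I.toD.toIntLinearMap (toD_surjective I)
  have hdet : A.det ≠ 0 := by
    intro h0
    refine Fr.gram_posDef.det_pos.ne' ?_
    have h : Fr.gram.det = ((A.det : ℤ) : ℝ) := by
      rw [hA]; exact ((Int.castRingHom ℝ).map_det A).symm
    rw [h, h0]; simp
  refine Module.finite_of_fg_torsion I.DOm fun γ => ?_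
  obtain ⟨a, rfl⟩ := toD_surjective I γ
  refine ⟨⟨A.det, mem_nonZeroDivisors_of_ne_zero hdet⟩, ?_⟩
  change A.det • I.toD a = 0
  rw [← map_zsmul, Fr.toD_eq_zero_iff]
  refine ⟨A.adjugate *ᵥ Fr.coord a, Fr.coord_injective hd ?_⟩
  rw [map_zsmul]
  have h1 : A *ᵥ (A.adjugate *ᵥ Fr.coord a) = A.det • Fr.coord a := by
    rw [Matrix.mulVec_mulVec, Matrix.mul_adjugate, Matrix.smul_mulVec, Matrix.one_mulVec]
  rw [← h1]
  ext i
  have h2 := congrFun (Fr.coord_om_real (A.adjugate *ᵥ Fr.coord a)) i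
  have h3 : (Fr.gram *ᵥ fun i => ((A.adjugate *ᵥ Fr.coord a) i : ℝ)) i
      = ((A *ᵥ (A.adjugate *ᵥ Fr.coord a)) i : ℤ) := by
    rw [hA, Matrix.mulVec, Matrix.mulVec, dotProduct, dotProduct]; push_cast; rfl
  rw [h3] at h2
  exact_mod_cast h2.symm

theorem qexpo_polar_toD (hd : 0 < d) (a b : I.Lam) :
    qexpo (QuadraticMap.polar I.qOm (I.toD a) (I.toD b))
      = cexpo (bform Fr.gram⁻¹ (vecZ (Fr.coord a)) (vecZ (Fr.coord b))) := by
  induction a using QuotientAddGroup.induction_on with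
  | H a =>
  induction b using QuotientAddGroup.induction_on with
  | H b =>
    rw [← Fr.htr_mk hd, ← qexpo_coe, ← I.polar_qFun a b]; rfl

theorem bform_inv_coord (a b : I.Lam) :
    bform Fr.gram⁻¹ (vecZ (Fr.coord a)) (vecZ (Fr.coord b)) = zdot (Fr.coord b) (vecC (Fr.yvec a)) := by
  rw [bform_comm Fr.gram_posDef.inv.1, vecC_yvec]; rfl

theorem zdot_coord (a : I.Lam) (x : Fin Fr.n → ℂ) :
    zdot (Fr.coord a) x = bform Fr.gram (vecC (Fr.yvec a)) x := by
  rw [bform_comm Fr.gram_posDef.1, bform, gram_map_mulVec_vecC_yvec, dotProduct_comm]; rfl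

/-- Every character of `D_Ω` is of the form `(a, ·)`. -/
theorem exists_polar_eq (Fr : Frame I) (hd : 0 < d) (χ : I.DOm →+ UnitAddCircle) :
    ∃ γ, ∀ δ, χ δ = QuadraticMap.polar I.qOm γ δ := by
  have hr : ∀ i, ∃ r : ℝ, χ (I.toD ((Fr.coordEquiv hd).symm (Pi.single i 1))) = (r : UnitAddCircle) :=
    fun i => (QuotientAddGroup.mk_surjective _).imp fun _ h => h.symm
  choose r hr using hr
  have hχ : ∀ a, χ (I.toD a) = ((∑ i, (Fr.coord a i : ℝ) * r i : ℝ) : UnitAddCircle) := by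
    intro a
    have h1 : Fr.coord a = ∑ i, Fr.coord a i • Pi.single i (1 : ℤ) := by
      ext j; simp [Finset.sum_apply, Pi.single_apply]
    have h2 : a = ∑ i, Fr.coord a i • (Fr.coordEquiv hd).symm (Pi.single i 1) := by
      apply (Fr.coordEquiv hd).injective
      rw [map_sum]
      simp only [map_zsmul, AddEquiv.apply_symm_apply]
      exact h1
    conv_lhs => rw [h2]
    rw [map_sum, map_sum]
    simp only [map_zsmul, hr]
    rw [show ((∑ i, (Fr.coord a i : ℝ) * r i : ℝ) : UnitAddCircle)
      = ∑ i, (((Fr.coord a i : ℝ) * r i : ℝ) : UnitAddCircle) from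
        map_sum (QuotientAddGroup.mk' _) _ _]
    refine Finset.sum_congr rfl fun i _ => ?_
    rw [← zsmul_eq_mul]; rfl
  have hint : ∀ i, ∃ m : ℤ, (Fr.gram *ᵥ r) i = m := by
    intro i
    have h1 := hχ (Fr.om (Pi.single i 1))
    rw [toD_om, map_zero] at h1
    obtain ⟨m, hm⟩ := (AddCircle.coe_eq_zero_iff (1 : ℝ)).1 h1.symm
    refine ⟨m, ?_⟩
    have h2 : ∑ j, (Fr.coord (Fr.om (Pi.single i 1)) j : ℝ) * r j = (Fr.gram *ᵥ r) i := by
      have h3 := Fr.coord_om_real (Pi.single i 1)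
      rw [Matrix.mulVec, dotProduct]
      refine Finset.sum_congr rfl fun j _ => ?_
      rw [congrFun h3 j, Matrix.mulVec, dotProduct, Finset.sum_eq_single i]
      · have := Fr.gram_isHermitian.apply i j
        simp only [star_trivial] at this
        simp [this]
      · intro l _ hl; simp [hl]
      · simp
    rw [← h2, ← hm]; simp
  choose m hm using hint
  obtain ⟨a, ha⟩ := Fr.coord_surjective m
  have hy : Fr.yvec a = r := by
    rw [yvec, ha, ← funext hm]; exact Fr.inv_mulVec_gram r
  refine ⟨I.toD a, fun δ => ?_⟩
  obtain ⟨b, rfl⟩ := toD_surjective I δ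
  apply qexpo_injective
  rw [Fr.qexpo_polar_toD hd, hχ, bform_inv_coord, hy, zdot_vecC, qexpo_coe]

/-! ### The theta series in coordinates -/

theorem lterm_eq (hd : 0 < d) (τ : ℂ) (z w : Fin c → ℂ) (a : I.Lam) :
    I.lterm τ z w a = gterm Fr.gram⁻¹ τ (Fr.zeta z w) (Fr.coord a) := by
  rw [MatrixIndex.lterm, gterm, Fr.lamNorm_eq hd, Fr.lamLin_eq hd]

theorem summable_norm_lterm (Fr : Frame I) (hd : 0 < d) {τ : ℂ} (hτ : 0 < τ.im) (z w : Fin c → ℂ) :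
    Summable fun a : I.Lam => ‖I.lterm τ z w a‖ := by
  simp_rw [Fr.lterm_eq hd]
  exact (summable_norm_gterm Fr.gram_posDef.inv hτ (Fr.zeta z w)).comp_injective
    (Fr.coord_injective hd)

theorem theta_eq_tsum (τ : UpperHalfPlane) (z w : Fin c → ℂ) (γ : I.DOm) :
    I.theta τ z w γ = ∑' a : I.Lam, {a | I.toD a = γ}.indicator (I.lterm τ z w) a :=
  tsum_subtype {a : I.Lam | I.toD a = γ} (I.lterm τ z w)

theorem hasSum_theta (Fr : Frame I) (hd : 0 < d) [Fintype I.DOm] (f : I.DOm → ℂ) (τ : UpperHalfPlane)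
    (z w : Fin c → ℂ) :
    HasSum (fun a => f (I.toD a) * I.lterm τ z w a) (∑ γ, f γ * I.theta τ z w γ) := by
  have h1 : ∀ γ, HasSum (fun a => f γ * {a | I.toD a = γ}.indicator (I.lterm τ z w) a)
      (f γ * I.theta τ z w γ) := by
    intro γ
    rw [theta_eq_tsum]
    refine HasSum.mul_left _ (Summable.hasSum ?_)
    exact ((Fr.summable_norm_lterm hd τ.im_pos z w).of_norm).indicator _
  have h2 := hasSum_sum (s := Finset.univ) fun γ _ => h1 γ
  convert h2 using 2 with a
  rw [Finset.sum_eq_single (I.toD a)]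
  · simp
  · intro γ _ hγ
    rw [Set.indicator_of_notMem (by simpa using hγ.symm), mul_zero]
  · simp

/-- Uniqueness of the coefficients of an expansion over `Ω^* / ker S`. -/
theorem lam_coeff_unique (Fr : Frame I) (hd : 0 < d) {f f' : I.Lam → ℂ} {g : (Fin c → ℂ) → (Fin c → ℂ) → ℂ}
    (h : ∀ z w, HasSum (fun a => f a * cexpo (I.lamLin z w a)) (g z w))
    (h' : ∀ z w, HasSum (fun a => f' a * cexpo (I.lamLin z w a)) (g z w)) : f = f' := by
  have key : ∀ f : I.Lam → ℂ, (∀ z w, HasSum (fun a => f a * cexpo (I.lamLin z w a)) (g z w)) →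
      ∀ a, f a = fcoef (fun ζ => g (Fr.comb ζ) (Fr.combStar ζ)) (Fr.coord a) := by
    intro f h a
    have := fourier_coeff_eq (c := fun m => f ((Fr.coordEquiv hd).symm m))
      (H := fun x => g (Fr.comb (vecC x)) (Fr.combStar (vecC x))) (fun x => ?_) (Fr.coord a)
    · rw [← coordEquiv_apply Fr hd, AddEquiv.symm_apply_apply] at this
      exact this
    · have h1 := (Fr.coordEquiv hd).symm.toEquiv.hasSum_iff.2
        (h (Fr.comb (vecC x)) (Fr.combStar (vecC x)))
      convert h1 using 2 with m
      have h2 : Fr.coord ((Fr.coordEquiv hd).symm m) = m := (Fr.coordEquiv hd).apply_symm_apply m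
      simp only [Function.comp]
      change _ = _ * cexpo (I.lamLin _ _ ((Fr.coordEquiv hd).symm m))
      rw [Fr.lamLin_eq hd, zeta_comb, h2]
      rfl
  ext a
  rw [key f h, key f' h']

/-- Holomorphy of the theta series. -/
theorem differentiableAt_theta (Fr : Frame I) (hd : 0 < d) (γ : I.DOm) {p : ℂ × (Fin c → ℂ) × (Fin c → ℂ)}
    (hp : 0 < p.1.im) :
    DifferentiableAt ℂ (fun p : ℂ × (Fin c → ℂ) × (Fin c → ℂ) =>
      I.theta (UpperHalfPlane.ofComplex p.1) p.2.1 p.2.2 γ) p := by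
  classical
  let cf : (Fin Fr.n → ℤ) → ℂ := fun m => if I.toD ((Fr.coordEquiv hd).symm m) = γ then 1 else 0
  have hcf : ∀ m, ‖cf m‖ ≤ 1 := fun m => by simp only [cf]; split_ifs <;> simp
  have h1 := differentiableAt_gseries Fr.gram_posDef.inv hcf (p := (p.1, Fr.zeta p.2.1 p.2.2)) hp
  have h2 : Differentiable ℂ fun p : ℂ × (Fin c → ℂ) × (Fin c → ℂ) =>
      (p.1, Fr.zeta p.2.1 p.2.2) := by
    unfold zeta herm Matrix.mulVec dotProduct; fun_prop
  have h3 := h1.comp p (h2 p)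
  refine h3.congr_of_eventuallyEq ?_
  have hopen : IsOpen {p : ℂ × (Fin c → ℂ) × (Fin c → ℂ) | 0 < p.1.im} :=
    isOpen_lt continuous_const (by fun_prop)
  filter_upwards [hopen.mem_nhds hp] with q hq
  rw [theta_eq_tsum]
  simp only [Function.comp]
  rw [← (Fr.coordEquiv hd).toEquiv.tsum_eq]
  refine tsum_congr fun a => ?_
  rw [UpperHalfPlane.ofComplex_apply_of_im_pos hq]
  simp only [cf, AddEquiv.toEquiv_eq_coe, AddEquiv.coe_toEquiv, AddEquiv.symm_apply_apply]
  simp only [Set.indicator, Set.mem_ofPred_eq]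
  split_ifs with h
  · rw [one_mul, Fr.lterm_eq hd]; rfl
  · simp

/-- The transformation of the theta series under `τ ↦ -1/τ`, up to a constant factor. -/
theorem exists_theta_inversion (Fr : Frame I) (hd : 0 < d) [Fintype I.DOm] :
    ∃ K : ℂ, K ≠ 0 ∧ ∀ (τ τ' : UpperHalfPlane) (z w : Fin c → ℂ) (γ : I.DOm),
      (τ' : ℂ) = -1 / (τ : ℂ) →
      I.theta τ' ((τ : ℂ)⁻¹ • z) ((τ : ℂ)⁻¹ • w) γ =
        K * (τ : ℂ) ^ I.S.rank * cexpo (w ⬝ᵥ (I.S *ᵥ z) / (τ : ℂ)) *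
          ∑ δ, qexpo (-QuadraticMap.polar I.qOm γ δ) * I.theta τ z w δ := by
  obtain ⟨K, hK0, hK⟩ := exists_poisson_gsum Fr.gram_posDef (Fr.n_eq hd)
  refine ⟨K, hK0, fun τ τ' z w γ hττ' => ?_⟩
  obtain ⟨a₀, rfl⟩ := toD_surjective I γ
  have hτ0 : (τ : ℂ) ≠ 0 := UpperHalfPlane.ne_zero τ
  set ζ := Fr.zeta z w with hζ
  set ξ := vecC (Fr.yvec a₀) - ζ with hξ
  have hL : I.theta τ' ((τ : ℂ)⁻¹ • z) ((τ : ℂ)⁻¹ • w) (I.toD a₀)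
      = cexpo (w ⬝ᵥ (I.S *ᵥ z) / (τ : ℂ)) * gsum Fr.gram (-1 / τ) ξ := by
    let e : (Fin Fr.n → ℤ) ≃ {a : I.Lam // I.toD a = I.toD a₀} :=
      Equiv.ofBijective (fun k => ⟨a₀ + Fr.om k, by rw [map_add, toD_om, add_zero]⟩) <| by
        constructor
        · intro k l h
          exact Fr.om_injective (add_left_cancel (congrArg Subtype.val h))
        · rintro ⟨a, ha⟩
          have : I.toD (a - a₀) = 0 := by rw [map_sub, ha, sub_self]
          obtain ⟨k, hk⟩ := (Fr.toD_eq_zero_iff _).1 this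
          exact ⟨k, Subtype.ext (by change a₀ + Fr.om k = a; rw [← hk]; abel)⟩
    rw [MatrixIndex.theta, ← e.tsum_eq, gsum, ← tsum_mul_left]
    refine tsum_congr fun k => ?_
    change I.lterm τ' _ _ (a₀ + Fr.om k) = _
    have hy : ξ + vecZ k = vecC (Fr.yvec (a₀ + Fr.om k)) - ζ := by
      rw [yvec_add, yvec_om, vecC_add, vecC_intCast, hξ]; abel
    rw [Fr.lterm_eq hd, gterm, Fr.zeta_smul, ← hζ, hττ', ← cexpo_add,
      Fr.dotProduct_mulVec_eq hd, ← hζ, hy, bform_inv_coord, zdot_coord, zdot_coord,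
      bform_smul_right]
    have h2 := bform_comm Fr.gram_posDef.1 ζ (vecC (Fr.yvec (a₀ + Fr.om k)))
    have h3 : bform Fr.gram (vecC (Fr.yvec (a₀ + Fr.om k)) - ζ) (vecC (Fr.yvec (a₀ + Fr.om k)) - ζ)
        = bform Fr.gram (vecC (Fr.yvec (a₀ + Fr.om k))) (vecC (Fr.yvec (a₀ + Fr.om k)))
          - 2 * bform Fr.gram (vecC (Fr.yvec (a₀ + Fr.om k))) ζ + bform Fr.gram ζ ζ := by
      rw [sub_eq_add_neg, bform_add_left, bform_add_right, bform_add_right,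
        ← neg_one_smul ℂ ζ, bform_smul_left, bform_smul_right, bform_smul_left, bform_smul_right, h2]
      ring
    rw [h3]
    congr 1
    field_simp
    ring
  have h4 := (Fr.hasSum_theta hd (fun δ => qexpo (-QuadraticMap.polar I.qOm (I.toD a₀) δ)) τ z w)
  have h5 := hK τ ξ τ.im_pos
  rw [← ((Fr.coordEquiv hd).toEquiv.trans (Equiv.neg _)).hasSum_iff] at h5
  have h6 := h5.unique (a₂ := K * (τ : ℂ) ^ I.S.rank *
      ∑ δ, qexpo (-QuadraticMap.polar I.qOm (I.toD a₀) δ) * I.theta τ z w δ) ?_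
  · rw [hL, h6]; ring
  · refine (congrArg (fun f => HasSum f _) (funext fun a => ?_)).mpr
      (h4.mul_left (K * (τ : ℂ) ^ I.S.rank))
    change K * (τ : ℂ) ^ I.S.rank * gterm Fr.gram⁻¹ τ ξ (-Fr.coord a) = _
    rw [qexpo_neg, Fr.qexpo_polar_toD hd, bform_inv_coord, ← cexpo_neg, Fr.lterm_eq hd, gterm, gterm,
      ← cexpo_add]
    have h7 : vecZ (-Fr.coord a) = (-1 : ℂ) • vecZ (Fr.coord a) := by ext i; simp [vecZ]
    have h8 : zdot (Fr.coord a) ξ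
        = zdot (Fr.coord a) (vecC (Fr.yvec a₀)) - zdot (Fr.coord a) ζ := by
      rw [hξ, zdot_eq_dotProduct, dotProduct_sub]; rfl
    rw [h7, bform_smul_left, bform_smul_right, zdot_neg_left, h8]
    congr 2
    ring

end Frame

end

end HermJac

namespace HermJac

noncomputable section

/-! ### Characters of finite abelian groups with values in `ℝ/ℤ` -/

/-- Characters of a subgroup extend. -/
theorem exists_character_extension {A : Type*} [AddCommGroup A] (H : AddSubgroup A)
    (χ : H →+ UnitAddCircle) : ∃ χ' : A →+ UnitAddCircle, ∀ h : H, χ' h = χ h := by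
  obtain ⟨f, hf⟩ := (Module.Baer.of_divisible UnitAddCircle).extension_property_addMonoidHom
    H.subtype H.subtype_injective χ
  exact ⟨f, fun h => DFunLike.congr_fun hf h⟩

/-- Characters separate points. -/
theorem exists_character_ne_zero {A : Type*} [AddCommGroup A] {a : A} (ha : a ≠ 0) :
    ∃ χ : A →+ UnitAddCircle, χ a ≠ 0 := by
  obtain ⟨χ, hχ⟩ := CharacterModule.exists_character_apply_ne_zero_of_ne_zero ha
  let κ : AddCircle (1 : ℚ) →+ UnitAddCircle :=
    QuotientAddGroup.map _ _ (Rat.castHom ℝ).toAddMonoidHom (by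
      rintro x ⟨n, rfl⟩
      exact ⟨n, by simp⟩)
  refine ⟨κ.comp (χ : A →+ AddCircle (1 : ℚ)), fun h => hχ ?_⟩
  obtain ⟨x, hx⟩ := QuotientAddGroup.mk_surjective (χ a)
  have h1 : ((x : ℝ) : UnitAddCircle) = 0 := by
    have h2 : κ (χ a) = 0 := h
    rw [← hx] at h2; exact h2
  obtain ⟨n, hn⟩ := (AddCircle.coe_eq_zero_iff (1 : ℝ)).1 h1
  rw [← hx]
  refine (AddCircle.coe_eq_zero_iff (1 : ℚ)).2 ⟨n, ?_⟩
  simp only [zsmul_eq_mul, mul_one] at hn ⊢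
  exact_mod_cast hn

/-- Orthogonality of characters. -/
theorem sum_qexpo_character {A : Type*} [AddCommGroup A] [Fintype A] (χ : A →+ UnitAddCircle) :
    ∑ a, qexpo (χ a) = if ∀ a, χ a = 0 then (Fintype.card A : ℂ) else 0 := by
  split_ifs with h
  · simp [h, qexpo_zero]
  · push Not at h
    obtain ⟨b, hb⟩ := h
    have h1 : qexpo (χ b) * ∑ a, qexpo (χ a) = ∑ a, qexpo (χ a) := by
      rw [Finset.mul_sum, ← Equiv.sum_comp (Equiv.addLeft b) fun a => qexpo (χ a)]
      simp [map_add, qexpo_add]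
    have h2 : qexpo (χ b) - 1 ≠ 0 := by
      rw [sub_ne_zero, Ne, qexpo_eq_one_iff]; exact hb
    have h3 : (qexpo (χ b) - 1) * ∑ a, qexpo (χ a) = 0 := by rw [sub_mul, h1]; ring
    exact (mul_eq_zero.1 h3).resolve_left h2

variable {d c : ℕ} {Δ D : Type*} [AddCommGroup Δ] [Fintype Δ] [AddCommGroup D] [Fintype D]
  {X : DiscForm d Δ} {I : MatrixIndex d c X} {Y : DiscForm d D} {hst : I.KerStable}

theorem polar_comm {A : Type*} [AddCommGroup A] (q : QuadraticMap ℤ A UnitAddCircle) (a b : A) :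
    QuadraticMap.polar q a b = QuadraticMap.polar q b a := QuadraticMap.polar_comm q a b

/-! ### Classes in `D_Ω` of vectors in `𝒪^c` -/

theorem MatrixIndex.cls_add (I : MatrixIndex d c X) (u v : Fin c → qOrder d) :
    I.cls (u + v) = I.cls u + I.cls v := by
  unfold cls
  rw [← QuotientAddGroup.mk_add]
  congr 1

theorem MatrixIndex.exists_cls_of_mem (I : MatrixIndex d c X) {γ : I.DOm} (h : γ ∈ I.DOmS) :
    ∃ u, γ = I.cls u := by
  let f : (Fin c → qOrder d) →+ I.DOm := AddMonoidHom.mk' I.cls I.cls_add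
  have h1 : I.DOmS ≤ f.range := by
    refine (AddSubgroup.closure_le _).2 ?_
    rintro _ ⟨u, rfl⟩
    exact ⟨u, rfl⟩
  obtain ⟨u, hu⟩ := h1 h
  exact ⟨u, hu.symm⟩

theorem MatrixIndex.cls_mem (I : MatrixIndex d c X) (u : Fin c → qOrder d) : I.cls u ∈ I.DOmS :=
  AddSubgroup.subset_closure ⟨u, rfl⟩

theorem MatrixIndex.mem_HOm (I : MatrixIndex d c X) {γ : I.DOm} :
    γ ∈ I.HOm ↔ ∀ u, QuadraticMap.polar I.qOm γ (I.cls u) = 0 := by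
  refine ⟨fun h u => h _ (I.cls_mem u), fun h δ hδ => ?_⟩
  obtain ⟨u, rfl⟩ := I.exists_cls_of_mem hδ
  exact h u

theorem Frame.mem_DOmS_of_perp (Fr : Frame I) (hd : 0 < d) {γ : I.DOm}
    (h : ∀ δ ∈ I.HOm, QuadraticMap.polar I.qOm δ γ = 0) : γ ∈ I.DOmS := by
  by_contra hγ
  have h1 : (QuotientAddGroup.mk γ : I.DOm ⧸ I.DOmS) ≠ 0 := by
    rwa [Ne, QuotientAddGroup.eq_zero_iff]
  obtain ⟨χ, hχ⟩ := exists_character_ne_zero h1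
  obtain ⟨δ, hδ⟩ := Fr.exists_polar_eq hd (χ.comp (QuotientAddGroup.mk' I.DOmS))
  refine hχ ?_
  have h2 := hδ γ
  rw [h δ] at h2
  · exact h2
  · rw [I.mem_HOm]
    intro u
    rw [← hδ]
    have : (QuotientAddGroup.mk' I.DOmS) (I.cls u) = 0 :=
      (QuotientAddGroup.eq_zero_iff _).2 (I.cls_mem u)
    rw [AddMonoidHom.comp_apply, this, map_zero]

/-! ### The action of the units on `D_Ω` -/

theorem mulD_mk (hst : I.KerStable) (x : qOrder d) (a : I.OmStar) :
    I.mulD hst x (QuotientAddGroup.mk a)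
      = QuotientAddGroup.mk (⟨(x : ℂ) • (a : Fin c → ℂ), I.smul_OmStar hst x a.2⟩ : I.OmStar) := rfl

theorem mulD_mul (hst : I.KerStable) (x y : qOrder d) (γ : I.DOm) :
    I.mulD hst (x * y) γ = I.mulD hst x (I.mulD hst y γ) := by
  induction γ using QuotientAddGroup.induction_on with
  | H a =>
    rw [mulD_mk, mulD_mk, mulD_mk]
    congr 1
    exact Subtype.ext (by simp [mul_smul])

theorem mulD_one (hst : I.KerStable) (γ : I.DOm) : I.mulD hst 1 γ = γ := by
  induction γ using QuotientAddGroup.induction_on with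
  | H a =>
    rw [mulD_mk]
    congr 1
    exact Subtype.ext (by simp)

theorem mulD_cls (hst : I.KerStable) (x : qOrder d) (u : Fin c → qOrder d) :
    I.mulD hst x (I.cls u) = I.cls (x • u) := by
  unfold MatrixIndex.cls
  rw [mulD_mk]
  congr 1

theorem qOm_mulD (hst : I.KerStable) (hd : 0 < d) (hd4 : d % 4 = 0 ∨ d % 4 = 3) (ξ : (qOrder d)ˣ)
    (γ : I.DOm) : I.qOm (I.mulD hst ξ γ) = I.qOm γ := by
  induction γ using QuotientAddGroup.induction_on with
  | H a =>
    rw [mulD_mk]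
    change ((hnorm I.S (((ξ : qOrder d) : ℂ) • (a : Fin c → ℂ)) : ℝ) : UnitAddCircle)
      = ((hnorm I.S (a : Fin c → ℂ) : ℝ) : UnitAddCircle)
    rw [hnorm, herm_smul_left, herm_smul_right, ← mul_assoc, star_mul_self_unit hd hd4, one_mul]
    rfl

theorem polar_mulD (hst : I.KerStable) (hd : 0 < d) (hd4 : d % 4 = 0 ∨ d % 4 = 3) (ξ : (qOrder d)ˣ)
    (γ δ : I.DOm) :
    QuadraticMap.polar I.qOm (I.mulD hst ξ γ) (I.mulD hst ξ δ) = QuadraticMap.polar I.qOm γ δ := by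
  simp only [QuadraticMap.polar, ← map_add, qOm_mulD hst hd hd4]

theorem DiscForm.polar_unit (Y : DiscForm d D) (ξ : (qOrder d)ˣ) (x y : D) :
    QuadraticMap.polar Y.q (Y.unit ξ x) (Y.unit ξ y) = QuadraticMap.polar Y.q x y := by
  simp only [QuadraticMap.polar, ← map_add, Y.unit_quad]

theorem DiscForm.unit_mul_apply (Y : DiscForm d D) (ξ ζ : (qOrder d)ˣ) (x : D) :
    Y.unit (ξ * ζ) x = Y.unit ξ (Y.unit ζ x) := by
  rw [map_mul]; rfl

theorem DiscForm.unit_one_apply (Y : DiscForm d D) (x : D) : Y.unit 1 x = x := by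
  rw [map_one]; rfl

/-- Multiplication by a unit as a permutation of `D_Ω`. -/
def mulDEquiv (hst : I.KerStable) (ξ : (qOrder d)ˣ) : I.DOm ≃ I.DOm where
  toFun := I.mulD hst ξ
  invFun := I.mulD hst (ξ⁻¹ : (qOrder d)ˣ)
  left_inv γ := by rw [← mulD_mul, ← Units.val_mul, inv_mul_cancel, Units.val_one, mulD_one]
  right_inv γ := by rw [← mulD_mul, ← Units.val_mul, mul_inv_cancel, Units.val_one, mulD_one]

/-- The action of a unit as a permutation of a discriminant form. -/
def DiscForm.unitEquiv (Y : DiscForm d D) (ξ : (qOrder d)ˣ) : D ≃ D where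
  toFun := Y.unit ξ
  invFun := Y.unit ξ⁻¹
  left_inv γ := by rw [← Y.unit_mul_apply, inv_mul_cancel, Y.unit_one_apply]
  right_inv γ := by rw [← Y.unit_mul_apply, mul_inv_cancel, Y.unit_one_apply]

theorem mulD_mem_HOm (hst : I.KerStable) (hd : 0 < d) (hd4 : d % 4 = 0 ∨ d % 4 = 3)
    (ξ : (qOrder d)ˣ) {γ : I.DOm} (hγ : γ ∈ I.HOm) : I.mulD hst ξ γ ∈ I.HOm := by
  rw [I.mem_HOm]
  intro u
  have h1 : I.cls u = I.mulD hst ξ (I.mulD hst (ξ⁻¹ : (qOrder d)ˣ) (I.cls u)) :=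
    ((mulDEquiv hst ξ).right_inv _).symm
  rw [h1, polar_mulD hst hd hd4, mulD_cls]
  exact I.mem_HOm.1 hγ _

/-! ### The gluing relation -/

theorem polar_sumForm (p q : I.DOm × D) : QuadraticMap.polar (sumForm I Y) p q
    = QuadraticMap.polar I.qOm p.1 q.1 + QuadraticMap.polar Y.q p.2 q.2 :=
  QuadraticMap.polar_prod I.qOm Y.q p q

namespace GlueData

variable (G : GlueData I Y hst)

theorem mem_perp_iff (p : I.DOm × D) : p ∈ perp (sumForm I Y) (glueSub I G.ι) ↔
    ∀ h : I.HOm, QuadraticMap.polar I.qOm p.1 h + QuadraticMap.polar Y.q p.2 (G.ι h) = 0 := by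
  constructor
  · intro hp h
    have := hp (h, G.ι h) ⟨h, rfl⟩
    rwa [polar_sumForm] at this
  · rintro hp _ ⟨h, rfl⟩
    rw [polar_sumForm]
    exact hp h

/-- The projection `H^⊥ → H^⊥/H ≅ Δ`. -/
def proj : perp (sumForm I Y) (glueSub I G.ι) →+ Δ :=
  G.iso.toAddMonoidHom.comp (QuotientAddGroup.mk' _)

/-- `(γ, x) ∈ H^⊥`, and its class in `Δ_H ≅ Δ` is `β`. -/
def Rel (γ : I.DOm) (x : D) (β : Δ) : Prop :=
  ∃ h : (γ, x) ∈ perp (sumForm I Y) (glueSub I G.ι), G.proj ⟨(γ, x), h⟩ = β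

variable {G} {γ γ' : I.DOm} {x x' : D} {β β' : Δ}

theorem rel_iff_exists : G.Rel γ x β ↔
    ∃ p : perp (sumForm I Y) (glueSub I G.ι), (p : I.DOm × D) = (γ, x) ∧ G.proj p = β := by
  constructor
  · rintro ⟨h, h'⟩
    exact ⟨⟨_, h⟩, rfl, h'⟩
  · rintro ⟨⟨p, hp⟩, rfl, h⟩
    exact ⟨hp, h⟩

theorem Rel.add (h : G.Rel γ x β) (h' : G.Rel γ' x' β') : G.Rel (γ + γ') (x + x') (β + β') := by
  obtain ⟨p, hp, hp'⟩ := rel_iff_exists.1 h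
  obtain ⟨r, hr, hr'⟩ := rel_iff_exists.1 h'
  exact rel_iff_exists.2 ⟨p + r, by rw [AddSubgroup.coe_add, hp, hr, Prod.mk_add_mk],
    by rw [map_add, hp', hr']⟩

theorem Rel.neg (h : G.Rel γ x β) : G.Rel (-γ) (-x) (-β) := by
  obtain ⟨p, hp, hp'⟩ := rel_iff_exists.1 h
  exact rel_iff_exists.2 ⟨-p, by rw [AddSubgroup.coe_neg, hp, Prod.neg_mk],
    by rw [map_neg, hp']⟩

theorem Rel.sub (h : G.Rel γ x β) (h' : G.Rel γ' x' β') : G.Rel (γ - γ') (x - x') (β - β') := by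
  rw [sub_eq_add_neg, sub_eq_add_neg, sub_eq_add_neg]; exact h.add h'.neg

theorem Rel.q (h : G.Rel γ x β) : X.q β = I.qOm γ + Y.q x := by
  obtain ⟨h, rfl⟩ := h
  exact G.iso_quad _

theorem Rel.polar (h : G.Rel γ x β) (h' : G.Rel γ' x' β') :
    QuadraticMap.polar X.q β β'
      = QuadraticMap.polar I.qOm γ γ' + QuadraticMap.polar Y.q x x' := by
  simp only [QuadraticMap.polar, (h.add h').q, h.q, h'.q]; abel

theorem rel_cls (u : Fin c → qOrder d) : G.Rel (I.cls u) 0 (I.ψ u) := by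
  have h : ((I.cls u, 0) : I.DOm × D) ∈ perp (sumForm I Y) (glueSub I G.ι) := by
    rw [mem_perp_iff]
    intro h
    rw [QuadraticMap.polar_zero_left, add_zero, polar_comm]
    exact I.mem_HOm.1 h.2 u
  exact ⟨h, G.iso_emb u _ rfl⟩

theorem polar_ι (h h' : I.HOm) : QuadraticMap.polar Y.q (G.ι h) (G.ι h')
    = -QuadraticMap.polar I.qOm (h : I.DOm) h' := by
  simp only [QuadraticMap.polar, ← map_add, G.ι_quad, AddSubgroup.coe_add]; abel

theorem rel_ι (h : I.HOm) : G.Rel h (G.ι h) 0 := by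
  have h1 : (((h : I.DOm), G.ι h) : I.DOm × D) ∈ perp (sumForm I Y) (glueSub I G.ι) := by
    rw [mem_perp_iff]
    intro h'
    rw [polar_ι, add_neg_cancel]
  refine ⟨h1, ?_⟩
  change G.iso (QuotientAddGroup.mk _) = 0
  rw [EmbeddingLike.map_eq_zero_iff, QuotientAddGroup.eq_zero_iff]
  exact ⟨h, rfl⟩

theorem Rel.exists_ι (h : G.Rel γ x 0) : ∃ h' : I.HOm, γ = h' ∧ x = G.ι h' := by
  obtain ⟨h, h0⟩ := h
  change G.iso (QuotientAddGroup.mk _) = 0 at h0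
  rw [EmbeddingLike.map_eq_zero_iff, QuotientAddGroup.eq_zero_iff] at h0
  obtain ⟨h', hh'⟩ := h0
  exact ⟨h', (congrArg Prod.fst hh').symm, (congrArg Prod.snd hh').symm⟩

theorem Rel.unique_right (h : G.Rel γ x β) (h' : G.Rel γ x β') : β = β' := by
  obtain ⟨_, rfl⟩ := h
  obtain ⟨_, rfl⟩ := h'
  rfl

theorem Rel.unique_mid (h : G.Rel γ x β) (h' : G.Rel γ x' β) : x = x' := by
  have h1 := h.sub h'
  rw [sub_self, sub_self] at h1
  obtain ⟨k, hk, hk'⟩ := h1.exists_ι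
  have : k = 0 := Subtype.ext hk.symm
  rw [this, map_zero] at hk'
  exact sub_eq_zero.1 hk'

theorem exists_rel_right (G : GlueData I Y hst) (β : Δ) : ∃ γ x, G.Rel γ x β := by
  obtain ⟨⟨⟨γ, x⟩, h⟩, hp⟩ := QuotientAddGroup.mk_surjective (G.iso.symm β)
  exact ⟨γ, x, h, (congrArg G.iso hp).trans (G.iso.apply_symm_apply β)⟩

theorem exists_rel_of_polar (G : GlueData I Y hst)
    (h : ∀ v, QuadraticMap.polar X.q β (I.ψ v) = QuadraticMap.polar I.qOm γ (I.cls v)) :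
    ∃ x, G.Rel γ x β := by
  obtain ⟨γ', x', h'⟩ := G.exists_rel_right β
  have h1 : γ - γ' ∈ I.HOm := by
    rw [I.mem_HOm]
    intro u
    rw [QuadraticMap.polar_sub_left, ← h u, h'.polar (rel_cls u), QuadraticMap.polar_zero_right,
      add_zero, sub_self]
  have h2 := h'.add (rel_ι ⟨_, h1⟩)
  rw [add_zero, add_sub_cancel] at h2
  exact ⟨_, h2⟩

theorem exists_rel_mid (G : GlueData I Y hst) (Fr : Frame I) (hd : 0 < d) (x : D) :
    ∃ γ β, G.Rel γ x β := by
  let χ : I.HOm →+ UnitAddCircle := AddMonoidHom.mk' (fun h => -QuadraticMap.polar Y.q x (G.ι h))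
    (by intro a b; rw [map_add, QuadraticMap.polar_add_right, neg_add])
  obtain ⟨χ', hχ'⟩ := exists_character_extension I.HOm χ
  obtain ⟨γ, hγ⟩ := Fr.exists_polar_eq hd χ'
  refine ⟨γ, _, (G.mem_perp_iff _).2 fun h => ?_, rfl⟩
  rw [← hγ, hχ']
  exact neg_add_cancel _

theorem Rel.exists_cls (Fr : Frame I) (hd : 0 < d) (h : G.Rel γ x β) (h' : G.Rel γ' x β') :
    ∃ u, γ' = γ + I.cls u ∧ β' = β + I.ψ u := by
  have h1 := h'.sub h
  rw [sub_self] at h1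
  have h2 : γ' - γ ∈ I.DOmS := Fr.mem_DOmS_of_perp hd fun δ hδ => by
    have := (G.mem_perp_iff _).1 h1.1 ⟨δ, hδ⟩
    rwa [QuadraticMap.polar_zero_left, add_zero, polar_comm] at this
  obtain ⟨u, hu⟩ := I.exists_cls_of_mem h2
  refine ⟨u, by rw [← hu]; abel, ?_⟩
  rw [hu] at h1
  rw [← h1.unique_right (rel_cls u)]; abel

theorem Rel.unit (hd : 0 < d) (hd4 : d % 4 = 0 ∨ d % 4 = 3) (ξ : (qOrder d)ˣ) (h : G.Rel γ x β) :
    G.Rel (I.mulD hst ξ γ) (Y.unit ξ x) (X.unit ξ β) := by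
  obtain ⟨h, rfl⟩ := h
  have h1 : (I.mulD hst ξ γ, Y.unit ξ x) ∈ perp (sumForm I Y) (glueSub I G.ι) := by
    rw [mem_perp_iff]
    intro k
    have hk : (k : I.DOm) = I.mulD hst ξ (I.mulD hst (ξ⁻¹ : (qOrder d)ˣ) k) :=
      ((mulDEquiv hst ξ).right_inv _).symm
    rw [G.ι_unit ξ ⟨_, mulD_mem_HOm hst hd hd4 ξ⁻¹ k.2⟩ k hk, Y.polar_unit,
      congrArg (QuadraticMap.polar I.qOm (I.mulD hst ξ γ)) hk, polar_mulD hst hd hd4]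
    exact (G.mem_perp_iff _).1 h ⟨_, mulD_mem_HOm hst hd hd4 ξ⁻¹ k.2⟩
  exact ⟨h1, G.iso_unit ξ _ _ rfl⟩

theorem rel_unit_iff (hd : 0 < d) (hd4 : d % 4 = 0 ∨ d % 4 = 3) (ξ : (qOrder d)ˣ) :
    G.Rel (I.mulD hst ξ γ) (Y.unit ξ x) (X.unit ξ β) ↔ G.Rel γ x β := by
  refine ⟨fun h => ?_, Rel.unit hd hd4 ξ⟩
  have h1 := h.unit hd hd4 ξ⁻¹
  have e1 : I.mulD hst (ξ⁻¹ : (qOrder d)ˣ) (I.mulD hst ξ γ) = γ := (mulDEquiv hst ξ).left_inv γ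
  have e2 : Y.unit ξ⁻¹ (Y.unit ξ x) = x := (Y.unitEquiv ξ).left_inv x
  have e3 : X.unit ξ⁻¹ (X.unit ξ β) = β := (X.unitEquiv ξ).left_inv β
  rwa [e1, e2, e3] at h1

end GlueData

/-! ### The operator `θ ⊗ v ↦ ↓_H(θ ⊗ v)` -/

namespace GlueData

open scoped Classical in
/-- The coefficient of `θ_γ` in the component of `↓_H(θ ⊗ v)` at `β`. -/
def pull (G : GlueData I Y hst) (v : D → ℂ) (β : Δ) (γ : I.DOm) : ℂ :=
  ∑ x, if G.Rel γ x β then v x else 0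

theorem pull_of_rel {G : GlueData I Y hst} (v : D → ℂ) {γ : I.DOm} {x : D} {β : Δ}
    (h : G.Rel γ x β) : G.pull v β γ = v x := by
  rw [pull, Finset.sum_eq_single x, if_pos h]
  · intro y _ hy
    rw [if_neg]
    exact fun h' => hy (h'.unique_mid h)
  · simp

theorem pull_of_not_rel {G : GlueData I Y hst} (v : D → ℂ) {γ : I.DOm} {β : Δ}
    (h : ∀ x, ¬ G.Rel γ x β) : G.pull v β γ = 0 :=
  Finset.sum_eq_zero fun x _ => if_neg (h x)

variable (G : GlueData I Y hst)

open scoped Classical in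
theorem downTensor_eq_sum [Fintype I.DOm] (θ : I.DOm → ℂ) (v : D → ℂ) (β : Δ) :
    G.downTensor θ v β = ∑ p : I.DOm × D, if G.Rel p.1 p.2 β then θ p.1 * v p.2 else 0 := by
  let e : {δ : perp (sumForm I Y) (glueSub I G.ι) //
      (QuotientAddGroup.mk δ : DeltaH (sumForm I Y) (glueSub I G.ι)) = G.iso.symm β} → I.DOm × D :=
    fun δ => (δ : perp (sumForm I Y) (glueSub I G.ι))
  have he : Function.Injective e := fun a b h => Subtype.ext (Subtype.ext h)
  have h1 := finsum_mem_range (f := fun p : I.DOm × D => θ p.1 * v p.2) he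
  rw [downTensor, downArrow]
  refine h1.symm.trans ?_
  rw [finsum_mem_def, finsum_eq_sum_of_fintype]
  refine Finset.sum_congr rfl fun p _ => ?_
  have hp : p ∈ Set.range e ↔ G.Rel p.1 p.2 β := by
    constructor
    · rintro ⟨δ, rfl⟩
      exact ⟨δ.1.2, (G.iso.eq_symm_apply).1 δ.2⟩
    · rintro ⟨h, h'⟩
      exact ⟨⟨⟨p, h⟩, (G.iso.eq_symm_apply).2 h'⟩, rfl⟩
  rw [Set.indicator_apply]
  simp only [hp]

theorem downTensor_eq [Fintype I.DOm] (θ : I.DOm → ℂ) (v : D → ℂ) (β : Δ) :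
    G.downTensor θ v β = ∑ γ, G.pull v β γ * θ γ := by
  classical
  rw [downTensor_eq_sum, Fintype.sum_prod_type]
  refine Finset.sum_congr rfl fun γ _ => ?_
  rw [pull, Finset.sum_mul]
  refine Finset.sum_congr rfl fun x _ => ?_
  dsimp only
  split_ifs
  · ring
  · ring

theorem Rel.iff_exists_ι {G : GlueData I Y hst} {γ₀ γ : I.DOm} {x₀ x : D} {β : Δ}
    (h₀ : G.Rel γ₀ x₀ β) : G.Rel γ x β ↔ ∃ h : I.HOm, γ = γ₀ + h ∧ x = x₀ + G.ι h := by
  constructor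
  · intro hp
    have h1 := hp.sub h₀
    rw [sub_self] at h1
    obtain ⟨h, e1, e2⟩ := h1.exists_ι
    exact ⟨h, by rw [← e1, add_sub_cancel], by rw [← e2, add_sub_cancel]⟩
  · rintro ⟨h, rfl, rfl⟩
    have := h₀.add (rel_ι h)
    rwa [add_zero] at this

open scoped Classical in
theorem Rel.sum_eq {G : GlueData I Y hst} [Fintype I.DOm] {γ₀ : I.DOm} {x₀ : D} {β : Δ}
    (h₀ : G.Rel γ₀ x₀ β) (g : I.DOm × D → ℂ) :
    (∑ p : I.DOm × D, if G.Rel p.1 p.2 β then g p else 0)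
      = ∑ h : I.HOm, g (γ₀ + h, x₀ + G.ι h) := by
  let e : I.HOm → I.DOm × D := fun h => (γ₀ + h, x₀ + G.ι h)
  have he : Function.Injective e := fun a b hab =>
    Subtype.ext (add_left_cancel (congrArg Prod.fst hab))
  rw [← Finset.sum_filter]
  change _ = ∑ h : I.HOm, g (e h)
  rw [← Finset.sum_image (s := Finset.univ) (g := e) (f := g) fun a _ b _ h => he h]
  refine Finset.sum_congr ?_ fun _ _ => rfl
  ext p
  rw [Finset.mem_filter, Finset.mem_image, h₀.iff_exists_ι]
  constructor
  · rintro ⟨-, h, h1, h2⟩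
    exact ⟨h, Finset.mem_univ _, (Prod.ext h1 h2).symm⟩
  · rintro ⟨h, -, rfl⟩
    exact ⟨Finset.mem_univ _, h, rfl, rfl⟩

/-- `↓_H` intertwines the Fourier kernels, up to a constant. -/
theorem downTensor_fourier [Fintype I.DOm] (θ : I.DOm → ℂ) (v : D → ℂ) (β : Δ) :
    G.downTensor (fun γ => ∑ δ, qexpo (-QuadraticMap.polar I.qOm γ δ) * θ δ)
        (fun x => ∑ y, qexpo (-QuadraticMap.polar Y.q y x) * v y) β
      = (Nat.card I.HOm : ℂ) *
        ∑ β', qexpo (-QuadraticMap.polar X.q β' β) * G.downTensor θ v β' := by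
  classical
  obtain ⟨γ₀, x₀, h₀⟩ := G.exists_rel_right β
  rw [downTensor_eq_sum, h₀.sum_eq fun p : I.DOm × D =>
    (∑ δ, qexpo (-QuadraticMap.polar I.qOm p.1 δ) * θ δ) *
      ∑ y, qexpo (-QuadraticMap.polar Y.q y p.2) * v y]
  have hM : ∀ h : I.HOm,
      (∑ δ, qexpo (-QuadraticMap.polar I.qOm (γ₀ + (h : I.DOm)) δ) * θ δ)
        * (∑ y, qexpo (-QuadraticMap.polar Y.q y (x₀ + G.ι h)) * v y)
      = ∑ p : I.DOm × D, qexpo (-(QuadraticMap.polar I.qOm p.1 h + QuadraticMap.polar Y.q p.2 (G.ι h)))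
          * (qexpo (-(QuadraticMap.polar I.qOm p.1 γ₀ + QuadraticMap.polar Y.q p.2 x₀))
            * (θ p.1 * v p.2)) := by
    intro h
    rw [Fintype.sum_prod_type, Finset.sum_mul_sum]
    refine Finset.sum_congr rfl fun δ _ => Finset.sum_congr rfl fun y _ => ?_
    rw [polar_comm I.qOm _ δ]
    simp only [QuadraticMap.polar_add_right, neg_add, qexpo_add]
    ring
  simp only [hM]
  rw [Finset.sum_comm]
  simp only [← Finset.sum_mul]
  have hchar : ∀ p : I.DOm × D,
      (∑ h : I.HOm, qexpo (-(QuadraticMap.polar I.qOm p.1 h + QuadraticMap.polar Y.q p.2 (G.ι h))))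
      = if p ∈ perp (sumForm I Y) (glueSub I G.ι) then (Nat.card I.HOm : ℂ) else 0 := by
    intro p
    let χ : I.HOm →+ UnitAddCircle := AddMonoidHom.mk'
      (fun h => -(QuadraticMap.polar I.qOm p.1 h + QuadraticMap.polar Y.q p.2 (G.ι h)))
      (by intro a b; rw [map_add, AddSubgroup.coe_add, QuadraticMap.polar_add_right,
            QuadraticMap.polar_add_right]; abel)
    refine (sum_qexpo_character χ).trans ?_
    rw [Nat.card_eq_fintype_card]
    refine if_congr ?_ rfl rfl
    rw [mem_perp_iff]
    exact forall_congr' fun h => neg_eq_zero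
  simp only [hchar]
  simp only [downTensor_eq_sum, Finset.mul_sum]
  rw [Finset.sum_comm]
  refine Finset.sum_congr rfl fun p _ => ?_
  split_ifs with hp
  · have hR : G.Rel p.1 p.2 (G.proj ⟨p, hp⟩) := ⟨hp, rfl⟩
    rw [Finset.sum_eq_single (G.proj ⟨p, hp⟩), if_pos hR, hR.polar h₀]
    · intro β' _ hβ'
      rw [if_neg, mul_zero, mul_zero]
      exact fun h => hβ' (h.unique_right hR)
    · simp
  · rw [zero_mul]
    symm
    refine Finset.sum_eq_zero fun β' _ => ?_
    rw [if_neg (fun h => hp h.1), mul_zero, mul_zero]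

theorem downTensor_weilT [Fintype I.DOm] (θ : I.DOm → ℂ) (v : D → ℂ) :
    G.downTensor (fun γ => qexpo (I.qOm γ) * θ γ) (Y.weilT v) = X.weilT (G.downTensor θ v) := by
  classical
  ext β
  change _ = qexpo (X.q β) * G.downTensor θ v β
  rw [downTensor_eq_sum, downTensor_eq_sum, Finset.mul_sum]
  refine Finset.sum_congr rfl fun p _ => ?_
  split_ifs with h
  · change qexpo (I.qOm p.1) * θ p.1 * (qexpo (Y.q p.2) * v p.2) = _
    rw [h.q, qexpo_add]; ring
  · simp

theorem downTensor_unit [Fintype I.DOm] (hd : 0 < d) (hd4 : d % 4 = 0 ∨ d % 4 = 3)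
    (ξ : (qOrder d)ˣ) (θ : I.DOm → ℂ) (v : D → ℂ) (β : Δ) :
    G.downTensor (fun γ => θ (I.mulD hst ξ γ)) (fun x => v (Y.unit ξ x)) β
      = G.downTensor θ v (X.unit ξ β) := by
  classical
  rw [downTensor_eq_sum, downTensor_eq_sum,
    ← ((mulDEquiv hst ξ).prodCongr (Y.unitEquiv ξ)).sum_comp
      fun p : I.DOm × D => if G.Rel p.1 p.2 (X.unit ξ β) then θ p.1 * v p.2 else 0]
  exact Finset.sum_congr rfl fun p _ => if_congr (rel_unit_iff hd hd4 ξ).symm rfl rfl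

theorem downTensor_smul_right [Fintype I.DOm] (r : ℂ) (θ : I.DOm → ℂ) (v : D → ℂ) :
    G.downTensor θ (r • v) = r • G.downTensor θ v := by
  classical
  ext β
  rw [Pi.smul_apply, downTensor_eq_sum, downTensor_eq_sum, Finset.smul_sum]
  refine Finset.sum_congr rfl fun p _ => ?_
  split_ifs
  · simp; ring
  · simp

theorem downTensor_smul_left [Fintype I.DOm] (r : ℂ) (θ : I.DOm → ℂ) (v : D → ℂ) :
    G.downTensor (r • θ) v = r • G.downTensor θ v := by
  classical
  ext β
  rw [Pi.smul_apply, downTensor_eq_sum, downTensor_eq_sum, Finset.smul_sum]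
  refine Finset.sum_congr rfl fun p _ => ?_
  split_ifs
  · simp; ring
  · simp

/-- The expansion of `↓_H(Θ ⊗ v)`. -/
theorem hasSum_downTensor (Fr : Frame I) (hd : 0 < d) (v : D → ℂ) (τ : UpperHalfPlane)
    (z w : Fin c → ℂ) (β : Δ) :
    HasSum (fun a => G.pull v β (I.toD a) * I.lterm τ z w a) (G.downTensor (I.theta τ z w) v β) := by
  have := Fr.finite_DOm hd
  have := Fintype.ofFinite I.DOm
  rw [downTensor_eq]
  exact Fr.hasSum_theta hd _ τ z w

theorem hasSum_downTensor' (Fr : Frame I) (hd : 0 < d) (v : D → ℂ) (τ : UpperHalfPlane)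
    (z w : Fin c → ℂ) (β : Δ) :
    HasSum (fun a => G.pull v β (I.toD a) * cexpo ((τ : ℂ) * (I.lamNorm a : ℂ))
      * cexpo (I.lamLin z w a)) (G.downTensor (I.theta τ z w) v β) := by
  simpa only [MatrixIndex.lterm, cexpo_add, mul_assoc] using G.hasSum_downTensor Fr hd v τ z w β

/-- `v` is determined by `↓_H(Θ(τ,·,·) ⊗ v)`. -/
theorem downTensor_theta_injective (Fr : Frame I) (hd : 0 < d) (τ : UpperHalfPlane) {v v' : D → ℂ}
    (h : ∀ z w, G.downTensor (I.theta τ z w) v = G.downTensor (I.theta τ z w) v') : v = v' := by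
  ext x
  obtain ⟨γ, β, hR⟩ := G.exists_rel_mid Fr hd x
  obtain ⟨a, rfl⟩ := Frame.toD_surjective I γ
  have h1 := Fr.lam_coeff_unique hd (fun z w => G.hasSum_downTensor' Fr hd v τ z w β)
    (fun z w => by rw [h]; exact G.hasSum_downTensor' Fr hd v' τ z w β)
  have h2 := mul_right_cancel₀ (cexpo_ne_zero _) (congrFun h1 a)
  rwa [pull_of_rel v hR, pull_of_rel v' hR] at h2

end GlueData

end

end HermJac

namespace HermJac

noncomputable section

/-! ### The group `U(1,1)(ℤ)` -/

section Group

variable {d : ℕ}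

theorem mat_mul (A B : U11 d) : mat (A * B) = mat A * mat B := toMat_mul _ _

theorem mat_one : mat (1 : U11 d) = 1 := toMat_one

theorem mat_injective : Function.Injective (mat : U11 d → Matrix (Fin 2) (Fin 2) ℂ) := by
  intro A B h
  refine Subtype.ext (Units.ext ?_)
  ext i j
  exact congrFun (congrFun h i) j

theorem det_mul_star (A : U11 d) (i j : Fin 2) : (mat A).det * star (mat A i j) = mat A i j := by
  have hA : mat A * Jmat * (mat A).conjTranspose = Jmat := A.2
  have e00 := congrFun (congrFun hA 0) 0
  have e01 := congrFun (congrFun hA 0) 1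
  have e10 := congrFun (congrFun hA 1) 0
  have e11 := congrFun (congrFun hA 1) 1
  simp only [Jmat, Matrix.mul_apply, Fin.sum_univ_two, Matrix.conjTranspose_apply,
    Matrix.of_apply, Matrix.cons_val', Matrix.cons_val_zero, Matrix.cons_val_one,
    Matrix.cons_val_fin_one, mul_zero, mul_one, zero_add, add_zero, mul_neg] at e00 e01 e10 e11
  rw [Matrix.det_fin_two]
  fin_cases i <;> fin_cases j <;> simp only [Fin.zero_eta, Fin.mk_one]
  · linear_combination (-mat A 1 0) * e00 + (mat A 0 0) * e10
  · linear_combination (-mat A 1 1) * e00 + (mat A 0 1) * e10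
  · linear_combination (-mat A 1 0) * e01 + (mat A 0 0) * e11
  · linear_combination (-mat A 1 1) * e01 + (mat A 0 1) * e11

theorem det_mat_ne_zero (A : U11 d) : (mat A).det ≠ 0 := by
  have h : mat A * mat A⁻¹ = 1 := by rw [← mat_mul, mul_inv_cancel, mat_one]
  intro h0
  have := congrArg Matrix.det h
  rw [Matrix.det_mul, h0, zero_mul, Matrix.det_one] at this
  exact zero_ne_one this

theorem jcfac_eq (A : U11 d) (τ : ℂ) : (mat A).det * jcfac A τ = jfac A τ := by
  rw [jcfac, jfac, mul_add, ← mul_assoc, det_mul_star, det_mul_star]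

theorem jfac_ne_zero (A : U11 d) (τ : UpperHalfPlane) : jfac A τ ≠ 0 := by
  intro h
  have := im_act_pos A τ
  rw [h, div_zero] at this
  simp at this

theorem jcfac_ne_zero (A : U11 d) (τ : UpperHalfPlane) : jcfac A τ ≠ 0 := by
  intro h
  have := jcfac_eq A τ
  rw [h, mul_zero] at this
  exact jfac_ne_zero A τ this.symm

theorem coe_act (A : U11 d) (τ : UpperHalfPlane) :
    (act A τ : ℂ) = (mat A 0 0 * (τ : ℂ) + mat A 0 1) / jfac A τ := rfl

theorem jfac_mul (A B : U11 d) (τ : UpperHalfPlane) :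
    jfac (A * B) τ = jfac A (act B τ) * jfac B τ := by
  have h := jfac_ne_zero B τ
  rw [jfac, jfac, coe_act, mat_mul]
  simp only [Matrix.mul_apply, Fin.sum_univ_two]
  field_simp
  rw [jfac]; ring

theorem act_mul (A B : U11 d) (τ : UpperHalfPlane) : act (A * B) τ = act A (act B τ) := by
  apply UpperHalfPlane.ext
  have h1 := jfac_ne_zero B τ
  have h2 := jfac_ne_zero A (act B τ)
  rw [coe_act, coe_act, jfac_mul, mat_mul]
  simp only [Matrix.mul_apply, Fin.sum_univ_two]
  rw [div_eq_div_iff (mul_ne_zero h2 h1) h2, coe_act]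
  field_simp
  rw [show jfac B (τ : ℂ) = mat B 1 0 * τ + mat B 1 1 from rfl]; ring

theorem jcfac_mul (A B : U11 d) (τ : UpperHalfPlane) :
    jcfac (A * B) τ = jcfac A (act B τ) * jcfac B τ := by
  have h1 := jcfac_eq A (act B τ)
  have h2 := jcfac_eq B τ
  have h3 := jcfac_eq (A * B) τ
  refine mul_left_cancel₀ (det_mat_ne_zero (A * B)) ?_
  rw [h3, jfac_mul, ← h1, ← h2, mat_mul, Matrix.det_mul]; ring

theorem act_one (τ : UpperHalfPlane) : act (1 : U11 d) τ = τ := by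
  apply UpperHalfPlane.ext
  rw [coe_act, jfac, mat_one]; simp

/-- The cocycle property of `c w^tSz / j`. -/
theorem exponent_mul (A B : U11 d) (τ : UpperHalfPlane) (s : ℂ) :
    mat (A * B) 1 0 * s / jfac (A * B) τ
      = mat B 1 0 * s / jfac B τ
        + mat A 1 0 * ((jcfac B τ)⁻¹ * ((jfac B τ)⁻¹ * s)) / jfac A (act B τ) := by
  have h1 := jfac_ne_zero B τ
  have h2 := jfac_ne_zero A (act B τ)
  have h3 := jcfac_ne_zero B τ
  have h4 : (jcfac B τ)⁻¹ = (mat B).det / jfac B τ := by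
    rw [← jcfac_eq]; field_simp
    rw [div_self (det_mat_ne_zero B)]
  have h5 : jfac A (act B τ) * jfac B τ
      = mat A 1 0 * (mat B 0 0 * (τ : ℂ) + mat B 0 1) + mat A 1 1 * jfac B τ := by
    rw [jfac, coe_act]; field_simp
  have h6 : mat (A * B) 1 0 = mat A 1 0 * mat B 0 0 + mat A 1 1 * mat B 1 0 := by
    rw [mat_mul, Matrix.mul_apply, Fin.sum_univ_two]
  rw [jfac_mul, h4, h6, Matrix.det_fin_two]
  field_simp
  have h7 : jfac B τ = mat B 1 0 * τ + mat B 1 1 := rfl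
  linear_combination (-mat B 1 0 * s) * h5 + (s * mat A 1 0 * mat B 0 0) * h7

/-- The embedding of `SL₂(ℤ)` into `GL₂(𝒪)`. -/
def slToGL (d : ℕ) : SL(2, ℤ) →* GL (Fin 2) (qOrder d) :=
  Matrix.SpecialLinearGroup.toGL.comp (Matrix.SpecialLinearGroup.map (Int.castRingHom (qOrder d)))

theorem toMat_slToGL (A : SL(2, ℤ)) (i j : Fin 2) : toMat (slToGL d A) i j = (A i j : ℂ) := by
  change (((A i j : ℤ) : qOrder d) : ℂ) = _
  simp

/-- The embedding of `SL₂(ℤ)` into `U(1,1)(ℤ)`. -/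
def slToU (d : ℕ) : SL(2, ℤ) →* U11 d :=
  (slToGL d).codRestrict (U11 d) (by
    intro A
    have hdet : ((A 0 0 : ℤ) : ℂ) * A 1 1 - A 0 1 * A 1 0 = 1 := by
      exact_mod_cast (Matrix.det_fin_two A.1).symm.trans A.2
    change toMat (slToGL d A) * Jmat * (toMat (slToGL d A)).conjTranspose = Jmat
    ext i j
    fin_cases i <;> fin_cases j <;>
      simp [Jmat, Matrix.mul_apply, Fin.sum_univ_two, toMat_slToGL] <;>
      first | ring1 | linear_combination hdet | linear_combination -hdet)

theorem mat_slToU (A : SL(2, ℤ)) (i j : Fin 2) : mat (slToU d A) i j = (A i j : ℂ) :=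
  toMat_slToGL A i j

theorem jfac_slToU (A : SL(2, ℤ)) (τ : ℂ) : jfac (slToU d A) τ = (A 1 0 : ℂ) * τ + (A 1 1 : ℂ) := by
  rw [jfac, mat_slToU, mat_slToU]

theorem jcfac_slToU (A : SL(2, ℤ)) (τ : ℂ) :
    jcfac (slToU d A) τ = (A 1 0 : ℂ) * τ + (A 1 1 : ℂ) := by
  rw [jcfac, mat_slToU, mat_slToU]; simp

theorem act_slToU (A : SL(2, ℤ)) (τ : UpperHalfPlane) : act (slToU d A) τ = A • τ := by
  apply UpperHalfPlane.ext
  rw [coe_act, jfac_slToU, UpperHalfPlane.coe_specialLinearGroup_apply, mat_slToU, mat_slToU]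
  simp

theorem mat_slToU_T : mat (slToU d ModularGroup.T) = !![1, 1; 0, 1] := by
  ext i j; rw [mat_slToU]
  fin_cases i <;> fin_cases j <;> simp [ModularGroup.T]

theorem mat_slToU_S : mat (slToU d ModularGroup.S) = !![0, -1; 1, 0] := by
  ext i j; rw [mat_slToU]
  fin_cases i <;> fin_cases j <;> simp [ModularGroup.S]

end Group

/-! ### Relations in the Weil representation -/

namespace DiscForm

variable {d : ℕ} {D : Type*} [AddCommGroup D] [Fintype D] (Y : DiscForm d D)

theorem weilT_apply (v : D → ℂ) (γ : D) : Y.weilT v γ = qexpo (Y.q γ) * v γ := rfl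

theorem weilS_apply (v : D → ℂ) (δ : D) :
    Y.weilS v δ = Complex.I ^ (-Y.sig) / (Real.sqrt (Fintype.card D) : ℂ)
      * ∑ γ, qexpo (-QuadraticMap.polar Y.q γ δ) * v γ := rfl

theorem weilU_apply (ξ : (qOrder d)ˣ) (v : D → ℂ) (γ : D) :
    Y.weilU ξ v γ = ((ξ : qOrder d) : ℂ) ^ (-Y.sig) * v (Y.unit ξ γ) := rfl

theorem sqrt_card_ne_zero (D : Type*) [AddCommGroup D] [Fintype D] :
    (Real.sqrt (Fintype.card D) : ℂ) ≠ 0 := by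
  have : 0 < Real.sqrt (Fintype.card D) := Real.sqrt_pos.2 (by exact_mod_cast Fintype.card_pos)
  exact_mod_cast this.ne'

theorem weilS_const_ne_zero : Complex.I ^ (-Y.sig) / (Real.sqrt (Fintype.card D) : ℂ) ≠ 0 :=
  div_ne_zero (zpow_ne_zero _ Complex.I_ne_zero) (sqrt_card_ne_zero D)

theorem weilS_const_mul_gauss : Complex.I ^ (-Y.sig) / (Real.sqrt (Fintype.card D) : ℂ)
    * ∑ γ, qexpo (Y.q γ) = 1 := by
  have := sqrt_card_ne_zero D
  rw [Y.gauss, div_mul_eq_mul_div, ← mul_assoc, ← zpow_add₀ Complex.I_ne_zero, neg_add_cancel]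
  field_simp

theorem weil_braid : Y.weilT * Y.weilS * Y.weilT * Y.weilS * Y.weilT = Y.weilS := by
  refine LinearMap.ext fun v => funext fun δ => ?_
  change Y.weilT (Y.weilS (Y.weilT (Y.weilS (Y.weilT v)))) δ = Y.weilS v δ
  have hG := Y.weilS_const_mul_gauss
  rw [weilT_apply, weilS_apply, weilS_apply]
  set s := Complex.I ^ (-Y.sig) / (Real.sqrt (Fintype.card D) : ℂ)
  simp only [weilT_apply, weilS_apply]
  change qexpo (Y.q δ) * (s * ∑ ε, qexpo (-QuadraticMap.polar Y.q ε δ) *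
    (qexpo (Y.q ε) * (s * ∑ γ, qexpo (-QuadraticMap.polar Y.q γ ε) * (qexpo (Y.q γ) * v γ)))) = _
  have h1 : ∀ γ, ∑ ε, qexpo (-QuadraticMap.polar Y.q ε δ) * (qexpo (Y.q ε) *
      qexpo (-QuadraticMap.polar Y.q γ ε)) = qexpo (-Y.q (δ + γ)) * ∑ ε, qexpo (Y.q ε) := by
    intro γ
    rw [Finset.mul_sum, ← Equiv.sum_comp (Equiv.addRight (δ + γ))]
    refine Finset.sum_congr rfl fun ε _ => ?_
    rw [← qexpo_add, ← qexpo_add, ← qexpo_add]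
    congr 1
    change -QuadraticMap.polar Y.q (ε + (δ + γ)) δ + (Y.q (ε + (δ + γ))
      + -QuadraticMap.polar Y.q γ (ε + (δ + γ))) = -Y.q (δ + γ) + Y.q ε
    have e1 : Y.q (ε + (δ + γ)) = Y.q ε + Y.q (δ + γ) + QuadraticMap.polar Y.q ε δ
        + QuadraticMap.polar Y.q γ ε := by
      rw [polar_comm Y.q γ ε, add_assoc, ← QuadraticMap.polar_add_right, QuadraticMap.polar]; abel
    have e2 : QuadraticMap.polar Y.q δ δ = Y.q δ + Y.q δ := by
      rw [QuadraticMap.polar_self]; exact two_nsmul _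
    have e3 : QuadraticMap.polar Y.q γ γ = Y.q γ + Y.q γ := by
      rw [QuadraticMap.polar_self]; exact two_nsmul _
    have e4 : Y.q (δ + γ) = Y.q δ + Y.q γ + QuadraticMap.polar Y.q γ δ := by
      rw [polar_comm Y.q γ δ, QuadraticMap.polar]; abel
    rw [e1, e4]
    simp only [QuadraticMap.polar_add_left, QuadraticMap.polar_add_right]
    rw [e2, e3]
    abel
  have h2 : ∀ γ, qexpo (Y.q δ) * (qexpo (-Y.q (δ + γ)) * qexpo (Y.q γ))
      = qexpo (-QuadraticMap.polar Y.q γ δ) := by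
    intro γ
    rw [← qexpo_add, ← qexpo_add, polar_comm, QuadraticMap.polar]
    congr 1; abel
  calc _ = s * ∑ γ, s * (qexpo (Y.q δ) * ((∑ ε, qexpo (-QuadraticMap.polar Y.q ε δ) *
        (qexpo (Y.q ε) * qexpo (-QuadraticMap.polar Y.q γ ε))) * qexpo (Y.q γ))) * v γ := by
        simp only [Finset.mul_sum, Finset.sum_mul]
        rw [Finset.sum_comm]
        refine Finset.sum_congr rfl fun _ _ => Finset.sum_congr rfl fun _ _ => by ring
    _ = s * ∑ γ, (s * ∑ ε, qexpo (Y.q ε)) *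
        (qexpo (Y.q δ) * (qexpo (-Y.q (δ + γ)) * qexpo (Y.q γ))) * v γ := by
        simp only [h1]
        congr 1
        refine Finset.sum_congr rfl fun _ _ => by ring
    _ = _ := by simp only [hG, h2, one_mul]

open scoped Classical in
theorem weilS_sq_apply (v : D → ℂ) (ε : D) :
    Y.weilS (Y.weilS v) ε = Complex.I ^ (-2 * Y.sig) * v (-ε) := by
  rw [weilS_apply]
  simp only [weilS_apply]
  set s := Complex.I ^ (-Y.sig) / (Real.sqrt (Fintype.card D) : ℂ) with hs
  have h1 : ∀ γ, ∑ δ, qexpo (-QuadraticMap.polar Y.q δ ε) * qexpo (-QuadraticMap.polar Y.q γ δ)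
      = if γ = -ε then (Fintype.card D : ℂ) else 0 := by
    intro γ
    let χ : D →+ UnitAddCircle := AddMonoidHom.mk' (fun δ => -QuadraticMap.polar Y.q (γ + ε) δ)
      (by intro a b; rw [QuadraticMap.polar_add_right, neg_add])
    have h2 := sum_qexpo_character χ
    have h3 : (∀ δ, χ δ = 0) ↔ γ = -ε := by
      rw [← add_eq_zero_iff_eq_neg]
      constructor
      · exact fun h => Y.nondeg _ fun δ => neg_eq_zero.1 (h δ)
      · intro h δ
        change -QuadraticMap.polar Y.q (γ + ε) δ = 0
        rw [h, QuadraticMap.polar_zero_left, neg_zero]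
    rw [if_congr h3 rfl rfl] at h2
    rw [← h2]
    refine Finset.sum_congr rfl fun δ _ => ?_
    change _ = qexpo (-QuadraticMap.polar Y.q (γ + ε) δ)
    rw [← qexpo_add, QuadraticMap.polar_add_left, polar_comm Y.q δ ε, neg_add, add_comm]
  have h4 : s * s * (Fintype.card D : ℂ) = Complex.I ^ (-2 * Y.sig) := by
    have := sqrt_card_ne_zero D
    have h5 : (Real.sqrt (Fintype.card D) : ℂ) * Real.sqrt (Fintype.card D) = Fintype.card D := by
      rw [← Complex.ofReal_mul, Real.mul_self_sqrt (Nat.cast_nonneg _)]; simp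
    rw [hs, ← h5, show -2 * Y.sig = -Y.sig + -Y.sig by ring, zpow_add₀ Complex.I_ne_zero]
    field_simp
  calc _ = s * s * ∑ γ, (∑ δ, qexpo (-QuadraticMap.polar Y.q δ ε)
        * qexpo (-QuadraticMap.polar Y.q γ δ)) * v γ := by
        simp only [Finset.mul_sum, Finset.sum_mul]
        rw [Finset.sum_comm]
        refine Finset.sum_congr rfl fun _ _ => Finset.sum_congr rfl fun _ _ => by ring
    _ = _ := by
        simp only [h1, ite_mul, zero_mul, Finset.sum_ite_eq', Finset.mem_univ, if_true]
        rw [← h4]; ring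

theorem weilS_pow_four : Y.weilS * Y.weilS * (Y.weilS * Y.weilS) = 1 := by
  refine LinearMap.ext fun v => funext fun δ => ?_
  change Y.weilS (Y.weilS (Y.weilS (Y.weilS v))) δ = v δ
  rw [weilS_sq_apply, weilS_sq_apply, neg_neg, ← mul_assoc, ← zpow_add₀ Complex.I_ne_zero,
    show -2 * Y.sig + -2 * Y.sig = 4 * (-Y.sig) by ring, zpow_mul,
    show (Complex.I : ℂ) ^ (4 : ℤ) = 1 by exact_mod_cast Complex.I_pow_four, one_zpow, one_mul]

theorem weilU_mul_inv (ξ : (qOrder d)ˣ) : Y.weilU ξ * Y.weilU ξ⁻¹ = 1 := by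
  refine LinearMap.ext fun v => funext fun δ => ?_
  change Y.weilU ξ (Y.weilU ξ⁻¹ v) δ = v δ
  have h1 : ((ξ : qOrder d) : ℂ) * ((ξ⁻¹ : (qOrder d)ˣ) : qOrder d) = 1 := by
    rw [← Subring.coe_mul, ← Units.val_mul, mul_inv_cancel]; rfl
  rw [weilU_apply, weilU_apply, ← mul_assoc, ← mul_zpow, h1, one_zpow, one_mul]
  exact congrArg v ((Y.unitEquiv ξ).left_inv δ)

variable {Y}

theorem mem_weilGraph_T {A : U11 d} (h : mat A = !![1, 1; 0, 1]) : (A, Y.weilT) ∈ Y.weilGraph :=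
  Submonoid.subset_closure (Or.inl (Or.inl ⟨h, rfl⟩))

theorem mem_weilGraph_S {A : U11 d} (h : mat A = !![0, -1; 1, 0]) : (A, Y.weilS) ∈ Y.weilGraph :=
  Submonoid.subset_closure (Or.inl (Or.inr ⟨h, rfl⟩))

theorem mem_weilGraph_U {A : U11 d} {ξ : (qOrder d)ˣ}
    (h : mat A = !![((ξ : qOrder d) : ℂ), 0; 0, ((ξ : qOrder d) : ℂ)]) :
    (A, Y.weilU ξ) ∈ Y.weilGraph :=
  Submonoid.subset_closure (Or.inr ⟨ξ, h, rfl⟩)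

/-- The graph of the Weil representation is closed under inversion. -/
theorem exists_inv_mem_weilGraph {p : U11 d × Module.End ℂ (D → ℂ)} (hp : p ∈ Y.weilGraph) :
    ∃ p' ∈ Y.weilGraph, p * p' = 1 ∧ p' * p = 1 := by
  have hS : (slToU d ModularGroup.S, Y.weilS) ∈ Y.weilGraph := mem_weilGraph_S mat_slToU_S
  have hT : (slToU d ModularGroup.T, Y.weilT) ∈ Y.weilGraph := mem_weilGraph_T mat_slToU_T
  have hS4 : slToU d ModularGroup.S * slToU d ModularGroup.S
      * (slToU d ModularGroup.S * slToU d ModularGroup.S) = 1 := by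
    apply mat_injective
    simp only [mat_mul, mat_slToU_S, mat_one]
    ext i j
    fin_cases i <;> fin_cases j <;> simp
  have hbraid : slToU d ModularGroup.T * slToU d ModularGroup.S * slToU d ModularGroup.T
      * slToU d ModularGroup.S * slToU d ModularGroup.T = slToU d ModularGroup.S := by
    apply mat_injective
    simp only [mat_mul, mat_slToU_S, mat_slToU_T]
    ext i j
    fin_cases i <;> fin_cases j <;> simp
  set s : U11 d × Module.End ℂ (D → ℂ) := (slToU d ModularGroup.S, Y.weilS) with hs
  set t : U11 d × Module.End ℂ (D → ℂ) := (slToU d ModularGroup.T, Y.weilT) with ht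
  have hs4 : s * s * (s * s) = 1 := Prod.ext hS4 Y.weilS_pow_four
  have hts : t * s * t * s * t = s := Prod.ext hbraid Y.weil_braid
  refine Submonoid.closure_induction (motive := fun p _ => ∃ p' ∈ Y.weilGraph, p * p' = 1 ∧ p' * p = 1)
    ?_ ⟨1, one_mem _, one_mul _, one_mul _⟩ ?_ hp
  · rintro ⟨A, R⟩ ((⟨h, h'⟩ | ⟨h, h'⟩) | ⟨ξ, h, h'⟩)
    · have e : ((A, R) : U11 d × Module.End ℂ (D → ℂ)) = t :=
        Prod.ext (mat_injective (h.trans mat_slToU_T.symm)) h'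
      have hl : t * (s * t * s * t * (s * s * s)) = 1 := by
        calc t * (s * t * s * t * (s * s * s)) = t * s * t * s * t * (s * s * s) := by
              simp only [mul_assoc]
          _ = 1 := by rw [hts, ← hs4]; simp only [mul_assoc]
      have hr' : s * s * s * (t * s * t * s) * t = 1 := by
        calc s * s * s * (t * s * t * s) * t = s * s * s * (t * s * t * s * t) := by
              simp only [mul_assoc]
          _ = 1 := by rw [hts, ← hs4]; simp only [mul_assoc]
      have hr : s * t * s * t * (s * s * s) * t = 1 := by
        rw [← left_inv_eq_right_inv hr' hl, hr']
      rw [e]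
      refine ⟨s * t * s * t * (s * s * s), ?_, ?_, ?_⟩
      · exact mul_mem (mul_mem (mul_mem (mul_mem hS hT) hS) hT) (mul_mem (mul_mem hS hS) hS)
      · exact hl
      · exact hr
    · have e : ((A, R) : U11 d × Module.End ℂ (D → ℂ)) = s :=
        Prod.ext (mat_injective (h.trans mat_slToU_S.symm)) h'
      rw [e]
      refine ⟨s * (s * s), mul_mem hS (mul_mem hS hS), ?_, ?_⟩
      · rw [← hs4]; simp only [mul_assoc]
      · rw [← hs4]; simp only [mul_assoc]
    · have h1 : ((ξ : qOrder d) : ℂ) * ((ξ⁻¹ : (qOrder d)ˣ) : qOrder d) = 1 := by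
        rw [← Subring.coe_mul, ← Units.val_mul, mul_inv_cancel]; rfl
      have h2 : mat A⁻¹ = !![(((ξ⁻¹ : (qOrder d)ˣ) : qOrder d) : ℂ), 0;
          0, (((ξ⁻¹ : (qOrder d)ˣ) : qOrder d) : ℂ)] := by
        have h3 : mat A * !![(((ξ⁻¹ : (qOrder d)ˣ) : qOrder d) : ℂ), 0;
            0, (((ξ⁻¹ : (qOrder d)ˣ) : qOrder d) : ℂ)] = 1 := by
          rw [show mat A = _ from h]
          ext i j
          fin_cases i <;> fin_cases j <;> simp [h1]
        refine left_inv_eq_right_inv ?_ h3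
        rw [← mat_mul, inv_mul_cancel, mat_one]
      have h3 : Y.weilU ξ⁻¹ * Y.weilU ξ = 1 := by
        have := Y.weilU_mul_inv ξ⁻¹
        rwa [inv_inv] at this
      refine ⟨(A⁻¹, Y.weilU ξ⁻¹), mem_weilGraph_U h2, ?_, ?_⟩
      · rw [Prod.mk_mul_mk, show R = _ from h', Y.weilU_mul_inv, mul_inv_cancel]; rfl
      · rw [Prod.mk_mul_mk, show R = _ from h', h3, inv_mul_cancel]; rfl
  · rintro p r - - ⟨p', hp', h1, h2⟩ ⟨r', hr', h3, h4⟩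
    refine ⟨r' * p', mul_mem hr' hp', ?_, ?_⟩
    · calc p * r * (r' * p') = p * (r * r') * p' := by simp only [mul_assoc]
        _ = 1 := by rw [h3, mul_one, h1]
    · calc r' * p' * (p * r) = r' * (p' * p) * r := by simp only [mul_assoc]
        _ = 1 := by rw [h2, mul_one, h4]

theorem exists_mem_weilGraph_slToU (Y : DiscForm d D) (A : SL(2, ℤ)) :
    ∃ R, (slToU d A, R) ∈ Y.weilGraph := by
  have hA : A ∈ Subgroup.closure {ModularGroup.S, ModularGroup.T} := by
    rw [SpecialLinearGroup.SL2Z_generators]; trivial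
  induction hA using Subgroup.closure_induction with
  | mem x hx =>
    rcases hx with rfl | rfl
    · exact ⟨_, mem_weilGraph_S mat_slToU_S⟩
    · exact ⟨_, mem_weilGraph_T mat_slToU_T⟩
  | one => exact ⟨1, by rw [map_one]; exact one_mem _⟩
  | mul x y _ _ hx hy =>
    obtain ⟨R, hR⟩ := hx
    obtain ⟨R', hR'⟩ := hy
    exact ⟨R * R', by rw [map_mul, ← Prod.mk_mul_mk]; exact mul_mem hR hR'⟩
  | inv x _ hx =>
    obtain ⟨R, hR⟩ := hx
    obtain ⟨⟨B, R'⟩, hp', h1, -⟩ := exists_inv_mem_weilGraph hR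
    rw [Prod.mk_mul_mk, Prod.mk_eq_one] at h1
    refine ⟨R', ?_⟩
    rw [map_inv, inv_eq_of_mul_eq_one_right h1.1]
    exact hp'

end DiscForm

end

end HermJac

namespace HermJac

noncomputable section

variable {d c : ℕ} {Δ D : Type*} [AddCommGroup Δ] [Fintype Δ] [AddCommGroup D] [Fintype D]
  {X : DiscForm d Δ} {I : MatrixIndex d c X} {Y : DiscForm d D} {hst : I.KerStable}

/-! ### The theta series under the generators -/

theorem cexpo_lamNorm (a : I.Lam) : cexpo (I.lamNorm a : ℂ) = qexpo (I.qOm (I.toD a)) := by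
  induction a using QuotientAddGroup.induction_on with
  | H a => rw [← qexpo_coe]; rfl

theorem theta_translation (τ τ' : UpperHalfPlane) (h : (τ' : ℂ) = τ + 1) (z w : Fin c → ℂ)
    (γ : I.DOm) : I.theta τ' z w γ = qexpo (I.qOm γ) * I.theta τ z w γ := by
  rw [MatrixIndex.theta, MatrixIndex.theta, ← tsum_mul_left]
  refine tsum_congr fun a => ?_
  obtain ⟨a, rfl⟩ := a
  rw [h, ← cexpo_lamNorm, ← cexpo_add]
  congr 1
  ring

/-- Multiplication by `x ∈ 𝒪` on `Ω^* / ker S`. -/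
def mulLam (hst : I.KerStable) (x : qOrder d) : I.Lam →+ I.Lam :=
  QuotientAddGroup.map _ _
    ({ toFun := fun a => ⟨(x : ℂ) • (a : Fin c → ℂ), I.smul_OmStar hst x a.2⟩
       map_zero' := by ext i; simp
       map_add' := by intro a b; ext i; simp [mul_add] } : I.OmStar →+ I.OmStar)
    (by
      intro a ha
      change (x : ℂ) • (a : Fin c → ℂ) ∈ I.kerS
      exact ⟨fun i => mul_mem (qOrder_le_imQuad d x.2) (ha.1 i),
        by rw [Matrix.mulVec_smul, show I.S *ᵥ (a : Fin c → ℂ) = 0 from ha.2, smul_zero]⟩)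

theorem mulLam_mk (hst : I.KerStable) (x : qOrder d) (a : I.OmStar) :
    mulLam hst x (QuotientAddGroup.mk a)
      = QuotientAddGroup.mk (⟨(x : ℂ) • (a : Fin c → ℂ), I.smul_OmStar hst x a.2⟩ : I.OmStar) := rfl

theorem mulLam_mul (hst : I.KerStable) (x y : qOrder d) (γ : I.Lam) :
    mulLam hst (x * y) γ = mulLam hst x (mulLam hst y γ) := by
  induction γ using QuotientAddGroup.induction_on with
  | H a =>
    rw [mulLam_mk, mulLam_mk, mulLam_mk]
    congr 1
    exact Subtype.ext (by simp [mul_smul])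

theorem mulLam_one (hst : I.KerStable) (γ : I.Lam) : mulLam hst 1 γ = γ := by
  induction γ using QuotientAddGroup.induction_on with
  | H a =>
    rw [mulLam_mk]
    congr 1
    exact Subtype.ext (by simp)

theorem toD_mulLam (hst : I.KerStable) (x : qOrder d) (a : I.Lam) :
    I.toD (mulLam hst x a) = I.mulD hst x (I.toD a) := by
  induction a using QuotientAddGroup.induction_on with
  | H a => rfl

theorem lterm_mulLam (hst : I.KerStable) {ξ : qOrder d} (hξ : star (ξ : ℂ) * ξ = 1) (τ : ℂ)
    (z w : Fin c → ℂ) (a : I.Lam) :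
    I.lterm τ z w (mulLam hst ξ a) = I.lterm τ (star (ξ : ℂ) • z) ((ξ : ℂ) • w) a := by
  induction a using QuotientAddGroup.induction_on with
  | H a =>
    rw [mulLam_mk]
    change cexpo (τ * (hnorm I.S ((ξ : ℂ) • (a : Fin c → ℂ)) : ℂ) +
        (herm I.S ((ξ : ℂ) • (a : Fin c → ℂ)) z + w ⬝ᵥ (I.S *ᵥ ((ξ : ℂ) • (a : Fin c → ℂ)))))
      = cexpo (τ * (hnorm I.S (a : Fin c → ℂ) : ℂ) +
        (herm I.S (a : Fin c → ℂ) (star (ξ : ℂ) • z) + ((ξ : ℂ) • w) ⬝ᵥ (I.S *ᵥ (a : Fin c → ℂ))))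
    have h : hnorm I.S ((ξ : ℂ) • (a : Fin c → ℂ)) = hnorm I.S (a : Fin c → ℂ) := by
      rw [hnorm, herm_smul_left, herm_smul_right, ← mul_assoc, hξ, one_mul]; rfl
    rw [h, herm_smul_left, herm_smul_right, Matrix.mulVec_smul, dotProduct_smul, smul_dotProduct]

theorem theta_unit (hst : I.KerStable) (hd : 0 < d) (hd4 : d % 4 = 0 ∨ d % 4 = 3)
    (ξ : (qOrder d)ˣ) (τ : UpperHalfPlane) (z w : Fin c → ℂ) (γ : I.DOm) :
    I.theta τ (((ξ : qOrder d) : ℂ)⁻¹ • z) ((star ((ξ : qOrder d) : ℂ))⁻¹ • w) γ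
      = I.theta τ z w (I.mulD hst ξ γ) := by
  have hξ := star_mul_self_unit hd hd4 ξ
  have hξ0 : ((ξ : qOrder d) : ℂ) ≠ 0 := right_ne_zero_of_mul_eq_one hξ
  have h1 : (((ξ : qOrder d) : ℂ))⁻¹ = star ((ξ : qOrder d) : ℂ) := by
    rw [← mul_one (_)⁻¹, ← hξ]; field_simp
  have h2 : (star ((ξ : qOrder d) : ℂ))⁻¹ = ((ξ : qOrder d) : ℂ) := by rw [← h1, inv_inv]
  rw [h1, h2]
  let e : {a : I.Lam // I.toD a = γ} ≃ {a : I.Lam // I.toD a = I.mulD hst ξ γ} :=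
    { toFun := fun a => ⟨mulLam hst ξ a, by rw [toD_mulLam, a.2]⟩
      invFun := fun a => ⟨mulLam hst (ξ⁻¹ : (qOrder d)ˣ) a, by
        rw [toD_mulLam, a.2]; exact (mulDEquiv hst ξ).left_inv γ⟩
      left_inv := fun a => Subtype.ext (by
        change mulLam hst (ξ⁻¹ : (qOrder d)ˣ) (mulLam hst ξ a) = a
        rw [← mulLam_mul, ← Units.val_mul, inv_mul_cancel, Units.val_one, mulLam_one])
      right_inv := fun a => Subtype.ext (by
        change mulLam hst ξ (mulLam hst (ξ⁻¹ : (qOrder d)ˣ) a) = a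
        rw [← mulLam_mul, ← Units.val_mul, mul_inv_cancel, Units.val_one, mulLam_one]) }
  rw [MatrixIndex.theta, MatrixIndex.theta, ← e.tsum_eq]
  refine tsum_congr fun a => ?_
  exact (lterm_mulLam hst hξ τ z w a).symm

/-! ### Compatibility of `↓_H(Θ ⊗ ·)` with the Weil representations -/

namespace GlueData

variable (G : GlueData I Y hst)

/-- `v ↦ ↓_H(Θ ⊗ v)` intertwines `R` and `R'` over `A`, up to the factor `κ`. -/
def Inter (A : U11 d) (R : Module.End ℂ (D → ℂ)) (R' : Module.End ℂ (Δ → ℂ)) (κ : ℂ) : Prop :=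
  ∀ (τ : UpperHalfPlane) (z w : Fin c → ℂ) (v : D → ℂ),
    G.downTensor (I.theta (act A τ) ((jfac A τ)⁻¹ • z) ((jcfac A τ)⁻¹ • w)) (R v)
      = (κ * jfac A τ ^ I.S.rank * cexpo (mat A 1 0 * (w ⬝ᵥ (I.S *ᵥ z)) / jfac A τ)) •
        R' (G.downTensor (I.theta τ z w) v)

variable {G}

theorem inter_one : G.Inter 1 1 1 1 := by
  intro τ z w v
  have h1 : jfac (1 : U11 d) τ = 1 := by rw [jfac, mat_one]; simp
  have h2 : jcfac (1 : U11 d) τ = 1 := by rw [jcfac, mat_one]; simp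
  rw [act_one, h1, h2, mat_one]
  simp [cexpo_zero]

theorem Inter.mul {A B : U11 d} {R₁ R₂ : Module.End ℂ (D → ℂ)} {R₁' R₂' : Module.End ℂ (Δ → ℂ)}
    {κ₁ κ₂ : ℂ} (h₁ : G.Inter A R₁ R₁' κ₁) (h₂ : G.Inter B R₂ R₂' κ₂) :
    G.Inter (A * B) (R₁ * R₂) (R₁' * R₂') (κ₁ * κ₂) := by
  intro τ z w v
  have e1 : (jfac (A * B) τ)⁻¹ • z = (jfac A (act B τ))⁻¹ • ((jfac B τ)⁻¹ • z) := by
    rw [jfac_mul, mul_inv, mul_smul]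
  have e2 : (jcfac (A * B) τ)⁻¹ • w = (jcfac A (act B τ))⁻¹ • ((jcfac B τ)⁻¹ • w) := by
    rw [jcfac_mul, mul_inv, mul_smul]
  rw [act_mul, e1, e2, Module.End.mul_apply, Module.End.mul_apply, h₁, h₂, map_smul, smul_smul,
    exponent_mul, jfac_mul, cexpo_add, Matrix.mulVec_smul, smul_dotProduct, dotProduct_smul,
    smul_eq_mul, smul_eq_mul, mul_pow]
  congr 1
  ring

theorem inter_T [Fintype I.DOm] {A : U11 d} (hA : mat A = !![1, 1; 0, 1]) :
    G.Inter A Y.weilT X.weilT 1 := by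
  intro τ z w v
  have h1 : jfac A τ = 1 := by rw [jfac, hA]; simp
  have h2 : jcfac A τ = 1 := by rw [jcfac, hA]; simp
  have h3 : (act A τ : ℂ) = τ + 1 := by rw [coe_act, h1, hA]; simp
  have h4 : mat A 1 0 = 0 := by rw [hA]; simp
  rw [h1, h2, h4, inv_one, one_smul, one_smul, zero_mul, zero_div, cexpo_zero, one_pow, one_mul,
    one_mul, one_smul, ← G.downTensor_weilT]
  congr 1
  ext γ
  exact theta_translation τ _ h3 z w γ

theorem inter_U [Fintype I.DOm] (hd : 0 < d) (hd4 : d % 4 = 0 ∨ d % 4 = 3) {A : U11 d}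
    {ξ : (qOrder d)ˣ} (hA : mat A = !![((ξ : qOrder d) : ℂ), 0; 0, ((ξ : qOrder d) : ℂ)]) :
    G.Inter A (Y.weilU ξ) (X.weilU ξ) 1 := by
  intro τ z w v
  have hξ0 : ((ξ : qOrder d) : ℂ) ≠ 0 := right_ne_zero_of_mul_eq_one (star_mul_self_unit hd hd4 ξ)
  have h1 : jfac A τ = ((ξ : qOrder d) : ℂ) := by rw [jfac, hA]; simp
  have h2 : jcfac A τ = star ((ξ : qOrder d) : ℂ) := by rw [jcfac, hA]; simp
  have h3 : act A τ = τ := by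
    apply UpperHalfPlane.ext
    rw [coe_act, h1, hA]; simp [hξ0]
  have h4 : mat A 1 0 = 0 := by rw [hA]; simp
  rw [h1, h2, h3, h4, zero_mul, zero_div, cexpo_zero, one_mul, mul_one]
  have h5 : I.theta τ (((ξ : qOrder d) : ℂ)⁻¹ • z) ((star ((ξ : qOrder d) : ℂ))⁻¹ • w)
      = fun γ => I.theta τ z w (I.mulD hst ξ γ) := funext fun γ => theta_unit hst hd hd4 ξ τ z w γ
  have h6 : Y.weilU ξ v = ((ξ : qOrder d) : ℂ) ^ (-Y.sig) • fun x => v (Y.unit ξ x) := rfl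
  rw [h5, h6, downTensor_smul_right]
  ext β
  rw [Pi.smul_apply, Pi.smul_apply, X.weilU_apply, G.downTensor_unit hd hd4, smul_eq_mul,
    smul_eq_mul, ← mul_assoc]
  congr 1
  have h7 := G.sig_eq ξ
  rw [zpow_neg, zpow_neg, h7, zpow_add₀ hξ0, zpow_natCast]
  have h8 : ((ξ : qOrder d) : ℂ) ^ I.S.rank ≠ 0 := pow_ne_zero _ hξ0
  have h9 : ((ξ : qOrder d) : ℂ) ^ Y.sig ≠ 0 := zpow_ne_zero _ hξ0
  field_simp

theorem exists_inter_S (Fr : Frame I) (hd : 0 < d) [Fintype I.DOm] :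
    ∃ κ : ℂ, κ ≠ 0 ∧ ∀ A : U11 d, mat A = !![0, -1; 1, 0] → G.Inter A Y.weilS X.weilS κ := by
  obtain ⟨K, hK0, hK⟩ := Fr.exists_theta_inversion hd
  set sY := Complex.I ^ (-Y.sig) / (Real.sqrt (Fintype.card D) : ℂ) with hsY
  set sX := Complex.I ^ (-X.sig) / (Real.sqrt (Fintype.card Δ) : ℂ) with hsX
  have hsY0 : sY ≠ 0 := Y.weilS_const_ne_zero
  have hsX0 : sX ≠ 0 := X.weilS_const_ne_zero
  have hcard : (Nat.card I.HOm : ℂ) ≠ 0 := by exact_mod_cast Nat.card_pos.ne'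
  refine ⟨K * sY * Nat.card I.HOm / sX, by positivity, fun A hA τ z w v => ?_⟩
  have h1 : jfac A τ = τ := by rw [jfac, hA]; simp
  have h2 : jcfac A τ = τ := by rw [jcfac, hA]; simp
  have h3 : (act A τ : ℂ) = -1 / τ := by rw [coe_act, h1, hA]; simp
  have h4 : mat A 1 0 = 1 := by rw [hA]; simp
  rw [h1, h2, h4, one_mul]
  have h5 : I.theta (act A τ) ((τ : ℂ)⁻¹ • z) ((τ : ℂ)⁻¹ • w)
      = (K * (τ : ℂ) ^ I.S.rank * cexpo (w ⬝ᵥ (I.S *ᵥ z) / (τ : ℂ))) •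
        fun γ => ∑ δ, qexpo (-QuadraticMap.polar I.qOm γ δ) * I.theta τ z w δ :=
    funext fun γ => hK τ _ z w γ h3
  have h6 : Y.weilS v = sY • fun x => ∑ y, qexpo (-QuadraticMap.polar Y.q y x) * v y := rfl
  rw [h5, h6, downTensor_smul_right, downTensor_smul_left]
  ext β
  rw [Pi.smul_apply, Pi.smul_apply, Pi.smul_apply, downTensor_fourier, X.weilS_apply, ← hsX]
  simp only [smul_eq_mul]
  field_simp

theorem Inter.const_unique {A : U11 d} {R : Module.End ℂ (D → ℂ)} {R' : Module.End ℂ (Δ → ℂ)}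
    {κ κ' : ℂ} (Fr : Frame I) (hd : 0 < d) (h : G.Inter A R R' κ) (h' : G.Inter A R R' κ')
    (hR : Function.Injective R) : κ = κ' := by
  by_contra hne
  have h0 : ∀ z w, G.downTensor (I.theta (act A UpperHalfPlane.I) z w) (R 1)
      = G.downTensor (I.theta (act A UpperHalfPlane.I) z w) (R 0) := by
    intro z w
    have e := h UpperHalfPlane.I (jfac A UpperHalfPlane.I • z) (jcfac A UpperHalfPlane.I • w) 1
    have e' := h' UpperHalfPlane.I (jfac A UpperHalfPlane.I • z) (jcfac A UpperHalfPlane.I • w) 1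
    have e0 := h UpperHalfPlane.I (jfac A UpperHalfPlane.I • z) (jcfac A UpperHalfPlane.I • w) 0
    rw [smul_smul, smul_smul, inv_mul_cancel₀ (jfac_ne_zero _ _),
      inv_mul_cancel₀ (jcfac_ne_zero _ _), one_smul, one_smul] at e e' e0
    have e1 := e.symm.trans e'
    rw [← sub_eq_zero, ← sub_smul, ← sub_mul, ← sub_mul, mul_assoc, mul_smul, smul_eq_zero,
      sub_eq_zero] at e1
    have e2 : ∀ θ : I.DOm → ℂ, G.downTensor θ 0 = 0 := fun θ => by
      ext β; simp [downTensor, downArrow]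
    rw [e, mul_assoc, mul_smul, e1.resolve_left hne, smul_zero, map_zero, e2]
  have h1 : (1 : D → ℂ) = 0 := hR (G.downTensor_theta_injective Fr hd _ h0)
  exact one_ne_zero (congrFun h1 0)

theorem weilS_injective (Y : DiscForm d D) : Function.Injective Y.weilS := by
  intro v w h
  have h4 := Y.weilS_pow_four
  have e : ∀ v, Y.weilS (Y.weilS (Y.weilS (Y.weilS v))) = v := fun v =>
    LinearMap.congr_fun h4 v
  rw [← e v, h, e w]

theorem inter_S (Fr : Frame I) (hd : 0 < d) [Fintype I.DOm] {A : U11 d}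
    (hA : mat A = !![0, -1; 1, 0]) : G.Inter A Y.weilS X.weilS 1 := by
  obtain ⟨κ, hκ0, hκ⟩ := exists_inter_S (G := G) Fr hd
  have hT := inter_T (G := G) (mat_slToU_T (d := d))
  have h1 := (((hT.mul (hκ A hA)).mul hT).mul (hκ A hA)).mul hT
  have hbraid : slToU d ModularGroup.T * A * slToU d ModularGroup.T * A * slToU d ModularGroup.T
      = A := by
    apply mat_injective
    simp only [mat_mul, hA, mat_slToU_T]
    ext i j
    fin_cases i <;> fin_cases j <;> simp
  rw [hbraid, Y.weil_braid, X.weil_braid] at h1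
  have h2 := h1.const_unique Fr hd (hκ A hA) (weilS_injective Y)
  have h3 : κ = 1 := by
    have : κ * κ = κ * 1 := by rw [mul_one]; linear_combination h2
    exact mul_left_cancel₀ hκ0 this
  rw [← h3]
  exact hκ A hA

/-- For every `A ∈ U(1,1)(ℤ)`, the map `v ↦ ↓_H(Θ ⊗ v)` intertwines the Weil representations of
`D` and of `Δ`. -/
theorem exists_inter (G : GlueData I Y hst) (Fr : Frame I) (hd : 0 < d)
    (hd4 : d % 4 = 0 ∨ d % 4 = 3)
    {A : U11 d} {R : Module.End ℂ (D → ℂ)} (h : (A, R) ∈ Y.weilGraph) :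
    ∃ R', (A, R') ∈ X.weilGraph ∧ G.Inter A R R' 1 := by
  have := Fr.finite_DOm hd
  have := Fintype.ofFinite I.DOm
  suffices H : ∀ p ∈ Y.weilGraph, ∃ R', (p.1, R') ∈ X.weilGraph ∧ G.Inter p.1 p.2 R' 1 from
    H _ h
  intro p hp
  refine Submonoid.closure_induction
    (motive := fun p _ => ∃ R', (p.1, R') ∈ X.weilGraph ∧ G.Inter p.1 p.2 R' 1) ?_ ?_ ?_ hp
  · rintro ⟨A, R⟩ ((⟨h, h'⟩ | ⟨h, h'⟩) | ⟨ξ, h, h'⟩)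
    · subst h'
      exact ⟨_, DiscForm.mem_weilGraph_T h, inter_T h⟩
    · subst h'
      exact ⟨_, DiscForm.mem_weilGraph_S h, inter_S Fr hd h⟩
    · subst h'
      exact ⟨_, DiscForm.mem_weilGraph_U h, inter_U hd hd4 h⟩
  · exact ⟨1, one_mem _, inter_one⟩
  · rintro ⟨A, R⟩ ⟨B, T⟩ - - ⟨R', h1, h2⟩ ⟨T', h3, h4⟩
    refine ⟨R' * T', ?_, ?_⟩
    · rw [Prod.fst_mul, ← Prod.mk_mul_mk]; exact mul_mem h1 h3
    · have := h2.mul h4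
      rwa [mul_one] at this

end GlueData

end

end HermJac

namespace HermJac

noncomputable section

/-- A doubly periodic entire function is constant. -/
theorem entire_doubly_periodic_const {g : ℂ → ℂ} (hg : Differentiable ℂ g) {τ : ℂ} (hτ : τ.im ≠ 0)
    (h1 : ∀ α, g (α + 1) = g α) (h2 : ∀ α, g (α + τ) = g α) (α β : ℂ) : g α = g β := by
  have p1 : Function.Periodic g 1 := h1
  have p2 : Function.Periodic g τ := h2
  refine hg.apply_eq_apply_of_bounded ?_ α β
  have hcpt : IsCompact ((fun p : ℝ × ℝ => g (p.1 + p.2 * τ)) '' (Set.Icc 0 1 ×ˢ Set.Icc 0 1)) :=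
    (isCompact_Icc.prod isCompact_Icc).image (hg.continuous.comp (by fun_prop))
  refine hcpt.isBounded.subset ?_
  rintro _ ⟨α, rfl⟩
  set t : ℝ := α.im / τ.im with ht
  set s : ℝ := α.re - t * τ.re with hs
  have hα : α = s + t * τ := by
    apply Complex.ext
    · simp [hs]
    · simp [ht, hτ]
  refine ⟨(Int.fract s, Int.fract t), ⟨⟨Int.fract_nonneg _, (Int.fract_lt_one _).le⟩,
    ⟨Int.fract_nonneg _, (Int.fract_lt_one _).le⟩⟩, ?_⟩
  have e : α = (((Int.fract s : ℝ) : ℂ) + ((Int.fract t : ℝ) : ℂ) * τ) + (⌊t⌋ : ℂ) * τ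
      + (⌊s⌋ : ℂ) * 1 := by
    rw [hα]
    have e1 : (s : ℂ) = ((Int.fract s : ℝ) : ℂ) + (⌊s⌋ : ℂ) := by
      exact_mod_cast (Int.fract_add_floor s).symm
    have e2 : (t : ℂ) = ((Int.fract t : ℝ) : ℂ) + (⌊t⌋ : ℂ) := by
      exact_mod_cast (Int.fract_add_floor t).symm
    rw [e1, e2]; ring
  dsimp only
  conv_rhs => rw [e]
  rw [p1.int_mul _ _, p2.int_mul _ _]

variable {d c : ℕ} {Δ D : Type*} [AddCommGroup Δ] [Fintype Δ] [AddCommGroup D] [Fintype D]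
  {X : DiscForm d Δ} {I : MatrixIndex d c X} {Y : DiscForm d D} {hst : I.KerStable}

theorem transOp_zero {D : Type*} [AddCommGroup D] (v : D → ℂ) : transOp 0 v = v := by
  ext γ; simp [transOp]

theorem DiscForm.charOp_zero (Y : DiscForm d D) (v : D → ℂ) : Y.charOp 0 v = v := by
  ext γ; simp [charOp, QuadraticMap.polar_zero_left, qexpo_zero]

/-! ### Translations of the exponentials -/

/-- The class in `Ω^* / ker S` of a vector in `𝒪^c`. -/
def MatrixIndex.lamCls (I : MatrixIndex d c X) (u : Fin c → qOrder d) : I.Lam :=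
  QuotientAddGroup.mk (⟨toC u, I.toC_mem_OmStar u⟩ : I.OmStar)

theorem toD_lamCls (u : Fin c → qOrder d) : I.toD (I.lamCls u) = I.cls u := rfl

theorem lamNorm_lamCls (u : Fin c → qOrder d) : I.lamNorm (I.lamCls u) = hnorm I.S (toC u) := rfl

theorem lamLin_lamCls (z w : Fin c → ℂ) (u : Fin c → qOrder d) :
    I.lamLin z w (I.lamCls u) = herm I.S (toC u) z + w ⬝ᵥ (I.S *ᵥ toC u) := rfl

theorem hnorm_coe (I : MatrixIndex d c X) (a : Fin c → ℂ) :
    ((hnorm I.S a : ℝ) : ℂ) = herm I.S a a := by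
  have h := herm_conj I.S_psd.isHermitian a a
  exact Complex.conj_eq_iff_re.1 h

theorem lamLin_add_lam (z w : Fin c → ℂ) (a b : I.Lam) :
    I.lamLin z w (a + b) = I.lamLin z w a + I.lamLin z w b := by
  induction a using QuotientAddGroup.induction_on with
  | H a =>
  induction b using QuotientAddGroup.induction_on with
  | H b =>
    change herm I.S ((a : Fin c → ℂ) + b) z + w ⬝ᵥ (I.S *ᵥ ((a : Fin c → ℂ) + b))
      = herm I.S a z + w ⬝ᵥ (I.S *ᵥ a) + (herm I.S b z + w ⬝ᵥ (I.S *ᵥ b))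
    rw [herm_add_left, Matrix.mulVec_add, dotProduct_add]; ring

theorem lamLin_add (z w z' w' : Fin c → ℂ) (a : I.Lam) :
    I.lamLin (z + z') (w + w') a = I.lamLin z w a + I.lamLin z' w' a := by
  induction a using QuotientAddGroup.induction_on with
  | H a =>
    change herm I.S a (z + z') + (w + w') ⬝ᵥ (I.S *ᵥ a)
      = herm I.S a z + w ⬝ᵥ (I.S *ᵥ a) + (herm I.S a z' + w' ⬝ᵥ (I.S *ᵥ a))
    rw [herm_add_right, add_dotProduct]; ring

theorem lamLin_smul (r : ℂ) (z w : Fin c → ℂ) (a : I.Lam) :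
    I.lamLin (r • z) (r • w) a = r * I.lamLin z w a := by
  induction a using QuotientAddGroup.induction_on with
  | H a =>
    change herm I.S a (r • z) + (r • w) ⬝ᵥ (I.S *ᵥ a) = r * (herm I.S a z + w ⬝ᵥ (I.S *ᵥ a))
    rw [herm_smul_right, smul_dotProduct, smul_eq_mul]; ring

theorem lamLin_toC (u : Fin c → qOrder d) (a : I.Lam) :
    I.lamLin (toC u) (star (toC u)) a
      = (I.lamNorm (a + I.lamCls u) : ℂ) - I.lamNorm a - hnorm I.S (toC u) := by
  induction a using QuotientAddGroup.induction_on with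
  | H a =>
    change herm I.S a (toC u) + herm I.S (toC u) a
      = ((hnorm I.S ((a : Fin c → ℂ) + toC u) : ℝ) : ℂ) - (hnorm I.S a : ℝ) - (hnorm I.S (toC u) : ℝ)
    rw [hnorm_coe, hnorm_coe, hnorm_coe, herm_add_left, herm_add_right, herm_add_right]; ring

theorem cexpo_lamLin_toC (u : Fin c → qOrder d) (a : I.Lam) :
    cexpo (I.lamLin (toC u) (star (toC u)) a)
      = qexpo (QuadraticMap.polar I.qOm (I.toD a) (I.cls u)) := by
  rw [lamLin_toC, QuadraticMap.polar, sub_eq_add_neg, sub_eq_add_neg, sub_eq_add_neg, sub_eq_add_neg,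
    qexpo_add, qexpo_add, qexpo_neg, qexpo_neg, cexpo_add, cexpo_add, cexpo_neg, cexpo_neg,
    ← toD_lamCls, ← map_add, ← cexpo_lamNorm, ← cexpo_lamNorm, ← cexpo_lamNorm, lamNorm_lamCls]

/-! ### The Fourier expansion of a Hermitian Jacobi form -/

/-- The coefficient `f_{β,a}(τ)` of the expansion of `Φ`. -/
def jacobiCoeff (Fr : Frame I) (Φ : UpperHalfPlane → (Fin c → ℂ) → (Fin c → ℂ) → Δ → ℂ) (β : Δ)
    (a : I.Lam) (τ : UpperHalfPlane) : ℂ :=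
  fcoef (fun x => Φ τ (Fr.comb x) (Fr.combStar x) β) (Fr.coord a)
    * cexpo (-((τ : ℂ) * (I.lamNorm a : ℂ)))

namespace IsHermitianJacobiForm

variable {Γ : Subgroup (U11 d)} {k : ℤ} {Φ : UpperHalfPlane → (Fin c → ℂ) → (Fin c → ℂ) → Δ → ℂ}

theorem apply_add_toC (hΦ : IsHermitianJacobiForm I Γ k Φ) (v : Fin c → qOrder d)
    (τ : UpperHalfPlane) (z w : Fin c → ℂ) :
    Φ τ (z + toC v) (w + star (toC v)) = X.charOp (I.ψ v) (Φ τ z w) := by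
  have h := hΦ.periodic 0 v τ z w
  have h0 : toC (0 : Fin c → qOrder d) = 0 := by ext; simp [toC]
  rw [h0, map_zero, transOp_zero] at h
  simpa [herm, cexpo_zero] using h

theorem apply_add_smul_toC (hΦ : IsHermitianJacobiForm I Γ k Φ) (u : Fin c → qOrder d)
    (τ : UpperHalfPlane) (z w : Fin c → ℂ) (β : Δ) :
    Φ τ (z + (τ : ℂ) • toC u) (w + (τ : ℂ) • star (toC u)) β
      = cexpo (-((τ : ℂ) * hnorm I.S (toC u) + I.lamLin z w (I.lamCls u)))
        * Φ τ z w (β + I.ψ u) := by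
  have h := congrFun (hΦ.periodic u 0 τ z w) β
  have h0 : toC (0 : Fin c → qOrder d) = 0 := by ext; simp [toC]
  rw [h0, map_zero, X.charOp_zero, star_zero, add_zero, add_zero] at h
  rw [h, Pi.smul_apply, smul_eq_mul, lamLin_lamCls, hnorm_coe, transOp]
  congr 2; ring

theorem differentiable_line (hΦ : IsHermitianJacobiForm I Γ k Φ) (τ : UpperHalfPlane) (β : Δ)
    {E : Type*} [NormedAddCommGroup E] [NormedSpace ℂ E] {f g : E → Fin c → ℂ}
    (hf : Differentiable ℂ f) (hg : Differentiable ℂ g) :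
    Differentiable ℂ fun x => Φ τ (f x) (g x) β :=
  differentiable_pi.1 ((hΦ.holomorphic τ).comp (hf.prodMk hg)) β

theorem apply_add_span (hΦ : IsHermitianJacobiForm I Γ k Φ) (τ : UpperHalfPlane)
    {p q : Fin c → ℂ}
    (hpq : (p, q) ∈ Submodule.span ℂ ((fun u => (toC u, star (toC u))) '' Frame.kap I))
    (z w : Fin c → ℂ) : Φ τ (z + p) (w + q) = Φ τ z w := by
  suffices H : ∀ r ∈ Submodule.span ℂ ((fun u => (toC u, star (toC u))) '' Frame.kap I), ∀ (α : ℂ)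
      (z w : Fin c → ℂ), Φ τ (z + α • r.1) (w + α • r.2) = Φ τ z w by
    simpa using H _ hpq 1 z w
  intro r hr
  induction hr using Submodule.span_induction with
  | mem r hr =>
    obtain ⟨u, ⟨hu, hu'⟩, rfl⟩ := hr
    intro α z w
    ext β
    have hlam : ∀ z w, I.lamLin z w (I.lamCls u) = 0 := by
      intro z w
      rw [lamLin_lamCls, hu', dotProduct_zero, ← herm_conj I.S_psd.isHermitian, herm, hu']
      simp
    have hn : hnorm I.S (toC u) = 0 := by rw [hnorm, herm, hu']; simp
    have := entire_doubly_periodic_const (g := fun α => Φ τ (z + α • toC u) (w + α • star (toC u)) β)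
      (hΦ.differentiable_line τ β (by fun_prop) (by fun_prop)) τ.im_pos.ne' (fun α => ?_) (fun α => ?_)
      α 0
    · simpa using this
    · have := hΦ.apply_add_toC u τ (z + α • toC u) (w + α • star (toC u))
      rw [hu, X.charOp_zero] at this
      simp only [add_smul, one_smul, ← add_assoc, this]
    · have := hΦ.apply_add_smul_toC u τ (z + α • toC u) (w + α • star (toC u)) β
      rw [hu, hn, hlam] at this
      simpa [cexpo_zero, add_smul, ← add_assoc] using this
  | zero => intro α z w; simp
  | add r s _ _ hr hs =>
    intro α z w
    rw [Prod.fst_add, Prod.snd_add, smul_add, smul_add, ← add_assoc, ← add_assoc, hs, hr]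
  | smul a r _ hr =>
    intro α z w
    rw [Prod.smul_fst, Prod.smul_snd, smul_smul, smul_smul, hr]

theorem hasSum (hΦ : IsHermitianJacobiForm I Γ k Φ) (Fr : Frame I) (hd : 0 < d)
    (τ : UpperHalfPlane) (z w : Fin c → ℂ) (β : Δ) :
    HasSum (fun a => jacobiCoeff Fr Φ β a τ * cexpo ((τ : ℂ) * (I.lamNorm a : ℂ) + I.lamLin z w a))
      (Φ τ z w β) := by
  obtain ⟨p, q, hpq, hz, hw⟩ := Fr.exists_pair_decomp hd z w
  have h1 : Φ τ z w = Φ τ (Fr.comb (Fr.zeta z w)) (Fr.combStar (Fr.zeta z w)) := by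
    have := hΦ.apply_add_span τ hpq (Fr.comb (Fr.zeta z w)) (Fr.combStar (Fr.zeta z w))
    rwa [← hz, ← hw] at this
  have hstar : ∀ m : Fin Fr.n → ℤ, Fr.combStar (vecZ m) = star (Fr.comb (vecZ m)) := by
    intro m; ext i; simp [Frame.combStar, Frame.comb, vecZ]
  have h2 := hasSum_fcoef (G := fun x => Φ τ (Fr.comb x) (Fr.combStar x) β)
    (hΦ.differentiable_line τ β (by unfold Frame.comb; fun_prop) (by unfold Frame.combStar; fun_prop))
    (fun x m => by
      rw [Fr.comb_add, Fr.combStar_add, hstar, Fr.comb_vecZ, hΦ.apply_add_toC, Fr.psi_comb,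
        X.charOp_zero]) (Fr.zeta z w)
  rw [h1]
  refine (congrArg (fun f => HasSum f _) (funext fun a => ?_)).mpr
    ((Fr.coordEquiv hd).toEquiv.hasSum_iff.2 h2)
  rw [Function.comp_apply, AddEquiv.toEquiv_eq_coe, AddEquiv.coe_toEquiv, Frame.coordEquiv_apply,
    jacobiCoeff, cexpo_add, Fr.lamLin_eq hd, cexpo_neg]
  have := cexpo_ne_zero ((τ : ℂ) * (I.lamNorm a : ℂ))
  field_simp

/-- The expansion in powers of the exponentials in `z`, `w` only. -/
theorem hasSum' (hΦ : IsHermitianJacobiForm I Γ k Φ) (Fr : Frame I) (hd : 0 < d)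
    (τ : UpperHalfPlane) (z w : Fin c → ℂ) (β : Δ) :
    HasSum (fun a => jacobiCoeff Fr Φ β a τ * cexpo ((τ : ℂ) * (I.lamNorm a : ℂ))
      * cexpo (I.lamLin z w a)) (Φ τ z w β) := by
  simpa only [cexpo_add, mul_assoc] using hΦ.hasSum Fr hd τ z w β

theorem polar_eq_of_coeff_ne_zero (hΦ : IsHermitianJacobiForm I Γ k Φ) (Fr : Frame I) (hd : 0 < d)
    {τ : UpperHalfPlane} {β : Δ} {a : I.Lam} (h : jacobiCoeff Fr Φ β a τ ≠ 0)
    (v : Fin c → qOrder d) :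
    QuadraticMap.polar X.q β (I.ψ v) = QuadraticMap.polar I.qOm (I.toD a) (I.cls v) := by
  have h1 := Fr.lam_coeff_unique hd
    (f := fun a => jacobiCoeff Fr Φ β a τ * cexpo ((τ : ℂ) * (I.lamNorm a : ℂ))
      * qexpo (QuadraticMap.polar I.qOm (I.toD a) (I.cls v)))
    (f' := fun a => qexpo (QuadraticMap.polar X.q (I.ψ v) β) *
      (jacobiCoeff Fr Φ β a τ * cexpo ((τ : ℂ) * (I.lamNorm a : ℂ))))
    (g := fun z w => Φ τ (z + toC v) (w + star (toC v)) β) (fun z w => ?_) (fun z w => ?_)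
  · have h2 := congrFun h1 a
    rw [mul_comm] at h2
    have h3 := mul_right_cancel₀ (mul_ne_zero h (cexpo_ne_zero _)) h2
    rw [polar_comm]
    exact (qexpo_injective h3).symm
  · have h2 := hΦ.hasSum' Fr hd τ (z + toC v) (w + star (toC v)) β
    simp only [lamLin_add, cexpo_add, cexpo_lamLin_toC] at h2
    simp only [mul_assoc] at h2 ⊢
    simpa only [mul_comm (qexpo _)] using h2
  · have h2 := (hΦ.hasSum' Fr hd τ z w β).mul_left (qexpo (QuadraticMap.polar X.q (I.ψ v) β))
    have h3 := congrFun (hΦ.apply_add_toC v τ z w) β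
    rw [DiscForm.charOp] at h3
    rw [h3]
    simpa only [mul_assoc] using h2

theorem coeff_add_lamCls (hΦ : IsHermitianJacobiForm I Γ k Φ) (Fr : Frame I) (hd : 0 < d)
    (τ : UpperHalfPlane) (β : Δ) (a : I.Lam) (u : Fin c → qOrder d) :
    jacobiCoeff Fr Φ (β + I.ψ u) (a + I.lamCls u) τ = jacobiCoeff Fr Φ β a τ := by
  have h1 := Fr.lam_coeff_unique hd
    (f := fun a => jacobiCoeff Fr Φ β a τ * cexpo ((τ : ℂ) * (I.lamNorm (a + I.lamCls u) : ℂ)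
      - (τ : ℂ) * hnorm I.S (toC u)))
    (f' := fun a => jacobiCoeff Fr Φ (β + I.ψ u) (a + I.lamCls u) τ *
      cexpo ((τ : ℂ) * (I.lamNorm (a + I.lamCls u) : ℂ) - (τ : ℂ) * hnorm I.S (toC u)))
    (g := fun z w => Φ τ (z + (τ : ℂ) • toC u) (w + (τ : ℂ) • star (toC u)) β)
    (fun z w => ?_) (fun z w => ?_)
  · exact (mul_right_cancel₀ (cexpo_ne_zero _) (congrFun h1 a)).symm
  · have h2 := hΦ.hasSum' Fr hd τ (z + (τ : ℂ) • toC u) (w + (τ : ℂ) • star (toC u)) β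
    refine (congrArg (fun f => HasSum f _) (funext fun a => ?_)).mpr h2
    rw [lamLin_add, lamLin_smul, lamLin_toC, mul_assoc, mul_assoc, ← cexpo_add, ← cexpo_add]
    congr 2; ring
  · rw [hΦ.apply_add_smul_toC]
    have h2 := (hΦ.hasSum' Fr hd τ z w (β + I.ψ u)).mul_left
      (cexpo (-((τ : ℂ) * hnorm I.S (toC u) + I.lamLin z w (I.lamCls u))))
    rw [← (Equiv.addRight (I.lamCls u)).hasSum_iff] at h2
    refine (congrArg (fun f => HasSum f _) (funext fun a => ?_)).mpr h2
    change _ = cexpo _ * (jacobiCoeff Fr Φ (β + I.ψ u) (a + I.lamCls u) τ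
      * cexpo ((τ : ℂ) * (I.lamNorm (a + I.lamCls u) : ℂ)) * cexpo (I.lamLin z w (a + I.lamCls u)))
    rw [lamLin_add_lam, mul_assoc, mul_assoc, mul_left_comm (cexpo (-_)), ← cexpo_add, ← cexpo_add,
      ← cexpo_add]
    congr 2; ring

/-- The coefficients depend only on the element of `D` that is glued to `(β, a + Ω)`. -/
theorem coeff_eq_of_rel (hΦ : IsHermitianJacobiForm I Γ k Φ) (Fr : Frame I) (hd : 0 < d)
    {G : GlueData I Y hst} (τ : UpperHalfPlane) {β β' : Δ} {a a' : I.Lam} {x : D}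
    (h : G.Rel (I.toD a) x β) (h' : G.Rel (I.toD a') x β') :
    jacobiCoeff Fr Φ β a τ = jacobiCoeff Fr Φ β' a' τ := by
  obtain ⟨u, h1, rfl⟩ := h.exists_cls Fr hd h'
  have h2 : I.toD (a' - (a + I.lamCls u)) = 0 := by
    rw [map_sub, map_add, h1, toD_lamCls, sub_self]
  obtain ⟨m, hm⟩ := (Fr.toD_eq_zero_iff _).1 h2
  have h3 : a' = a + I.lamCls (u + ∑ i, m i • Fr.bas i) := by
    rw [sub_eq_iff_eq_add] at hm
    rw [hm]
    have : I.lamCls (u + ∑ i, m i • Fr.bas i) = I.lamCls u + Fr.om m := by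
      rw [MatrixIndex.lamCls, MatrixIndex.lamCls, Frame.om, ← QuotientAddGroup.mk_add]
      congr 1
    rw [this]; abel
  have h4 : I.ψ u = I.ψ (u + ∑ i, m i • Fr.bas i) := by
    rw [map_add, Fr.psi_comb, add_zero]
  rw [h3, h4, hΦ.coeff_add_lamCls Fr hd]

end IsHermitianJacobiForm

theorem ExpGrowth.of_components {D : Type*} [Fintype D] {F : UpperHalfPlane → D → ℂ}
    (h : ∀ x, ExpGrowth fun τ => F τ x) : ExpGrowth F := by
  intro A R
  choose C₁ C₂ hC using fun x => h x A R
  refine ⟨∑ x, |C₁ x|, ∑ x, |C₂ x|, fun τ hτ hτ' => ?_⟩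
  have h1 : ‖F (A • τ)‖ ≤ ∑ x, ‖F (A • τ) x‖ :=
    (pi_norm_le_iff_of_nonneg (Finset.sum_nonneg fun _ _ => norm_nonneg _)).2 fun x =>
      Finset.single_le_sum (f := fun x => ‖F (A • τ) x‖) (fun _ _ => norm_nonneg _)
        (Finset.mem_univ x)
  refine h1.trans ?_
  rw [Finset.sum_mul]
  refine Finset.sum_le_sum fun x _ => (hC x τ hτ hτ').trans ?_
  have h2 : C₂ x ≤ ∑ x, |C₂ x| := (le_abs_self _).trans
    (Finset.single_le_sum (f := fun x => |C₂ x|) (fun _ _ => abs_nonneg _) (Finset.mem_univ x))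
  gcongr
  exact le_abs_self _

/-- A Hermitian Jacobi form is `↓_H(Θ ⊗ F)`, for a function `F` that satisfies the growth
condition. -/
theorem IsHermitianJacobiForm.exists_eq_downTensor {Γ : Subgroup (U11 d)} {k : ℤ}
    {Φ : UpperHalfPlane → (Fin c → ℂ) → (Fin c → ℂ) → Δ → ℂ}
    (hΦ : IsHermitianJacobiForm I Γ k Φ) (Fr : Frame I) (hd : 0 < d) (G : GlueData I Y hst) :
    ∃ F : UpperHalfPlane → D → ℂ, ExpGrowth F ∧
      ∀ τ z w, Φ τ z w = G.downTensor (I.theta τ z w) (F τ) := by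
  have h1 : ∀ x : D, ∃ (a : I.Lam) (β : Δ), G.Rel (I.toD a) x β := by
    intro x
    obtain ⟨γ, β, h⟩ := G.exists_rel_mid Fr hd x
    obtain ⟨a, rfl⟩ := Frame.toD_surjective I γ
    exact ⟨a, β, h⟩
  choose a β hR using h1
  refine ⟨fun τ x => jacobiCoeff Fr Φ (β x) (a x) τ, ?_, ?_⟩
  · exact ExpGrowth.of_components fun x => hΦ.growth (fun β a τ => jacobiCoeff Fr Φ β a τ)
      (fun τ z w β => hΦ.hasSum Fr hd τ z w β) _ _
  · intro τ z w
    ext β'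
    refine (hΦ.hasSum Fr hd τ z w β').unique ?_
    refine (congrArg (fun f => HasSum f _) (funext fun a' => ?_)).mpr
      (G.hasSum_downTensor Fr hd _ τ z w β')
    congr 1
    by_cases h : ∃ x, G.Rel (I.toD a') x β'
    · obtain ⟨x, hx⟩ := h
      rw [GlueData.pull_of_rel _ hx]
      exact hΦ.coeff_eq_of_rel Fr hd τ hx (hR x)
    · rw [GlueData.pull_of_not_rel _ (not_exists.1 h)]
      by_contra hne
      exact h (G.exists_rel_of_polar (hΦ.polar_eq_of_coeff_ne_zero Fr hd hne))

end

end HermJac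

namespace HermJac

noncomputable section

variable {d c : ℕ} {Δ D : Type*} [AddCommGroup Δ] [Fintype Δ] [AddCommGroup D] [Fintype D]
  {X : DiscForm d Δ} {I : MatrixIndex d c X} {Y : DiscForm d D} {hst : I.KerStable}

/-! ### Modularity -/

/-- If `Φ = ↓_H(Θ ⊗ F)`, then `F` inherits the transformation law from `Φ`. -/
theorem modular_of_eq_downTensor {Γ : Subgroup (U11 d)} {k : ℤ}
    {Φ : UpperHalfPlane → (Fin c → ℂ) → (Fin c → ℂ) → Δ → ℂ}
    (hΦ : IsHermitianJacobiForm I Γ k Φ) (Fr : Frame I) (hd : 0 < d) (hd4 : d % 4 = 0 ∨ d % 4 = 3)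
    (G : GlueData I Y hst) {F : UpperHalfPlane → D → ℂ}
    (hF : ∀ τ z w, Φ τ z w = G.downTensor (I.theta τ z w) (F τ)) {A : U11 d} (hA : A ∈ Γ)
    {R : Module.End ℂ (D → ℂ)} (hR : (A, R) ∈ Y.weilGraph) (τ : UpperHalfPlane) :
    F (act A τ) = jfac A τ ^ (k - I.S.rank) • R (F τ) := by
  have := Fr.finite_DOm hd
  have := Fintype.ofFinite I.DOm
  obtain ⟨R', hR', hI⟩ := G.exists_inter Fr hd hd4 hR
  refine G.downTensor_theta_injective Fr hd (act A τ) fun z w => ?_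
  have hj := jfac_ne_zero A τ
  have h1 := hΦ.modular A hA R' hR' τ (jfac A τ • z) (jcfac A τ • w)
  have h2 := hI τ (jfac A τ • z) (jcfac A τ • w) (F τ)
  rw [smul_smul, smul_smul, inv_mul_cancel₀ hj, inv_mul_cancel₀ (jcfac_ne_zero _ _), one_smul,
    one_smul] at h1 h2
  rw [← hF, h1, G.downTensor_smul_right, h2, ← hF, smul_smul]
  congr 1
  rw [one_mul, ← mul_assoc, ← zpow_natCast, ← zpow_add₀ hj, sub_add_cancel]

/-! ### Regularity -/

theorem contDiffAt_det {𝕜 E : Type*} [NontriviallyNormedField 𝕜] [NormedAlgebra 𝕜 ℂ]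
    [NormedAddCommGroup E] [NormedSpace 𝕜 E] {m : Type*} [Fintype m] [DecidableEq m]
    {n : WithTop ℕ∞} {M : E → Matrix m m ℂ} {t : E}
    (h : ∀ i j, ContDiffAt 𝕜 n (fun t => M t i j) t) :
    ContDiffAt 𝕜 n (fun t => (M t).det) t := by
  simp only [Matrix.det_apply']
  exact ContDiffAt.sum fun σ _ => contDiffAt_const.mul (contDiffAt_prod fun i _ => h _ _)

/-- Regularity of the solution of a linear system. -/
theorem contDiffAt_of_mulVec {𝕜 E : Type*} [NontriviallyNormedField 𝕜] [NormedAlgebra 𝕜 ℂ]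
    [NormedAddCommGroup E] [NormedSpace 𝕜 E] {m : Type*} [Fintype m] [DecidableEq m]
    {n : WithTop ℕ∞} {M : E → Matrix m m ℂ} {v : E → m → ℂ} {t : E}
    (h : ∀ i j, ContDiffAt 𝕜 n (fun t => M t i j) t)
    (h' : ∀ i, ContDiffAt 𝕜 n (fun t => (M t *ᵥ v t) i) t) (hdet : (M t).det ≠ 0) :
    ContDiffAt 𝕜 n v t := by
  refine contDiffAt_pi.2 fun i => ?_
  have hd := contDiffAt_det h
  have hc : ContDiffAt 𝕜 n (fun t => ((M t).updateCol i (M t *ᵥ v t)).det) t := by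
    refine contDiffAt_det fun a b => ?_
    simp only [Matrix.updateCol_apply]
    split_ifs
    · exact h' a
    · exact h a b
  have hinv : ContDiffAt 𝕜 n (fun t => ((M t).det)⁻¹ * ((M t).updateCol i (M t *ᵥ v t)).det) t :=
    (hd.inv hdet).mul hc
  refine hinv.congr_of_eventuallyEq ?_
  filter_upwards [hd.continuousAt.eventually_ne hdet] with s hs
  rw [← Matrix.cramer_apply, Matrix.cramer_eq_adjugate_mulVec, Matrix.mulVec_mulVec,
    Matrix.adjugate_mul, Matrix.smul_mulVec, Matrix.one_mulVec, Pi.smul_apply, smul_eq_mul,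
    inv_mul_cancel_left₀ hs]

namespace GlueData

open scoped Classical in
/-- The coefficient of `v_x` in the component of `↓_H(θ ⊗ v)` at `β`. -/
def push [Fintype I.DOm] (G : GlueData I Y hst) (θ : I.DOm → ℂ) (β : Δ) (x : D) : ℂ :=
  ∑ γ, if G.Rel γ x β then θ γ else 0

theorem downTensor_eq_push [Fintype I.DOm] (G : GlueData I Y hst) (θ : I.DOm → ℂ) (v : D → ℂ)
    (β : Δ) : G.downTensor θ v β = ∑ x, G.push θ β x * v x := by
  classical
  rw [downTensor_eq_sum, Fintype.sum_prod_type, Finset.sum_comm]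
  refine Finset.sum_congr rfl fun x _ => ?_
  rw [push, Finset.sum_mul]
  refine Finset.sum_congr rfl fun γ _ => ?_
  dsimp only
  rw [ite_mul, zero_mul]

theorem span_push_eq_top [Fintype I.DOm] (G : GlueData I Y hst) (Fr : Frame I) (hd : 0 < d)
    (τ : UpperHalfPlane) :
    Submodule.span ℂ (Set.range fun p : (Fin c → ℂ) × (Fin c → ℂ) × Δ =>
      G.push (I.theta τ p.1 p.2.1) p.2.2) = ⊤ := by
  classical
  by_contra hne
  obtain ⟨f, hf, hle⟩ := Submodule.exists_le_ker_of_lt_top _ (lt_top_iff_ne_top.2 hne)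
  have hfx : ∀ w : D → ℂ, f w = ∑ x, w x * f (Pi.single x 1) := by
    intro w
    conv_lhs => rw [pi_eq_sum_univ' w, map_sum]
    refine Finset.sum_congr rfl fun x _ => ?_
    rw [map_smul, smul_eq_mul]
  have h0 : (fun x => f (Pi.single x 1)) = (0 : D → ℂ) := by
    refine G.downTensor_theta_injective Fr hd τ fun z w => ?_
    ext β
    rw [downTensor_eq_push, downTensor_eq_push, ← hfx]
    have : G.push (I.theta τ z w) β ∈ LinearMap.ker f :=
      hle (Submodule.subset_span ⟨(z, w, β), rfl⟩)
    rw [LinearMap.mem_ker.1 this]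
    simp
  refine hf (LinearMap.ext fun w => ?_)
  rw [hfx]
  simp only [fun x => congrFun h0 x]
  simp

/-- Regularity of `↓_H(Θ ⊗ F)` in `τ` implies regularity of `F`. -/
theorem contDiffAt_of_downTensor (G : GlueData I Y hst) (Fr : Frame I) (hd : 0 < d)
    {𝕜 : Type*} [NontriviallyNormedField 𝕜] [NormedAlgebra 𝕜 ℂ] {n : WithTop ℕ∞}
    {F : UpperHalfPlane → D → ℂ} {t₀ : ℂ}
    (hθ : ∀ z w γ, ContDiffAt 𝕜 n (fun t : ℂ => I.theta (UpperHalfPlane.ofComplex t) z w γ) t₀)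
    (h : ∀ z w β, ContDiffAt 𝕜 n (fun t : ℂ => G.downTensor (I.theta (UpperHalfPlane.ofComplex t) z w)
      (F (UpperHalfPlane.ofComplex t)) β) t₀) :
    ContDiffAt 𝕜 n (fun t : ℂ => F (UpperHalfPlane.ofComplex t)) t₀ := by
  classical
  have := Fr.finite_DOm hd
  have := Fintype.ofFinite I.DOm
  have hex : ∀ x : D, ∃ cf : (Fin c → ℂ) × (Fin c → ℂ) × Δ →₀ ℂ, (cf.sum fun p r =>
      r • G.push (I.theta (UpperHalfPlane.ofComplex t₀) p.1 p.2.1) p.2.2) = Pi.single x 1 := by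
    intro x
    rw [← Finsupp.mem_span_range_iff_exists_finsupp, G.span_push_eq_top Fr hd]
    trivial
  choose cf hcf using hex
  let M : ℂ → Matrix D D ℂ := fun t x y => (cf x).sum fun p r =>
    r * G.push (I.theta (UpperHalfPlane.ofComplex t) p.1 p.2.1) p.2.2 y
  have hM : M t₀ = 1 := by
    ext x y
    have := congrFun (hcf x) y
    rw [Finsupp.sum, Finset.sum_apply] at this
    simp only [M, Finsupp.sum]
    rw [Matrix.one_apply, eq_comm (a := x), ← Pi.single_apply x (1 : ℂ) y, ← this]
    rfl
  refine contDiffAt_of_mulVec (M := M) (fun x y => ?_) (fun x => ?_) (by rw [hM]; simp)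
  · simp only [M, Finsupp.sum, push]
    refine ContDiffAt.sum fun p _ => contDiffAt_const.mul (ContDiffAt.sum fun γ _ => ?_)
    split_ifs
    · exact hθ _ _ _
    · exact contDiffAt_const
  · have e : (fun t => (M t *ᵥ F (UpperHalfPlane.ofComplex t)) x) = fun t => (cf x).sum fun p r =>
        r * G.downTensor (I.theta (UpperHalfPlane.ofComplex t) p.1 p.2.1)
          (F (UpperHalfPlane.ofComplex t)) p.2.2 := by
      ext t
      simp only [Matrix.mulVec, dotProduct, M, Finsupp.sum, Finset.sum_mul, downTensor_eq_push,
        Finset.mul_sum]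
      rw [Finset.sum_comm]
      refine Finset.sum_congr rfl fun _ _ => Finset.sum_congr rfl fun _ _ => by ring
    rw [e]
    simp only [Finsupp.sum]
    exact ContDiffAt.sum fun p _ => contDiffAt_const.mul (h _ _ _)

end GlueData

theorem isOpen_im_pos : IsOpen {t : ℂ | 0 < t.im} := isOpen_lt continuous_const Complex.continuous_im

theorem contDiffOn_theta (Fr : Frame I) (hd : 0 < d) (n : WithTop ℕ∞) (z w : Fin c → ℂ)
    (γ : I.DOm) :
    ContDiffOn ℂ n (fun t : ℂ => I.theta (UpperHalfPlane.ofComplex t) z w γ) {t | 0 < t.im} := by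
  refine DifferentiableOn.contDiffOn (fun t ht => ?_) isOpen_im_pos
  have h1 := Fr.differentiableAt_theta hd γ (p := (t, z, w)) ht
  exact (h1.comp (f := fun t : ℂ => (t, z, w)) t (by fun_prop)).differentiableWithinAt

theorem smooth_of_eq_downTensor {Γ : Subgroup (U11 d)} {k : ℤ}
    {Φ : UpperHalfPlane → (Fin c → ℂ) → (Fin c → ℂ) → Δ → ℂ}
    (hΦ : IsHermitianJacobiForm I Γ k Φ) (Fr : Frame I) (hd : 0 < d)
    (G : GlueData I Y hst) {F : UpperHalfPlane → D → ℂ}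
    (hF : ∀ τ z w, Φ τ z w = G.downTensor (I.theta τ z w) (F τ)) :
    ContDiffOn ℝ ∞ (fun t : ℂ => F (UpperHalfPlane.ofComplex t)) {t | 0 < t.im} := by
  intro t ht
  refine (G.contDiffAt_of_downTensor Fr hd (fun z w γ => ?_) (fun z w β => ?_)).contDiffWithinAt
  · exact ((contDiffOn_theta Fr hd ∞ z w γ).contDiffAt (isOpen_im_pos.mem_nhds ht)).restrict_scalars ℝ
  · simp only [← hF]
    have hopen : IsOpen {p : ℂ × (Fin c → ℂ) × (Fin c → ℂ) | 0 < p.1.im} :=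
      isOpen_lt continuous_const (by fun_prop)
    have h1 := hΦ.smooth.contDiffAt (x := (t, z, w)) (hopen.mem_nhds ht)
    have h2 := h1.comp (f := fun t : ℂ => (t, z, w)) t (by fun_prop)
    exact contDiffAt_pi.1 h2 β

theorem holJacobi_iff {Φ : UpperHalfPlane → (Fin c → ℂ) → (Fin c → ℂ) → Δ → ℂ} (Fr : Frame I)
    (hd : 0 < d) (G : GlueData I Y hst) {F : UpperHalfPlane → D → ℂ}
    (hF : ∀ τ z w, Φ τ z w = G.downTensor (I.theta τ z w) (F τ)) :
    HolModular F ↔ HolJacobi Φ := by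
  have := Fr.finite_DOm hd
  have := Fintype.ofFinite I.DOm
  have hopen : IsOpen {p : ℂ × (Fin c → ℂ) × (Fin c → ℂ) | 0 < p.1.im} :=
    isOpen_lt continuous_const (by fun_prop)
  constructor
  · intro h p hp
    refine (differentiableAt_pi.2 fun β => ?_).differentiableWithinAt
    simp only [hF, G.downTensor_eq]
    refine DifferentiableAt.fun_sum fun γ _ => DifferentiableAt.mul ?_ (Fr.differentiableAt_theta hd γ hp)
    have h1 := differentiableAt_pi.1 (h.differentiableAt (isOpen_im_pos.mem_nhds hp))
    unfold GlueData.pull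
    refine DifferentiableAt.fun_sum fun x _ => ?_
    split_ifs
    · exact (h1 x).comp (f := fun p : ℂ × (Fin c → ℂ) × (Fin c → ℂ) => p.1) p (by fun_prop)
    · exact differentiableAt_const _
  · intro h t ht
    refine ((G.contDiffAt_of_downTensor (𝕜 := ℂ) (n := 1) Fr hd (fun z w γ => ?_)
      (fun z w β => ?_)).differentiableAt one_ne_zero).differentiableWithinAt
    · exact (contDiffOn_theta Fr hd 1 z w γ).contDiffAt (isOpen_im_pos.mem_nhds ht)
    · simp only [← hF]
      refine ContDiffOn.contDiffAt (s := {t | 0 < t.im}) ?_ (isOpen_im_pos.mem_nhds ht)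
      refine DifferentiableOn.contDiffOn (fun s hs => ?_) isOpen_im_pos
      have h1 := differentiableAt_pi.1 (h.differentiableAt (x := (s, z, w)) (hopen.mem_nhds hs)) β
      exact (h1.comp (f := fun t : ℂ => (t, z, w)) s (by fun_prop)).differentiableWithinAt

end

end HermJac

namespace HermJac

noncomputable section

variable {d c : ℕ} {Δ D : Type*} [AddCommGroup Δ] [Fintype Δ] [AddCommGroup D] [Fintype D]
  {X : DiscForm d Δ} {I : MatrixIndex d c X} {Y : DiscForm d D} {hst : I.KerStable}

/-! ### Expansions at a cusp -/

/-- Existence of a Fourier expansion `∑ C_{β,m,a} 𝐞(mτ + a^*Sz + w^tSa)`, with `C_{β,m,a} ≠ 0`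
only for `m ≥ a^*Sa`. -/
def CuspExpansion (I : MatrixIndex d c X)
    (V : UpperHalfPlane → (Fin c → ℂ) → (Fin c → ℂ) → Δ → ℂ) : Prop :=
  ∃ (N : ℕ) (C : Δ → ℤ → I.Lam → ℂ), 0 < N ∧
    (∀ β m a, C β m a ≠ 0 → I.lamNorm a ≤ (m : ℝ) / N) ∧
    ∀ (τ : UpperHalfPlane) (z w : Fin c → ℂ) (β : Δ), HasSum
      (fun p : ℤ × I.Lam => C β p.1 p.2 * cexpo ((p.1 : ℂ) / N * (τ : ℂ) + I.lamLin z w p.2))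
      (V τ z w β)

theorem end_apply_eq_sum {m : Type*} [Fintype m] [DecidableEq m] (L : Module.End ℂ (m → ℂ))
    (v : m → ℂ) (i : m) : L v i = ∑ j, L (Pi.single j 1) i * v j := by
  conv_lhs => rw [pi_eq_sum_univ' v, map_sum, Finset.sum_apply]
  refine Finset.sum_congr rfl fun j _ => ?_
  rw [map_smul, Pi.smul_apply, smul_eq_mul, mul_comm]

theorem CuspExpansion.map {V : UpperHalfPlane → (Fin c → ℂ) → (Fin c → ℂ) → Δ → ℂ}
    (h : CuspExpansion I V) (L : Module.End ℂ (Δ → ℂ)) :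
    CuspExpansion I fun τ z w => L (V τ z w) := by
  classical
  obtain ⟨N, C, hN, hC, hV⟩ := h
  refine ⟨N, fun β m a => ∑ β', L (Pi.single β' 1) β * C β' m a, hN, fun β m a h => ?_,
    fun τ z w β => ?_⟩
  · obtain ⟨β', -, hβ'⟩ := Finset.exists_ne_zero_of_sum_ne_zero h
    exact hC β' m a (right_ne_zero_of_mul hβ')
  · dsimp only
    rw [end_apply_eq_sum L]
    have h1 := hasSum_sum (s := Finset.univ) fun β' _ =>
      (hV τ z w β').mul_left (L (Pi.single β' 1) β)
    refine (congrArg (fun f => HasSum f _) (funext fun p => ?_)).mpr h1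
    rw [Finset.sum_mul]
    exact Finset.sum_congr rfl fun _ _ => by ring

theorem qParam_pow (N m : ℕ) (τ : ℂ) :
    Function.Periodic.qParam N τ ^ m = cexpo ((m : ℂ) / N * τ) := by
  rw [Function.Periodic.qParam, ← Complex.exp_nat_mul, cexpo]
  congr 1; push_cast; ring

theorem hasSum_mul_prod {α β : Type*} {f : α → ℂ} {g : β → ℂ} {s t : ℂ} (hf : HasSum f s)
    (hg : HasSum g t) : HasSum (fun p : α × β => f p.1 * g p.2) (s * t) :=
  hf.mul hg (summable_mul_of_summable_norm hf.summable.norm hg.summable.norm)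

theorem shift_injective {α : Type*} (e : α → ℤ) :
    Function.Injective fun p : ℕ × α => ((p.1 : ℤ) + e p.2, p.2) := by
  rintro ⟨m, a⟩ ⟨m', a'⟩ h
  obtain ⟨h1, h2⟩ := Prod.mk.inj h
  simp only at h1 h2
  subst h2
  rw [Int.ofNat_inj.1 (add_right_cancel h1)]

theorem hasSum_shift {α : Type*} (e : α → ℤ) (K : ℕ → α → ℂ) (E : ℤ → α → ℂ) {s : ℂ}
    (h : HasSum (fun p : ℕ × α => K p.1 p.2 * E (p.1 + e p.2) p.2) s) :
    HasSum (fun p : ℤ × α => (if e p.2 ≤ p.1 then K (p.1 - e p.2).toNat p.2 else 0)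
      * E p.1 p.2) s := by
  refine ((shift_injective e).hasSum_iff ?_).1 ?_
  · rintro ⟨p, a⟩ hp
    rw [if_neg, zero_mul]
    intro h
    refine hp ⟨((p - e a).toNat, a), Prod.ext ?_ rfl⟩
    change (((p - e a).toNat : ℕ) : ℤ) + e a = p
    rw [Int.toNat_of_nonneg (sub_nonneg.2 h), sub_add_cancel]
  · refine (congrArg (fun f => HasSum f _) (funext fun p => ?_)).mpr h
    have h5 : e p.2 ≤ (p.1 : ℤ) + e p.2 := by omega
    have h6 : ((p.1 : ℤ) + e p.2 - e p.2).toNat = p.1 := by omega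
    simp only [Function.comp_apply]
    rw [if_pos h5, h6]

theorem exists_qExpansion {F : UpperHalfPlane → D → ℂ} {N : ℕ} (hN : 0 < N)
    (hper : ∀ τ τ' : UpperHalfPlane, (τ' : ℂ) = τ + N → F τ' = F τ)
    (hhol : HolModular F) (hbdd : UpperHalfPlane.IsBoundedAtImInfty F) (x : D) :
    ∃ g : ℕ → ℂ, ∀ τ : UpperHalfPlane,
      HasSum (fun m : ℕ => g m * cexpo ((m : ℂ) / N * τ)) (F τ x) := by
  have hNr : (0 : ℝ) < N := by exact_mod_cast hN
  refine ⟨fun m => (UpperHalfPlane.qExpansion N fun τ => F τ x).coeff m, fun τ => ?_⟩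
  have h1 := UpperHalfPlane.hasSum_qExpansion (h := N) (f := fun τ => F τ x) hNr ?_ ?_ ?_ τ
  · simpa only [qParam_pow, smul_eq_mul] using h1
  · intro t
    by_cases ht : 0 < t.im
    · have ht' : 0 < (t + ((N : ℝ) : ℂ)).im := by simpa using ht
      rw [Function.comp_apply, Function.comp_apply, UpperHalfPlane.ofComplex_apply_of_im_pos ht,
        UpperHalfPlane.ofComplex_apply_of_im_pos ht', hper ⟨t, ht⟩ ⟨_, ht'⟩ (by simp)]
    · have ht' : (t + ((N : ℝ) : ℂ)).im ≤ 0 := by simpa using ht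
      rw [Function.comp_apply, Function.comp_apply,
        UpperHalfPlane.ofComplex_apply_of_im_nonpos (not_lt.1 ht),
        UpperHalfPlane.ofComplex_apply_of_im_nonpos ht']
  · rw [UpperHalfPlane.mdifferentiable_iff]
    exact fun t ht => differentiableWithinAt_pi.1 (hhol t ht) x
  · exact (Asymptotics.isBigO_pi.1 hbdd x)

/-- `↓_H(Θ ⊗ G)` has an expansion at `∞`, if `G` is holomorphic, periodic and bounded at `∞`. -/
theorem cuspExpansion_of_bounded (Fr : Frame I) (hd : 0 < d) (G : GlueData I Y hst)
    {F : UpperHalfPlane → D → ℂ} {N : ℕ} (hN : 0 < N) (hN' : ∀ a, ∃ e : ℤ, N * I.lamNorm a = e)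
    (hper : ∀ τ τ' : UpperHalfPlane, (τ' : ℂ) = τ + N → F τ' = F τ)
    (hhol : HolModular F) (hbdd : UpperHalfPlane.IsBoundedAtImInfty F) :
    CuspExpansion I fun τ z w => G.downTensor (I.theta τ z w) (F τ) := by
  classical
  have := Fr.finite_DOm hd
  have := Fintype.ofFinite I.DOm
  have hNr : (0 : ℝ) < N := by exact_mod_cast hN
  have hNc : (N : ℂ) ≠ 0 := by exact_mod_cast hN.ne'
  choose g hg using exists_qExpansion hN hper hhol hbdd
  choose e he using hN'
  have he' : ∀ a, ((e a : ℤ) : ℂ) = N * (I.lamNorm a : ℂ) := fun a => by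
    exact_mod_cast congrArg Complex.ofReal (he a).symm
  let ind : Δ → I.Lam → D → ℂ := fun β a x => if G.Rel (I.toD a) x β then 1 else 0
  let K : Δ → ℕ → I.Lam → ℂ := fun β m a => ∑ x, g x m * ind β a x
  refine ⟨N, fun β p a => if e a ≤ p then K β (p - e a).toNat a else 0, hN, fun β p a h => ?_,
    fun τ z w β => ?_⟩
  · have h1 : e a ≤ p := by
      by_contra h1; exact h (if_neg h1)
    rw [le_div_iff₀ hNr, mul_comm, he]
    exact_mod_cast h1
  · have h1 : ∀ x, HasSum (fun p : ℕ × I.Lam =>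
        (g x p.1 * cexpo ((p.1 : ℂ) / N * τ)) * (ind β p.2 x * I.lterm τ z w p.2))
        (F τ x * G.push (I.theta τ z w) β x) := by
      intro x
      have h2 : HasSum (fun a => ind β a x * I.lterm τ z w a) (G.push (I.theta τ z w) β x) := by
        have := Fr.hasSum_theta hd (fun γ => if G.Rel γ x β then 1 else 0) τ z w
        simpa only [GlueData.push, ite_mul, one_mul, zero_mul, ind] using this
      have h5 := hasSum_mul_prod (hg x τ) h2
      exact h5
    have h3 := hasSum_sum (s := Finset.univ) fun x _ => h1 x
    have h4 : ∑ x, F τ x * G.push (I.theta τ z w) β x = G.downTensor (I.theta τ z w) (F τ) β := by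
      rw [G.downTensor_eq_push]
      exact Finset.sum_congr rfl fun _ _ => mul_comm _ _
    rw [h4] at h3
    refine hasSum_shift e (K β)
      (fun p a => cexpo ((p : ℂ) / N * τ + I.lamLin z w a)) ?_
    refine (congrArg (fun f => HasSum f _) (funext fun p => ?_)).mpr h3
    have h7 : cexpo (((((p.1 : ℤ) + e p.2 : ℤ)) : ℂ) / N * τ + I.lamLin z w p.2)
        = cexpo ((p.1 : ℂ) / N * τ) * I.lterm τ z w p.2 := by
      rw [MatrixIndex.lterm, ← cexpo_add]
      congr 1
      push_cast
      rw [he']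
      field_simp
      ring
    rw [h7, Finset.sum_mul]
    exact Finset.sum_congr rfl fun x _ => by ring

/-- Conversely, `G` is bounded at `∞` if `↓_H(Θ ⊗ G)` has an expansion at `∞`. -/
theorem bounded_of_cuspExpansion (Fr : Frame I) (hd : 0 < d) (G : GlueData I Y hst)
    {F : UpperHalfPlane → D → ℂ}
    (h : CuspExpansion I fun τ z w => G.downTensor (I.theta τ z w) (F τ)) :
    UpperHalfPlane.IsBoundedAtImInfty F := by
  obtain ⟨N, C, hN, hC, hV⟩ := h
  have hlam0 : ∀ a, I.lamLin 0 0 a = 0 := fun a => by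
    have := lamLin_smul 0 0 0 a
    simpa using this
  refine Asymptotics.isBigO_pi.2 fun x => ?_
  obtain ⟨γ, β, hR⟩ := G.exists_rel_mid Fr hd x
  obtain ⟨a, rfl⟩ := Frame.toD_surjective I γ
  have hsw : ∀ (τ : UpperHalfPlane) (z w : Fin c → ℂ), HasSum (fun p : I.Lam × ℤ =>
      C β p.2 p.1 * cexpo ((p.2 : ℂ) / N * (τ : ℂ) + I.lamLin z w p.1))
      (G.downTensor (I.theta τ z w) (F τ) β) := fun τ z w =>
    (Equiv.prodComm I.Lam ℤ).hasSum_iff.2 (hV τ z w β)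
  have hfib : ∀ (τ : UpperHalfPlane) (b : I.Lam),
      Summable fun m : ℤ => C β m b * cexpo ((m : ℂ) / N * (τ : ℂ)) := by
    intro τ b
    have := (hsw τ 0 0).summable.prod_factor b
    simpa only [hlam0, add_zero] using this
  have hcoef : ∀ τ : UpperHalfPlane, F τ x * cexpo ((τ : ℂ) * (I.lamNorm a : ℂ))
      = ∑' m : ℤ, C β m a * cexpo ((m : ℂ) / N * (τ : ℂ)) := by
    intro τ
    have h1 := Fr.lam_coeff_unique hd (fun z w => G.hasSum_downTensor' Fr hd (F τ) τ z w β)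
      (f' := fun b => ∑' m : ℤ, C β m b * cexpo ((m : ℂ) / N * (τ : ℂ))) (fun z w => by
        refine (hsw τ z w).prod_fiberwise fun b => ?_
        simp only [cexpo_add, ← mul_assoc]
        exact (hfib τ b).hasSum.mul_right _)
    have h2 := congrFun h1 a
    rwa [GlueData.pull_of_rel _ hR] at h2
  have hF : ∀ τ : UpperHalfPlane, F τ x
      = ∑' m : ℤ, C β m a * cexpo (((m : ℂ) / N - I.lamNorm a) * (τ : ℂ)) := by
    intro τ
    have h1 := cexpo_ne_zero ((τ : ℂ) * (I.lamNorm a : ℂ))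
    rw [eq_div_of_mul_eq h1 (hcoef τ), div_eq_mul_inv, ← tsum_mul_right]
    refine tsum_congr fun m => ?_
    rw [mul_assoc, ← cexpo_neg, ← cexpo_add]
    congr 2; ring
  have hnorm : ∀ (τ : UpperHalfPlane) (m : ℤ),
      ‖C β m a * cexpo (((m : ℂ) / N - I.lamNorm a) * (τ : ℂ))‖
        = ‖C β m a‖ * Real.exp (-(2 * Real.pi * (((m : ℝ) / N - I.lamNorm a) * τ.im))) := by
    intro τ m
    have : (((m : ℂ) / N - I.lamNorm a) * (τ : ℂ)) =
      (((m : ℝ) / N - I.lamNorm a : ℝ) : ℂ) * τ := by push_cast; ring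
    rw [norm_mul, norm_cexpo, this, Complex.im_ofReal_mul, UpperHalfPlane.coe_im]
  have hsum : Summable fun m : ℤ =>
      ‖C β m a * cexpo (((m : ℂ) / N - I.lamNorm a) * (UpperHalfPlane.I : ℂ))‖ := by
    refine Summable.norm ?_
    refine ((hfib UpperHalfPlane.I a).mul_right
      (cexpo (-((UpperHalfPlane.I : ℂ) * (I.lamNorm a : ℂ))))).congr fun m => ?_
    rw [mul_assoc, ← cexpo_add]
    congr 2; ring
  refine UpperHalfPlane.isBoundedAtImInfty_iff.2 ⟨∑' m : ℤ,
    ‖C β m a * cexpo (((m : ℂ) / N - I.lamNorm a) * (UpperHalfPlane.I : ℂ))‖, 1,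
    fun τ hτ => ?_⟩
  rw [hF]
  refine tsum_of_norm_bounded hsum.hasSum fun m => ?_
  rw [hnorm, hnorm]
  by_cases h0 : C β m a = 0
  · simp [h0]
  · have h1 := sub_nonneg.2 (hC β m a h0)
    have h2 : UpperHalfPlane.I.im = 1 := by simp
    rw [h2]
    gcongr

/-! ### The slash operation on `↓_H(Θ ⊗ F)` -/

theorem isBoundedAtImInfty_end {D : Type*} [Fintype D] {V : UpperHalfPlane → D → ℂ}
    (h : UpperHalfPlane.IsBoundedAtImInfty V) (L : Module.End ℂ (D → ℂ)) :
    UpperHalfPlane.IsBoundedAtImInfty fun τ => L (V τ) := by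
  obtain ⟨M, A, hM⟩ := UpperHalfPlane.isBoundedAtImInfty_iff.1 h
  refine UpperHalfPlane.isBoundedAtImInfty_iff.2
    ⟨‖LinearMap.toContinuousLinearMap L‖ * M, A, fun τ hτ => ?_⟩
  refine ((LinearMap.toContinuousLinearMap L).le_opNorm (V τ)).trans ?_
  gcongr
  exact hM τ hτ

/-- `j(A,τ)^{-k} R F(Aτ)`. -/
def slashF (k : ℤ) (A : SL(2, ℤ)) (R : Module.End ℂ (D → ℂ)) (F : UpperHalfPlane → D → ℂ)
    (τ : UpperHalfPlane) : D → ℂ :=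
  R (((A 1 0 : ℂ) * (τ : ℂ) + (A 1 1 : ℂ)) ^ (-k) • F (A • τ))

theorem slashJ_eq {Φ : UpperHalfPlane → (Fin c → ℂ) → (Fin c → ℂ) → Δ → ℂ} (Fr : Frame I)
    (hd : 0 < d) (k : ℤ) (G : GlueData I Y hst) {F : UpperHalfPlane → D → ℂ}
    (hF : ∀ τ z w, Φ τ z w = G.downTensor (I.theta τ z w) (F τ)) {A : SL(2, ℤ)}
    {R Ri : Module.End ℂ (D → ℂ)} {R' : Module.End ℂ (Δ → ℂ)} (hRi : R * Ri = 1)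
    (hI : G.Inter (slToU d A) R R' 1) (τ : UpperHalfPlane) (z w : Fin c → ℂ) :
    slashJ I k A Φ τ z w
      = R' (G.downTensor (I.theta τ z w) (slashF (k - I.S.rank) A Ri F τ)) := by
  have := Fr.finite_DOm hd
  have := Fintype.ofFinite I.DOm
  have h1 := hI τ z w (slashF (k - I.S.rank) A Ri F τ)
  have h2 : ∀ v, R (Ri v) = v := fun v => LinearMap.congr_fun hRi v
  have hj := jfac_ne_zero (slToU d A) τ
  rw [slashF, h2, G.downTensor_smul_right, act_slToU, jcfac_slToU, ← jfac_slToU (d := d),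
    mat_slToU, ← hF] at h1
  rw [slashJ, ← jfac_slToU (d := d), slashF, ← jfac_slToU (d := d)]
  generalize jfac (slToU d A) (τ : ℂ) = j at *
  generalize Φ (A • τ) (j⁻¹ • z) (j⁻¹ • w) = V at *
  have h3 : V = j ^ (k - I.S.rank) • (j ^ (-(k - (I.S.rank : ℤ))) • V) := by
    rw [smul_smul, ← zpow_add₀ hj, add_neg_cancel, zpow_zero, one_smul]
  rw [h3, h1, smul_smul, smul_smul, one_mul]
  have h4 : j ^ (-k) * cexpo (-((A 1 0 : ℂ) * (w ⬝ᵥ (I.S *ᵥ z)) / j)) * j ^ (k - (I.S.rank : ℤ))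
      * (j ^ I.S.rank * cexpo ((A 1 0 : ℂ) * (w ⬝ᵥ (I.S *ᵥ z)) / j)) = 1 := by
    rw [cexpo_neg, ← zpow_natCast j I.S.rank]
    have e1 : j ^ (-k) * j ^ (k - (I.S.rank : ℤ)) * j ^ (I.S.rank : ℤ) = 1 := by
      rw [← zpow_add₀ hj, ← zpow_add₀ hj]; ring_nf; exact zpow_zero j
    have e2 := cexpo_ne_zero ((A 1 0 : ℂ) * (w ⬝ᵥ (I.S *ᵥ z)) / j)
    calc _ = (j ^ (-k) * j ^ (k - (I.S.rank : ℤ)) * j ^ (I.S.rank : ℤ))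
          * ((cexpo ((A 1 0 : ℂ) * (w ⬝ᵥ (I.S *ᵥ z)) / j))⁻¹
            * cexpo ((A 1 0 : ℂ) * (w ⬝ᵥ (I.S *ᵥ z)) / j)) := by ring
      _ = 1 := by rw [e1, inv_mul_cancel₀ e2, one_mul]
  rw [h4, one_smul]

/-- The order of `ρ_D(T)` divides `|D|²`. -/
theorem DiscForm.weilT_pow (Y : DiscForm d D) : Y.weilT ^ (Fintype.card D * Fintype.card D) = 1 := by
  have h1 : ∀ (m : ℕ) (v : D → ℂ) (γ : D), (Y.weilT ^ m) v γ = qexpo (Y.q γ) ^ m * v γ := by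
    intro m
    induction m with
    | zero => intro v γ; simp
    | succ m ih =>
      intro v γ
      rw [pow_succ, Module.End.mul_apply, ih, Y.weilT_apply, pow_succ, mul_assoc]
  refine LinearMap.ext fun v => funext fun γ => ?_
  rw [h1, Module.End.one_apply]
  have h2 : ∀ m : ℕ, qexpo (Y.q γ) ^ m = qexpo (m • Y.q γ) := by
    intro m
    induction m with
    | zero => simp [qexpo_zero]
    | succ m ih => rw [pow_succ, ih, succ_nsmul, qexpo_add]
  have h3 : (Fintype.card D * Fintype.card D) • Y.q γ = 0 := by
    have h4 := QuadraticMap.map_smul Y.q (Fintype.card D : ℤ) γ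
    have h5 : (Fintype.card D : ℤ) • γ = 0 := by rw [natCast_zsmul]; exact card_nsmul_eq_zero
    rw [h5, QuadraticMap.map_zero] at h4
    rw [← natCast_zsmul, Nat.cast_mul]
    exact h4.symm
  rw [h2, h3, qexpo_zero, one_mul]

/-- The norms `a^*Sa` of the classes in `Ω^* / ker S` have bounded denominators. -/
theorem exists_lamNorm_denominator [Finite I.DOm] :
    ∃ M : ℕ, 0 < M ∧ ∀ a : I.Lam, ∃ e : ℤ, M * I.lamNorm a = e := by
  have := Fintype.ofFinite I.DOm
  refine ⟨Fintype.card I.DOm * Fintype.card I.DOm, Nat.mul_pos Fintype.card_pos Fintype.card_pos,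
    fun a => ?_⟩
  have h4 := QuadraticMap.map_smul I.qOm (Fintype.card I.DOm : ℤ) (I.toD a)
  have h5 : (Fintype.card I.DOm : ℤ) • I.toD a = 0 := by
    rw [natCast_zsmul]; exact card_nsmul_eq_zero
  rw [h5, QuadraticMap.map_zero] at h4
  have h6 : I.qOm (I.toD a) = ((I.lamNorm a : ℝ) : UnitAddCircle) := by
    induction a using QuotientAddGroup.induction_on with
    | H a => rfl
  rw [h6] at h4
  have h7 : ((((Fintype.card I.DOm : ℤ) * (Fintype.card I.DOm : ℤ)) • I.lamNorm a : ℝ) :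
      UnitAddCircle) = 0 := h4.symm
  obtain ⟨e, he⟩ := (AddCircle.coe_eq_zero_iff (1 : ℝ)).1 h7
  refine ⟨e, ?_⟩
  simp only [zsmul_eq_mul, mul_one] at he
  rw [he]
  push_cast
  rfl

/-- Periodicity at a cusp. -/
theorem exists_period {Γ : Subgroup (U11 d)} (hΓ : Γ.FiniteIndex) {k : ℤ}
    {F : UpperHalfPlane → D → ℂ} (hF : IsModularForm Y Γ k F) {A : SL(2, ℤ)}
    {R Ri : Module.End ℂ (D → ℂ)} (hR : (slToU d A, R) ∈ Y.weilGraph)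
    (hRi : ((slToU d A)⁻¹, Ri) ∈ Y.weilGraph) (h1 : Ri * R = 1) :
    ∃ N : ℕ, 0 < N ∧ ∀ τ τ' : UpperHalfPlane, (τ' : ℂ) = τ + N →
      slashF k A Ri F τ' = slashF k A Ri F τ := by
  have hRiR : ∀ v, Ri (R v) = v := fun v => LinearMap.congr_fun h1 v
  set T := slToU d ModularGroup.T with hT
  have hTg : (T, Y.weilT) ∈ Y.weilGraph := DiscForm.mem_weilGraph_T mat_slToU_T
  obtain ⟨n, hn, -, hmem⟩ := Subgroup.exists_pow_mem_of_index_ne_zero hΓ.index_ne_zero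
    (slToU d A * T * (slToU d A)⁻¹)
  set m := Fintype.card D * Fintype.card D with hm
  have hm0 : 0 < m := Nat.mul_pos Fintype.card_pos Fintype.card_pos
  refine ⟨n * m, Nat.mul_pos hn hm0, fun τ τ' hτ => ?_⟩
  have hB : slToU d A * T ^ (n * m) * (slToU d A)⁻¹ ∈ Γ := by
    rw [← conj_pow, pow_mul]; exact pow_mem hmem m
  have hTm : Y.weilT ^ (n * m) = 1 := by rw [mul_comm, pow_mul, Y.weilT_pow, one_pow]
  have hBg : (slToU d A * T ^ (n * m) * (slToU d A)⁻¹, R * Y.weilT ^ (n * m) * Ri)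
      ∈ Y.weilGraph := by
    have := mul_mem (mul_mem hR (pow_mem hTg (n * m))) hRi
    rwa [Prod.pow_mk, Prod.mk_mul_mk, Prod.mk_mul_mk] at this
  have hact : act (T ^ (n * m)) τ = τ' := by
    apply UpperHalfPlane.ext
    rw [hT, ← map_pow, act_slToU, hτ, ← zpow_natCast, ModularGroup.coe_T_zpow_smul_eq]
    push_cast; rfl
  have hjT : jfac (T ^ (n * m)) τ = 1 := by
    rw [hT, ← map_pow, jfac_slToU, ← zpow_natCast, ModularGroup.coe_T_zpow]; simp
  have e1 : act (slToU d A * T ^ (n * m) * (slToU d A)⁻¹) (A • τ) = A • τ' := by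
    rw [← act_slToU (d := d), ← act_mul, inv_mul_cancel_right, act_mul, hact, act_slToU]
  have e2 : jfac (slToU d A * T ^ (n * m) * (slToU d A)⁻¹) (A • τ : UpperHalfPlane)
      * jfac (slToU d A) τ = jfac (slToU d A) τ' := by
    rw [← act_slToU (d := d), ← jfac_mul, inv_mul_cancel_right, jfac_mul, hact, hjT, mul_one]
  have h2 := hF.modular _ hB _ hBg (A • τ)
  rw [e1, hTm, mul_one] at h2
  have hRRi : (R * Ri) (F (A • τ)) = R (Ri (F (A • τ))) := rfl
  rw [slashF, slashF, ← jfac_slToU (d := d), ← jfac_slToU (d := d), h2, hRRi, ← e2, map_smul, map_smul,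
    hRiR, map_smul, smul_smul]
  congr 1
  have hj := jfac_ne_zero (slToU d A * T ^ (n * m) * (slToU d A)⁻¹) (A • τ)
  rw [mul_zpow, mul_right_comm, ← zpow_add₀ hj, neg_add_cancel, zpow_zero, one_mul]

theorem holModular_slashF (k : ℤ) (A : SL(2, ℤ)) (R : Module.End ℂ (D → ℂ))
    {F : UpperHalfPlane → D → ℂ} (hF : HolModular F) : HolModular (slashF k A R F) := by
  intro t ht
  refine DifferentiableAt.differentiableWithinAt ?_
  have hj : ((A 1 0 : ℂ) * t + (A 1 1 : ℂ)) ≠ 0 := by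
    have := jfac_ne_zero (slToU 1 A) ⟨t, ht⟩
    rwa [jfac_slToU] at this
  have him : 0 < (((A 0 0 : ℂ) * t + (A 0 1 : ℂ)) / ((A 1 0 : ℂ) * t + (A 1 1 : ℂ))).im := by
    have := (A • (⟨t, ht⟩ : UpperHalfPlane)).im_pos
    rw [← UpperHalfPlane.coe_im, UpperHalfPlane.coe_specialLinearGroup_apply] at this
    simpa using this
  have h1 : DifferentiableAt ℂ (fun t : ℂ => LinearMap.toContinuousLinearMap R
      (((A 1 0 : ℂ) * t + (A 1 1 : ℂ)) ^ (-k) • F (UpperHalfPlane.ofComplex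
        (((A 0 0 : ℂ) * t + (A 0 1 : ℂ)) / ((A 1 0 : ℂ) * t + (A 1 1 : ℂ)))))) t := by
    refine (ContinuousLinearMap.differentiableAt _).comp t (DifferentiableAt.fun_smul ?_ ?_)
    · exact DifferentiableAt.zpow (by fun_prop) (Or.inl hj)
    · have h2 := hF.differentiableAt (isOpen_im_pos.mem_nhds him)
      refine h2.comp (f := fun t : ℂ =>
        ((A 0 0 : ℂ) * t + (A 0 1 : ℂ)) / ((A 1 0 : ℂ) * t + (A 1 1 : ℂ))) t ?_
      exact DifferentiableAt.div (by fun_prop) (by fun_prop) hj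
  refine h1.congr_of_eventuallyEq ?_
  filter_upwards [isOpen_im_pos.mem_nhds ht] with s hs
  have hs' : UpperHalfPlane.ofComplex s = ⟨s, hs⟩ := UpperHalfPlane.ofComplex_apply_of_im_pos hs
  have h3 : A • (⟨s, hs⟩ : UpperHalfPlane) = UpperHalfPlane.ofComplex
      (((A 0 0 : ℂ) * s + (A 0 1 : ℂ)) / ((A 1 0 : ℂ) * s + (A 1 1 : ℂ))) := by
    have h4 := UpperHalfPlane.ofComplex_apply (A • (⟨s, hs⟩ : UpperHalfPlane))
    rw [UpperHalfPlane.coe_specialLinearGroup_apply] at h4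
    rw [← h4]
    simp
  rw [hs', slashF, h3]
  rfl

/-- The cusp conditions for `F` and for `↓_H(Θ ⊗ F)` are equivalent. -/
theorem bddAtCusps_iff {Γ : Subgroup (U11 d)} (hΓ : Γ.FiniteIndex) {k : ℤ}
    {Φ : UpperHalfPlane → (Fin c → ℂ) → (Fin c → ℂ) → Δ → ℂ} (Fr : Frame I)
    (hd : 0 < d) (hd4 : d % 4 = 0 ∨ d % 4 = 3) (G : GlueData I Y hst) {F : UpperHalfPlane → D → ℂ}
    (hF : ∀ τ z w, Φ τ z w = G.downTensor (I.theta τ z w) (F τ))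
    (hmod : IsModularForm Y Γ (k - I.S.rank) F) (hhol : HolModular F) :
    BddAtCusps (k - I.S.rank) F ↔ HolAtCusps I k Φ := by
  have := Fr.finite_DOm hd
  refine forall_congr' fun A => ?_
  obtain ⟨R, hR⟩ := DiscForm.exists_mem_weilGraph_slToU Y A
  obtain ⟨⟨B, Ri⟩, hRi, h1, h2⟩ := DiscForm.exists_inv_mem_weilGraph hR
  rw [Prod.mk_mul_mk, Prod.mk_eq_one] at h1 h2
  obtain ⟨R', hR', hI⟩ := G.exists_inter Fr hd hd4 hR
  obtain ⟨⟨B', Ri'⟩, -, h1', h2'⟩ := DiscForm.exists_inv_mem_weilGraph hR'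
  rw [Prod.mk_mul_mk, Prod.mk_eq_one] at h1' h2'
  rw [← inv_eq_of_mul_eq_one_right h1.1] at hRi
  have hslash : slashJ I k A Φ = fun τ z w =>
      R' (G.downTensor (I.theta τ z w) (slashF (k - I.S.rank) A Ri F τ)) := by
    funext τ z w
    exact slashJ_eq Fr hd k G hF h1.2 hI τ z w
  change _ ↔ CuspExpansion I (slashJ I k A Φ)
  rw [hslash]
  constructor
  · intro h
    refine CuspExpansion.map ?_ R'
    obtain ⟨N, hN, hper⟩ := exists_period hΓ hmod hR hRi h2.2
    obtain ⟨M, hM, hden⟩ := exists_lamNorm_denominator (I := I)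
    refine cuspExpansion_of_bounded Fr hd G (N := N * M) (Nat.mul_pos hN hM) (fun a => ?_) ?_
      (holModular_slashF _ A Ri hhol) (isBoundedAtImInfty_end h Ri)
    · obtain ⟨e, he⟩ := hden a
      refine ⟨N * e, ?_⟩
      push_cast
      rw [mul_assoc, he]
    · intro τ τ' hτ
      have : ∀ (m : ℕ) (τ τ' : UpperHalfPlane), (τ' : ℂ) = τ + (N * m : ℕ) →
          slashF (k - I.S.rank) A Ri F τ' = slashF (k - I.S.rank) A Ri F τ := by
        intro m
        induction m with
        | zero =>
          intro τ τ' h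
          congr 1
          apply UpperHalfPlane.ext
          simpa using h
        | succ m ih =>
          intro τ τ' h
          have him : 0 < ((τ : ℂ) + (N * m : ℕ)).im := by
            rw [Complex.add_im, Complex.natCast_im, add_zero]; exact τ.im_pos
          rw [hper ⟨_, him⟩ τ' (by rw [h]; push_cast; ring), ih τ ⟨_, him⟩ rfl]
      exact this M τ τ' hτ
  · intro h
    have h3 : CuspExpansion I fun τ z w =>
        G.downTensor (I.theta τ z w) (slashF (k - I.S.rank) A Ri F τ) := by
      have h4 := h.map Ri'
      have h5 : ∀ v, Ri' (R' v) = v := fun v => LinearMap.congr_fun h2'.2 v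
      simpa only [h5] using h4
    have h6 := isBoundedAtImInfty_end (bounded_of_cuspExpansion Fr hd G h3) R
    have h7 : ∀ v, R (Ri v) = v := fun v => LinearMap.congr_fun h1.2 v
    simpa only [slashF, h7] using h6

end

end HermJac

theorem mainTheorem5 (d c : ℕ) (hd : 0 < d) (hd4 : d % 4 = 0 ∨ d % 4 = 3)
    {Δ D : Type*} [AddCommGroup Δ] [Fintype Δ] [AddCommGroup D] [Fintype D]
    (X : HermJac.DiscForm d Δ) (I : HermJac.MatrixIndex d c X)
    (hst : I.KerStable) (hproj : Module.Projective (HermJac.qOrder d) (I.OmBar hst))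
    (Y : HermJac.DiscForm d D) (G : HermJac.GlueData I Y hst)
    (Γ : Subgroup (HermJac.U11 d)) (hΓ : Γ.FiniteIndex) (k : ℤ)
    (Φ : UpperHalfPlane → (Fin c → ℂ) → (Fin c → ℂ) → Δ → ℂ)
    (hΦ : HermJac.IsHermitianJacobiForm I Γ k Φ) :
    ∃ F : UpperHalfPlane → D → ℂ,
      (HermJac.IsModularForm Y Γ (k - I.S.rank) F ∧
        ∀ (τ : UpperHalfPlane) (z w : Fin c → ℂ),
          Φ τ z w = G.downTensor (I.theta τ z w) (F τ)) ∧
      (∀ F' : UpperHalfPlane → D → ℂ,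
        (HermJac.IsModularForm Y Γ (k - I.S.rank) F' ∧
          ∀ (τ : UpperHalfPlane) (z w : Fin c → ℂ),
            Φ τ z w = G.downTensor (I.theta τ z w) (F' τ)) → F' = F) ∧
      (HermJac.HolModular F ↔ HermJac.HolJacobi Φ) ∧
      ((HermJac.HolModular F ∧ HermJac.BddAtCusps (k - I.S.rank) F) ↔
        (HermJac.HolJacobi Φ ∧ HermJac.HolAtCusps I k Φ)) := by
  obtain ⟨Fr⟩ := HermJac.nonempty_frame hd4 I
  obtain ⟨F, hgr, hF⟩ := hΦ.exists_eq_downTensor Fr hd G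
  have hmod : HermJac.IsModularForm Y Γ (k - I.S.rank) F :=
    { smooth := HermJac.smooth_of_eq_downTensor hΦ Fr hd G hF
      modular := fun _ hA _ hR τ => HermJac.modular_of_eq_downTensor hΦ Fr hd hd4 G hF hA hR τ
      growth := hgr }
  have hhol := HermJac.holJacobi_iff Fr hd G hF
  refine ⟨F, ⟨hmod, hF⟩, fun F' hF' => ?_, hhol, ?_⟩
  · funext τ
    exact G.downTensor_theta_injective Fr hd τ fun z w => by rw [← hF'.2, hF]
  · rw [← hhol]
    exact and_congr_right fun h => HermJac.bddAtCusps_iff hΓ Fr hd hd4 G hF hmod h
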